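/- **Setting.** Let $T=\bigcup_{n\ge 0}\{0,1\}^n$ be the infinite complete binary tree with root $\partial$. Let $T^\infty\supset T$ be the tree obtained by adding a line of ancestors $u_{-j}=\mathrm p^j(\partial)$, $j\ge1$ ($u_0=\partial$), and grafting on each $u_{-j}$, $j\geq 1$, a copy of $T$ whose root $\partial^{(j)}$ becomes the second child of $u_{-j}$; every vertex $u$ of $T^\infty$ has one parent $\mathrm p(u)$ and two children. Let $\mathcal U=(\mathcal U_{(-j)})_{j\ge0}$ be independent Bernoulli$(1/2)$ bits with law $\mathbb P_{\mathcal U}$; for $j\ge0$, $u_{-j}$ is the left child of $u_{-j-1}$ if $\mathcal U_{(-j)}=0$ and the right child otherwise (inside $T$ and its copies the order of the children is the usual one). Let $<_{\mathcal U}$ be the breadth-first order of the resulting plane tree, and for $k\ge0$ let $\Delta^*(u,k)$ be the set of descendants $v$ of $\mathrm p^k(u)$ (including $\mathrm p^k(u)$ itself) with $v<_{\mathcal U}u$, and $\Delta(u,k)=\Delta^*(u,k)\cup\{u\}$. Let $\mathcal X,\mathcal Y$ be metric spaces with their Borel $\sigma$-fields, $\Theta\subset\mathbb R^d$ and $\theta^\star\in\Theta$.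 For $\theta\in\Theta$ let $Q_\theta$ be a probability kernel on $\mathcal X$, $G_\theta$ a probability kernel from $\mathcal X$ to $\mathcal Y$, and $\nu_\theta$ a probability measure on $\mathcal X$. Let $(X,Y)=((X_u,Y_u))_{u\in T^\infty}$ be, under $\mathbb P_\theta$, a hidden Markov tree process: for each $k,n\ge 0$, on the finite subtree $S$ of the descendants of $r=\mathrm p^k(\partial)$ at distance at most $n$ from $r$, the law of $X_S$ is $\nu_\theta(\mathrm dx_{r})\prod_{u\in S\setminus\{r\}}Q_\theta(x_{\mathrm p(u)};\mathrm dx_u)$, and given $X_S$ the variables $Y_u$, $u\in S$, are independent with laws $G_\theta(X_u;\cdot)$. $\mathbb E_\theta$ is the expectation under $\mathbb P_\theta$. **Assumptions.** 1. (Stationarity) $\nu_\theta Q_\theta=\nu_\theta$ for every $\theta\in\Theta$. 2. (Domination) There are a probability measure $\lambda$ on $\mathcal X$ and a $\sigma$-finite measure $\mu$ on $\mathcal Y$ such that, for all $\theta,x$, $Q_\theta(x;\mathrm dx')=q_\theta(x,x')\lambda(\mathrm dx')$ and $G_\theta(x;\mathrm dy)=g_\theta(x,y)\mu(\mathrm dy)$,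 with nonnegative jointly measurable densities $q_\theta$, $g_\theta$. 3. (Regularity) There are $0<\sigma^-\le\sigma^+<\infty$ with $\sigma^-\le q_\theta(x,x')\le\sigma^+$ for all $\theta,x,x'$; for every $y$, $\int g_\theta(x,y)\lambda(\mathrm dx)$ is bounded away from $0$ and $\infty$ uniformly in $\theta$; and $g_\theta(x,y)>0$ for all $\theta,x,y$. 4. ($L^1$ regularity) $\sup_{\theta,x,y}g_\theta(x,y)<\infty$ and $\mathbb E_{\theta^\star}|\log b^-(Y_\partial)|<\infty$, where $b^-(y)=\inf_\theta\int g_\theta(x,y)\lambda(\mathrm dx)$. 5. ($L^2$ regularity) $\mathbb E_{\theta^\star}[(\log b^-(Y_\partial))^2]<\infty$. **Contrast function.** For a finite subtree $\Delta$ of $T^\infty$ with root $w$ put $$p_\theta(y_\Delta\mid X_w=x)=g_\theta(x,y_w)\int\prod_{v\in\Delta\setminus\{w\}}q_\theta(x_{\mathrm p(v)},x_v)\,g_\theta(x_v,y_v)\,\lambda(\mathrm dx_v),\qquad x_w=x,$$ and $p_\theta(y_\emptyset\mid X_w=x)=1$. For $k\ge0$ and $x\in\mathcal X$ let $$\mathrm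 h_{\partial,k,x}(\theta)=\log\frac{p_\theta(Y_{\Delta(\partial,k)}\mid X_{\mathrm p^k(\partial)}=x)}{p_\theta(Y_{\Delta^*(\partial,k)}\mid X_{\mathrm p^k(\partial)}=x)}.$$ **Proposition.** For every $\theta\in\Theta$ there is $\mathrm h_{\partial,\infty}(\theta)\in L^1(\mathbb P_{\mathcal U}\otimes\mathbb P_{\theta^\star})$ such that, for all $x\in\mathcal X$, $\mathrm h_{\partial,k,x}(\theta)\to\mathrm h_{\partial,\infty}(\theta)$ as $k\to\infty$, $\mathbb P_{\mathcal U}\otimes\mathbb P_{\theta^\star}$-almost surely and in $L^1(\mathbb P_{\mathcal U}\otimes\mathbb P_{\theta^\star})$; so the contrast function $\ell(\theta)=\mathbb E_{\mathcal U}\otimes\mathbb E_{\theta^\star}[\mathrm h_{\partial,\infty}(\theta)]$ is well defined. A parameter $\theta\in\Theta$ is a global maximum of $\ell$ over $\Theta$ if and only if $\theta$ is equivalent to $\theta^\star$, that is, the process $(Y_u)_{u\in T}$ has the same law under $\mathbb P_\theta$ and under $\mathbb P_{\theta^\star}$. -/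

import Mathlib

open MeasureTheory ProbabilityTheory Filter Topology
open scoped ENNReal

/-! Hidden Markov models indexed by the binary tree, with an infinite past. -/

namespace HMT

/-! ### The extended binary tree -/

/-- The extended binary tree `T^∞`, as a non-plane tree. `node 0 w` is the vertex of the infinite
complete binary tree `T` with word `w` (written from the last letter to the first, so that
`node 0 (b :: w)` is the `b`-th child of `node 0 w`); `spine j` is the ancestor `u_{-(j+1)}` of the
root of `T`; `node (j+1) w` is the vertex with word `w` of the copy of `T` that is grafted on
`u_{-(j+1)} = spine j`. -/
inductive Vertex : Type
  | node (j : ℕ) (w : List Bool) : Vertex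
  | spine (j : ℕ) : Vertex
  deriving DecidableEq

namespace Vertex

/-- The vertex `∂`, root of the complete binary tree `T`. -/
def root : Vertex := node 0 []

/-- The parent of a vertex; every vertex of the extended tree has one. -/
def parent : Vertex → Vertex
  | node j (_ :: w) => node j w
  | node 0 [] => spine 0
  | node (j + 1) [] => spine j
  | spine j => spine (j + 1)

/-- An enumeration of the two children of a vertex (not the plane order, which is random). -/
def child : Vertex → Bool → Vertex
  | node j w, b => node j (b :: w)
  | spine 0, false => root
  | spine (j + 1), false => spine j
  | spine j, true => node (j + 1) []

theorem parent_child (v : Vertex) (b : Bool) : parent (child v b) = v := by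
  rcases v with ⟨j, w⟩ | ⟨_ | j⟩ <;> cases b <;> rfl

theorem exists_child_parent (v : Vertex) : ∃ b, child (parent v) b = v := by
  rcases v with ⟨_ | j, _ | ⟨b, w⟩⟩ | j
  · exact ⟨false, rfl⟩
  · exact ⟨b, rfl⟩
  · exact ⟨true, by cases j <;> rfl⟩
  · exact ⟨b, rfl⟩
  · exact ⟨false, rfl⟩

/-- The height of a vertex; the root `∂` has height `0`, its `j`-th ancestor height `-j`. -/
def height : Vertex → ℤ
  | node 0 w => w.length
  | node (j + 1) w => w.length - j
  | spine j => -(j + 1)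

theorem height_parent (v : Vertex) : height (parent v) = height v - 1 := by
  rcases v with ⟨_ | j, _ | ⟨b, w⟩⟩ | j <;> simp [height, parent] <;> ring

/-- The subtree `T^∞(v, n)`: the descendants of `v` at distance at most `n` from `v`. -/
def subtree : ℕ → Vertex → Finset Vertex
  | 0, v => {v}
  | n + 1, v => insert v (subtree n (child v false) ∪ subtree n (child v true))

/-- The label of a vertex in the plane embedding given by `U`: `false` for a left child, `true` for
a right child. Here `U j` is the bit `𝒰_{(-j)}`, which is the label of the `j`-th ancestor of `∂`
(`j = 0` being `∂` itself); the sibling of that vertex has the opposite label. -/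
def label (U : ℕ → Bool) : Vertex → Bool
  | node _ (b :: _) => b
  | node 0 [] => U 0
  | node (j + 1) [] => !(U j)
  | spine j => U (j + 1)

/-- The strict breadth-first order `u <_U v` of the plane tree: smaller height, or equal heights and
smaller path from the most recent common ancestor in the lexicographic order. The two paths have
equal length and already differ at their first letter, which is `0` for `u` and `1` for `v`. -/
def bfsLT (U : ℕ → Bool) (u v : Vertex) : Prop :=
  height u < height v ∨
    (height u = height v ∧ ∃ n : ℕ, parent^[n + 1] u = parent^[n + 1] v ∧
      label U (parent^[n] u) = false ∧ label U (parent^[n] v) = true)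

open Classical in
/-- `Δ*_U(u, k) = {v ∈ T^∞(p^k(u)) : v <_U u}`. (Such a vertex `v` is at distance at most `k`
from `p^k(u)`.) -/
noncomputable def pastStar (U : ℕ → Bool) (u : Vertex) (k : ℕ) : Finset Vertex :=
  (subtree k (parent^[k] u)).filter fun v => bfsLT U v u

/-- `Δ_U(u, k) = Δ*_U(u, k) ∪ {u}`. -/
noncomputable def past (U : ℕ → Bool) (u : Vertex) (k : ℕ) : Finset Vertex :=
  insert u (pastStar U u k)

end Vertex

open Vertex

/-- The law of the random bits `𝒰`: independent, Bernoulli with parameter `1/2`. -/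
noncomputable def spineLaw : Measure (ℕ → Bool) :=
  Measure.infinitePi fun _ => (PMF.uniformOfFintype Bool).toMeasure

instance : IsProbabilityMeasure spineLaw := by
  unfold spineLaw; infer_instance

/-! ### Branching Markov processes and hidden Markov tree processes -/

section Processes

variable {𝒳 𝒴 Ω : Type*} [MeasurableSpace 𝒳] [MeasurableSpace 𝒴] [MeasurableSpace Ω]

/-- The iterated integral
`∫ 1_{A_v}(x) ∏_{u ∈ T^∞(v,n) ∖ {v}} 1_{A_u}(x_u) Q(x_{p(u)}; dx_u)`, where `x_v = x` is fixed. -/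
noncomputable def branchMass (Q : Kernel 𝒳 𝒳) (A : Vertex → Set 𝒳) : ℕ → Vertex → 𝒳 → ℝ≥0∞
  | 0, v, x => (A v).indicator 1 x
  | n + 1, v, x => (A v).indicator 1 x * ∏ b : Bool, ∫⁻ x', branchMass Q A n (child v b) x' ∂(Q x)

/-- The restriction of `X` to the descendants of `r` is a branching Markov process with root `r`,
transition kernel `Q` and initial distribution `ν`: on every finite subtree `T^∞(r, n)` its law is
`ν(dx_r) ∏_{u ≠ r} Q(x_{p(u)}; dx_u)`. (A finite-dimensional law is given by its values on
measurable rectangles.) -/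
structure IsBranchingMarkov (r : Vertex) (Q : Kernel 𝒳 𝒳) (ν : Measure 𝒳)
    (X : Vertex → Ω → 𝒳) (P : Measure Ω) : Prop where
  measurable : ∀ v, Measurable (X v)
  law : ∀ (n : ℕ) (A : Vertex → Set 𝒳), (∀ v, MeasurableSet (A v)) →
    P {ω | ∀ v ∈ subtree n r, X v ω ∈ A v} = ∫⁻ x, branchMass Q A n r x ∂ν

/-- The restriction of `(X, Y)` to the descendants of `r` is a hidden Markov tree process with root
`r` and parameter `(Q, G, ν)`: `X` is a branching Markov process and, conditionally on `X` on the
subtree `T^∞(r, n)`, the variables `Y_v` are independent with laws `G(X_v; ·)`. -/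
structure IsHMT (r : Vertex) (Q : Kernel 𝒳 𝒳) (G : Kernel 𝒳 𝒴) (ν : Measure 𝒳)
    (X : Vertex → Ω → 𝒳) (Y : Vertex → Ω → 𝒴) (P : Measure Ω) : Prop where
  hidden : IsBranchingMarkov r Q ν X P
  measurable : ∀ v, Measurable (Y v)
  observed : ∀ (n : ℕ) (A : Vertex → Set 𝒳) (B : Vertex → Set 𝒴),
    (∀ v, MeasurableSet (A v)) → (∀ v, MeasurableSet (B v)) →
    P {ω | ∀ v ∈ subtree n r, X v ω ∈ A v ∧ Y v ω ∈ B v} =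
      ∫⁻ ω, ∏ v ∈ subtree n r, (A v).indicator 1 (X v ω) * G (X v ω) (B v) ∂P

/-- `(X, Y)` is a stationary hidden Markov tree process on the whole extended tree: the initial
distribution `ν` is invariant for `Q` and, seen from each ancestor `p^k(∂)`, the process is a hidden
Markov tree process with parameter `(Q, G, ν)`. -/
structure IsStationaryHMT (Q : Kernel 𝒳 𝒳) (G : Kernel 𝒳 𝒴) (ν : Measure 𝒳)
    (X : Vertex → Ω → 𝒳) (Y : Vertex → Ω → 𝒴) (P : Measure Ω) : Prop where
  invariant : Kernel.Invariant Q ν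
  isHMT : ∀ k : ℕ, IsHMT (parent^[k] root) Q G ν X Y P

end Processes

/-! ### Assumptions on the family of models -/

section Assumptions

variable {Θ 𝒳 𝒴 : Type*} [MeasurableSpace 𝒳] [MeasurableSpace 𝒴]

/-- Fully dominated model, with transition densities `q` and observation densities `g`. -/
structure FullyDominated (Q : Θ → Kernel 𝒳 𝒳) (G : Θ → Kernel 𝒳 𝒴) (lam : Measure 𝒳)
    (μ : Measure 𝒴) (q : Θ → 𝒳 → 𝒳 → ℝ) (g : Θ → 𝒳 → 𝒴 → ℝ) : Prop where
  measurable_q : ∀ θ, Measurable fun p : 𝒳 × 𝒳 => q θ p.1 p.2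
  nonneg_q : ∀ θ x x', 0 ≤ q θ x x'
  density_q : ∀ θ x, Q θ x = lam.withDensity fun x' => ENNReal.ofReal (q θ x x')
  measurable_g : ∀ θ, Measurable fun p : 𝒳 × 𝒴 => g θ p.1 p.2
  nonneg_g : ∀ θ x y, 0 ≤ g θ x y
  density_g : ∀ θ x, G θ x = μ.withDensity fun y => ENNReal.ofReal (g θ x y)

/-- Regularity of the densities. (In `integral_g`, a non-integrable function would have integral
`0`, which the positive lower bound excludes.) -/
structure Regular (lam : Measure 𝒳) (q : Θ → 𝒳 → 𝒳 → ℝ) (g : Θ → 𝒳 → 𝒴 → ℝ) : Prop where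
  bounded_q : ∃ σm σp : ℝ, 0 < σm ∧ ∀ θ x x', σm ≤ q θ x x' ∧ q θ x x' ≤ σp
  integral_g : ∀ y, ∃ c C : ℝ, 0 < c ∧ ∀ θ, c ≤ ∫ x, g θ x y ∂lam ∧ ∫ x, g θ x y ∂lam ≤ C
  pos_g : ∀ θ x y, 0 < g θ x y

/-- `b⁻(y) = inf_θ ∫ g_θ(x, y) λ(dx)`. -/
noncomputable def bMinus (lam : Measure 𝒳) (g : Θ → 𝒳 → 𝒴 → ℝ) (y : 𝒴) : ℝ :=
  ⨅ θ, ∫ x, g θ x y ∂lam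

/-- `L¹` regularity; `P` is the law under the true parameter and `Y₀` the observation at the
root. -/
structure L1Regular {Ω : Type*} [MeasurableSpace Ω] (lam : Measure 𝒳) (g : Θ → 𝒳 → 𝒴 → ℝ)
    (Y₀ : Ω → 𝒴) (P : Measure Ω) : Prop where
  bounded_g : ∃ b : ℝ, ∀ θ x y, g θ x y ≤ b
  integrable_log : Integrable (fun ω => Real.log (bMinus lam g (Y₀ ω))) P

/-- `L²` regularity. -/
def L2Regular {Ω : Type*} [MeasurableSpace Ω] (lam : Measure 𝒳) (g : Θ → 𝒳 → 𝒴 → ℝ)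
    (Y₀ : Ω → 𝒴) (P : Measure Ω) : Prop :=
  MemLp (fun ω => Real.log (bMinus lam g (Y₀ ω))) 2 P

end Assumptions

/-! ### Log-likelihood increments and the contrast function -/

section Likelihood

variable {𝒳 𝒴 : Type*} [MeasurableSpace 𝒳]

/-- The conditional density `p(y_Δ | X_w = x)` for a finite subtree `Δ` with root `w`:
`g(x, y_w) ∫ ∏_{v ∈ Δ ∖ {w}} q(x_{p(v)}, x_v) g(x_v, y_v) λ(dx_v)` with `x_w = x`; it is `1` for
`Δ = ∅`. -/
noncomputable def condDensity (lam : Measure 𝒳) (q : 𝒳 → 𝒳 → ℝ) (g : 𝒳 → 𝒴 → ℝ)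
    (Δ : Finset Vertex) (w : Vertex) (x : 𝒳) (y : Vertex → 𝒴) : ℝ :=
  if Δ = ∅ then 1
  else g x (y w) * ∫ z : (Δ.erase w → 𝒳),
    ∏ v : Δ.erase w,
      q (if h : parent v ∈ Δ.erase w then z ⟨parent v, h⟩ else x) (z v) * g (z v) (y v)
    ∂(Measure.pi fun _ => lam)

/-- `H_{u,k,x} = p(y_{Δ(u,k)} | X_{p^k(u)} = x) / p(y_{Δ*(u,k)} | X_{p^k(u)} = x)`. -/
noncomputable def bigH (lam : Measure 𝒳) (q : 𝒳 → 𝒳 → ℝ) (g : 𝒳 → 𝒴 → ℝ)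
    (u : Vertex) (k : ℕ) (x : 𝒳) (U : ℕ → Bool) (y : Vertex → 𝒴) : ℝ :=
  condDensity lam q g (past U u k) (parent^[k] u) x y /
    condDensity lam q g (pastStar U u k) (parent^[k] u) x y

/-- The log-likelihood increment `h_{u,k,x} = log H_{u,k,x}`. -/
noncomputable def smallH (lam : Measure 𝒳) (q : 𝒳 → 𝒳 → ℝ) (g : 𝒳 → 𝒴 → ℝ)
    (u : Vertex) (k : ℕ) (x : 𝒳) (U : ℕ → Bool) (y : Vertex → 𝒴) : ℝ :=
  Real.log (bigH lam q g u k x U y)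

variable {Ω : Type*}

/-- The increment `h_{∂,k,x}` at the root, as a random variable of the bits `𝒰` and the sample
point. -/
noncomputable def rootIncrement (lam : Measure 𝒳) (q : 𝒳 → 𝒳 → ℝ) (g : 𝒳 → 𝒴 → ℝ)
    (Y : Vertex → Ω → 𝒴) (k : ℕ) (x : 𝒳) (s : (ℕ → Bool) × Ω) : ℝ :=
  smallH lam q g root k x s.1 fun v => Y v s.2

/-- The increment `h_{∂,∞}` with infinite past, the limit of `h_{∂,k,x}` as `k → ∞`. -/
noncomputable def limitIncrement (lam : Measure 𝒳) (q : 𝒳 → 𝒳 → ℝ) (g : 𝒳 → 𝒴 → ℝ)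
    (Y : Vertex → Ω → 𝒴) (x : 𝒳) (s : (ℕ → Bool) × Ω) : ℝ :=
  limUnder atTop fun k : ℕ => rootIncrement lam q g Y k x s

variable [MeasurableSpace Ω]

/-- The contrast `ℓ = E_𝒰 ⊗ E[h_{∂,∞}]`, where `P` is the law under the true parameter. -/
noncomputable def contrast (lam : Measure 𝒳) (q : 𝒳 → 𝒳 → ℝ) (g : 𝒳 → 𝒴 → ℝ)
    (Y : Vertex → Ω → 𝒴) (P : Measure Ω) (x : 𝒳) : ℝ :=
  ∫ s, limitIncrement lam q g Y x s ∂(spineLaw.prod P)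

variable [MeasurableSpace 𝒴]

/-- Equality of the laws under `P` and `P'` of the observed process `(Y_u, u ∈ T)`; vertices of `T`
are words. -/
def SameObservedLaw (Y : Vertex → Ω → 𝒴) (P P' : Measure Ω) : Prop :=
  P.map (fun ω (u : List Bool) => Y (node 0 u) ω) =
    P'.map (fun ω (u : List Bool) => Y (node 0 u) ω)

end Likelihood

end HMT

namespace HMT

universe u

open Vertex

/-! ### Finite binary shapes and labelled shapes -/

/-- Finite rooted subtrees of the binary tree; `nil` is the empty tree. -/
inductive Shape : Type
  | nil : Shape
  | node (l r : Shape) : Shape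

/-- The complete binary shape with `n` generations. -/
def Shape.full : ℕ → Shape
  | 0 => .nil
  | n + 1 => .node (full n) (full n)

/-- The number of vertices of a shape. -/
def Shape.size : Shape → ℕ
  | .nil => 0
  | .node l r => l.size + r.size + 1

/-- Elementary exchanges of the two children of a vertex, along the left branch. -/
inductive Shape.Swap : Shape → Shape → Prop
  | swap (l r : Shape) : Swap (.node l r) (.node r l)
  | left {s s' : Shape} (t : Shape) (h : Swap s s') : Swap (.node s t) (.node s' t)

/-- Labellings of the vertices of a shape. -/
@[reducible] def Obs (𝒴 : Type u) : Shape → Type u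
  | .nil => PUnit
  | .node l r => 𝒴 × Obs 𝒴 l × Obs 𝒴 r

@[reducible] instance Obs.measurableSpace (𝒴 : Type u) [MeasurableSpace 𝒴] :
    ∀ s, MeasurableSpace (Obs 𝒴 s)
  | .nil => (inferInstance : MeasurableSpace PUnit)
  | .node l r => @Prod.instMeasurableSpace _ _ _
      (@Prod.instMeasurableSpace _ _ (Obs.measurableSpace 𝒴 l) (Obs.measurableSpace 𝒴 r))

section Likelihoods

variable {𝒳 : Type*} {𝒴 : Type u} [MeasurableSpace 𝒳] [MeasurableSpace 𝒴]

/-! ### The law of the labels -/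

/-- The law of the observations on a shape, given the hidden state at its root. -/
noncomputable def obsKernel (Q : Kernel 𝒳 𝒳) (G : Kernel 𝒳 𝒴) : ∀ s, Kernel 𝒳 (Obs 𝒴 s)
  | .nil => Kernel.const 𝒳 (Measure.dirac PUnit.unit)
  | .node l r => G ×ₖ ((obsKernel Q G l ∘ₖ Q) ×ₖ (obsKernel Q G r ∘ₖ Q))

instance obsKernel.isMarkovKernel (Q : Kernel 𝒳 𝒳) (G : Kernel 𝒳 𝒴) [IsMarkovKernel Q]
    [IsMarkovKernel G] : ∀ s, IsMarkovKernel (obsKernel Q G s)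
  | .nil => by unfold obsKernel; infer_instance
  | .node l r => by
    have := obsKernel.isMarkovKernel Q G l
    have := obsKernel.isMarkovKernel Q G r
    unfold obsKernel; infer_instance

/-- The law of the observations on a shape, when the hidden state at the root has law `ν`. -/
noncomputable def obsLaw (Q : Kernel 𝒳 𝒳) (G : Kernel 𝒳 𝒴) (ν : Measure 𝒳) (s : Shape) :
    Measure (Obs 𝒴 s) :=
  obsKernel Q G s ∘ₘ ν

instance (Q : Kernel 𝒳 𝒳) (G : Kernel 𝒳 𝒴) (ν : Measure 𝒳) (s : Shape) [IsMarkovKernel Q]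
    [IsMarkovKernel G] [IsProbabilityMeasure ν] : IsProbabilityMeasure (obsLaw Q G ν s) := by
  unfold obsLaw; infer_instance

/-- The reference measure on labellings. -/
noncomputable def refMeasure (μ : Measure 𝒴) : ∀ s, Measure (Obs 𝒴 s)
  | .nil => Measure.dirac PUnit.unit
  | .node l r => μ.prod ((refMeasure μ l).prod (refMeasure μ r))

instance refMeasure.sigmaFinite (μ : Measure 𝒴) [SigmaFinite μ] :
    ∀ s, SigmaFinite (refMeasure μ s)
  | .nil => by unfold refMeasure; infer_instance
  | .node l r => by
    have := refMeasure.sigmaFinite μ l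
    have := refMeasure.sigmaFinite μ r
    unfold refMeasure; infer_instance

/-- The likelihood of the observations on a shape, given the hidden state at its root. -/
noncomputable def lik (Q : Kernel 𝒳 𝒳) (g : 𝒳 → 𝒴 → ℝ≥0∞) : ∀ s, 𝒳 → Obs 𝒴 s → ℝ≥0∞
  | .nil, _, _ => 1
  | .node l r, x, t =>
    g x t.1 * ((∫⁻ z, lik Q g l z t.2.1 ∂Q x) * ∫⁻ z, lik Q g r z t.2.2 ∂Q x)

/-- The likelihood of the observations on a shape, when the hidden state at the root has
law `ν`. -/
noncomputable def meanLik (Q : Kernel 𝒳 𝒳) (g : 𝒳 → 𝒴 → ℝ≥0∞) (ν : Measure 𝒳) (s : Shape)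
    (t : Obs 𝒴 s) : ℝ≥0∞ :=
  ∫⁻ z, lik Q g s z t ∂ν

theorem measurable_lintegral_kernel_param {𝒵 : Type*} [MeasurableSpace 𝒵] (Q : Kernel 𝒳 𝒳)
    [IsSFiniteKernel Q] {f : 𝒳 → 𝒵 → ℝ≥0∞} (hf : Measurable fun p : 𝒳 × 𝒵 => f p.1 p.2) :
    Measurable fun p : 𝒳 × 𝒵 => ∫⁻ z, f z p.2 ∂Q p.1 := by
  have : Measurable fun w : (𝒳 × 𝒵) × 𝒳 => f w.2 w.1.2 :=
    hf.comp (measurable_snd.prodMk (measurable_snd.comp measurable_fst))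
  exact this.lintegral_kernel_prod_right' (κ := Q.comap Prod.fst measurable_fst)

section Measurability

variable (Q : Kernel 𝒳 𝒳) [IsMarkovKernel Q] {g : 𝒳 → 𝒴 → ℝ≥0∞}

theorem measurable_lik (hg : Measurable fun p : 𝒳 × 𝒴 => g p.1 p.2) :
    ∀ s, Measurable fun p : 𝒳 × Obs 𝒴 s => lik Q g s p.1 p.2
  | .nil => measurable_const
  | .node l r => by
    have hl := measurable_lintegral_kernel_param Q (measurable_lik hg l)
    have hr := measurable_lintegral_kernel_param Q (measurable_lik hg r)
    have h0 : Measurable fun p : 𝒳 × Obs 𝒴 (.node l r) => g p.1 p.2.1 :=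
      hg.comp (measurable_fst.prodMk measurable_snd.fst)
    have h1 : Measurable fun p : 𝒳 × Obs 𝒴 (.node l r) => ∫⁻ z, lik Q g l z p.2.2.1 ∂Q p.1 :=
      hl.comp (measurable_fst.prodMk measurable_snd.snd.fst)
    have h2 : Measurable fun p : 𝒳 × Obs 𝒴 (.node l r) => ∫⁻ z, lik Q g r z p.2.2.2 ∂Q p.1 :=
      hr.comp (measurable_fst.prodMk measurable_snd.snd.snd)
    exact h0.mul (h1.mul h2)

theorem measurable_lik_left (hg : Measurable fun p : 𝒳 × 𝒴 => g p.1 p.2) (s : Shape)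
    (t : Obs 𝒴 s) : Measurable fun x => lik Q g s x t :=
  (measurable_lik Q hg s).comp (measurable_id.prodMk measurable_const)

theorem measurable_lik_right (hg : Measurable fun p : 𝒳 × 𝒴 => g p.1 p.2) (s : Shape) (x : 𝒳) :
    Measurable (lik Q g s x) :=
  (measurable_lik Q hg s).comp (measurable_const.prodMk measurable_id)

theorem measurable_meanLik (hg : Measurable fun p : 𝒳 × 𝒴 => g p.1 p.2) (ν : Measure 𝒳)
    [SFinite ν] (s : Shape) : Measurable (meanLik Q g ν s) :=
  (measurable_lik Q hg s).lintegral_prod_left'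

end Measurability

/-- A mixture of measures with densities has the mixture of the densities as its density. -/
theorem comp_eq_withDensity {𝒵 : Type*} [MeasurableSpace 𝒵] (m : Measure 𝒳) [SFinite m]
    (κ : Kernel 𝒳 𝒵) (ref : Measure 𝒵) [SFinite ref] {f : 𝒳 → 𝒵 → ℝ≥0∞}
    (hf : Measurable fun p : 𝒳 × 𝒵 => f p.1 p.2) (hκ : ∀ x, κ x = ref.withDensity (f x)) :
    κ ∘ₘ m = ref.withDensity fun t => ∫⁻ z, f z t ∂m := by
  ext S hS
  rw [Measure.bind_apply hS κ.aemeasurable, withDensity_apply _ hS]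
  simp_rw [hκ, withDensity_apply _ hS]
  exact lintegral_lintegral_swap hf.aemeasurable

theorem obsKernel_eq_withDensity (Q : Kernel 𝒳 𝒳) [IsMarkovKernel Q] (G : Kernel 𝒳 𝒴)
    [IsMarkovKernel G] {g : 𝒳 → 𝒴 → ℝ≥0∞} (hg : Measurable fun p : 𝒳 × 𝒴 => g p.1 p.2)
    (μ : Measure 𝒴) [SigmaFinite μ] (hG : ∀ x, G x = μ.withDensity (g x)) :
    ∀ s x, obsKernel Q G s x = (refMeasure μ s).withDensity (lik Q g s x)
  | .nil, x => by
    have : lik Q g .nil x = 1 := rfl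
    rw [this, withDensity_one]; rfl
  | .node l r, x => by
    have hl := measurable_lik Q hg l
    have hr := measurable_lik Q hg r
    have key : ∀ s, (∀ x, obsKernel Q G s x = (refMeasure μ s).withDensity (lik Q g s x)) →
        (obsKernel Q G s ∘ₖ Q) x =
          (refMeasure μ s).withDensity fun t => ∫⁻ z, lik Q g s z t ∂Q x := fun s hs => by
      rw [Kernel.comp_apply]
      exact comp_eq_withDensity (Q x) _ _ (measurable_lik Q hg s) hs
    have ml : Measurable fun t : Obs 𝒴 l => ∫⁻ z, lik Q g l z t ∂Q x := hl.lintegral_prod_left'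
    have mr : Measurable fun t : Obs 𝒴 r => ∫⁻ z, lik Q g r z t ∂Q x := hr.lintegral_prod_left'
    have mg : Measurable (g x) := hg.comp (measurable_const.prodMk measurable_id)
    unfold obsKernel
    rw [Kernel.prod_apply, Kernel.prod_apply, hG,
      key l (obsKernel_eq_withDensity Q G hg μ hG l), key r (obsKernel_eq_withDensity Q G hg μ hG r),
      prod_withDensity ml mr, prod_withDensity mg (by fun_prop)]
    rfl

theorem obsLaw_eq_withDensity (Q : Kernel 𝒳 𝒳) [IsMarkovKernel Q] (G : Kernel 𝒳 𝒴)
    [IsMarkovKernel G] {g : 𝒳 → 𝒴 → ℝ≥0∞} (hg : Measurable fun p : 𝒳 × 𝒴 => g p.1 p.2)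
    (μ : Measure 𝒴) [SigmaFinite μ] (hG : ∀ x, G x = μ.withDensity (g x)) (ν : Measure 𝒳)
    [SFinite ν] (s : Shape) :
    obsLaw Q G ν s = (refMeasure μ s).withDensity (meanLik Q g ν s) :=
  comp_eq_withDensity ν _ _ (measurable_lik Q hg s) (obsKernel_eq_withDensity Q G hg μ hG s)

/-! ### Marginals of the stationary law -/

section Marginals

variable (Q : Kernel 𝒳 𝒳) [IsMarkovKernel Q] (G : Kernel 𝒳 𝒴) [IsMarkovKernel G]
  {ν : Measure 𝒳} (l r : Shape)

theorem map_root_obsLaw : (obsLaw Q G ν (.node l r)).map Prod.fst = G ∘ₘ ν := by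
  unfold obsLaw
  rw [Measure.map_comp _ _ measurable_fst]
  have : (obsKernel Q G (.node l r)).map Prod.fst = G := by
    change (G ×ₖ ((obsKernel Q G l ∘ₖ Q) ×ₖ (obsKernel Q G r ∘ₖ Q))).map Prod.fst = _
    rw [← Kernel.fst_eq, Kernel.fst_prod]
  rw [this]

theorem map_left_obsLaw (hν : Kernel.Invariant Q ν) :
    (obsLaw Q G ν (.node l r)).map (fun t => t.2.1) = obsLaw Q G ν l := by
  unfold obsLaw
  rw [Measure.map_comp _ _ measurable_snd.fst]
  have : (obsKernel Q G (.node l r)).map (fun t => t.2.1) = obsKernel Q G l ∘ₖ Q := by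
    change (G ×ₖ ((obsKernel Q G l ∘ₖ Q) ×ₖ (obsKernel Q G r ∘ₖ Q))).map (Prod.fst ∘ Prod.snd) = _
    rw [Kernel.map_comp_right _ measurable_snd measurable_fst, ← Kernel.snd_eq, ← Kernel.fst_eq,
      Kernel.snd_prod, Kernel.fst_prod]
  rw [this, ← Measure.comp_assoc, hν.def]

theorem map_right_obsLaw (hν : Kernel.Invariant Q ν) :
    (obsLaw Q G ν (.node l r)).map (fun t => t.2.2) = obsLaw Q G ν r := by
  unfold obsLaw
  rw [Measure.map_comp _ _ measurable_snd.snd]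
  have : (obsKernel Q G (.node l r)).map (fun t => t.2.2) = obsKernel Q G r ∘ₖ Q := by
    change (G ×ₖ ((obsKernel Q G l ∘ₖ Q) ×ₖ (obsKernel Q G r ∘ₖ Q))).map (Prod.snd ∘ Prod.snd) = _
    rw [Kernel.map_comp_right _ measurable_snd measurable_snd, ← Kernel.snd_eq, ← Kernel.snd_eq,
      Kernel.snd_prod, Kernel.snd_prod]
  rw [this, ← Measure.comp_assoc, hν.def]

end Marginals

/-! ### Invariance under exchanges of children -/

theorem Shape.Swap.exists_map {s s' : Shape} (h : s.Swap s') :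
    ∃ σ : Obs 𝒴 s → Obs 𝒴 s', Measurable σ ∧
      (∀ (Q : Kernel 𝒳 𝒳) (G : Kernel 𝒳 𝒴) [IsMarkovKernel Q] [IsMarkovKernel G] (x : 𝒳),
        (obsKernel Q G s x).map σ = obsKernel Q G s' x) ∧
      ∀ (Q : Kernel 𝒳 𝒳) (g : 𝒳 → 𝒴 → ℝ≥0∞) (x : 𝒳) (t : Obs 𝒴 s),
        lik Q g s' x (σ t) = lik Q g s x t := by
  induction h with
  | swap l r =>
    refine ⟨Prod.map id Prod.swap, by fun_prop, fun Q G _ _ x => ?_, fun Q g x t => ?_⟩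
    · unfold obsKernel
      rw [Kernel.prod_apply, Kernel.prod_apply, Kernel.prod_apply, Kernel.prod_apply,
        ← Measure.map_prod_map _ _ measurable_id measurable_swap, Measure.map_id,
        Measure.prod_swap]
    · simp only [lik, Prod.map_fst, Prod.map_snd, id, Prod.fst_swap, Prod.snd_swap]
      rw [mul_comm (∫⁻ z, lik Q g r z _ ∂_)]
  | @left s s' t h ih =>
    obtain ⟨σ, hσ, h1, h2⟩ := ih
    refine ⟨Prod.map id (Prod.map σ id), by fun_prop, fun Q G _ _ x => ?_, fun Q g x t => ?_⟩
    · have : ((obsKernel Q G s ∘ₖ Q) x).map σ = (obsKernel Q G s' ∘ₖ Q) x := by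
        rw [Kernel.comp_apply, Kernel.comp_apply, Measure.map_comp _ _ hσ]
        congr 1
        ext1 z
        rw [Kernel.map_apply _ hσ, h1]
      unfold obsKernel
      rw [Kernel.prod_apply, Kernel.prod_apply, Kernel.prod_apply, Kernel.prod_apply,
        ← Measure.map_prod_map _ _ measurable_id (hσ.prodMap measurable_id), Measure.map_id,
        ← Measure.map_prod_map _ _ hσ measurable_id, Measure.map_id, this]
    · simp only [lik, Prod.map_fst, Prod.map_snd, id, h2]

/-! ### Bounds on likelihoods -/

/-- The sum of `f` over the labels. -/
noncomputable def labelSum (f : 𝒴 → ℝ) : ∀ s, Obs 𝒴 s → ℝ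
  | .nil, _ => 0
  | .node l r, t => f t.1 + (labelSum f l t.2.1 + labelSum f r t.2.2)

theorem integrable_labelSum (Q : Kernel 𝒳 𝒳) [IsMarkovKernel Q] (G : Kernel 𝒳 𝒴)
    [IsMarkovKernel G] {ν : Measure 𝒳} (hν : Kernel.Invariant Q ν)
    {f : 𝒴 → ℝ} (hf : Integrable f (G ∘ₘ ν)) :
    ∀ s, Integrable (labelSum f s) (obsLaw Q G ν s)
  | .nil => integrable_zero _ _ _
  | .node l r => by
    have h0 := map_root_obsLaw Q G (ν := ν) l r
    have h1 := map_left_obsLaw Q G l r hν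
    have h2 := map_right_obsLaw Q G l r hν
    have i0 : Integrable (f ∘ Prod.fst) (obsLaw Q G ν (.node l r)) :=
      (h0 ▸ hf : Integrable f _).comp_measurable measurable_fst
    have i1 : Integrable (labelSum f l ∘ fun t => t.2.1) (obsLaw Q G ν (.node l r)) :=
      (h1 ▸ integrable_labelSum Q G hν hf l : Integrable (labelSum f l) _).comp_measurable
        measurable_snd.fst
    have i2 : Integrable (labelSum f r ∘ fun t => t.2.2) (obsLaw Q G ν (.node l r)) :=
      (h2 ▸ integrable_labelSum Q G hν hf r : Integrable (labelSum f r) _).comp_measurable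
        measurable_snd.snd
    exact i0.add (i1.add i2)

/-- The transition kernel `Q` is comparable to `lam`, and the observation density `g` is positive
and bounded. -/
structure IsMixing (Q : Kernel 𝒳 𝒳) (g : 𝒳 → 𝒴 → ℝ≥0∞) (lam : Measure 𝒳) (σm σp b : ℝ) :
    Prop where
  measurable_g : Measurable fun p : 𝒳 × 𝒴 => g p.1 p.2
  pos_g : ∀ x y, 0 < g x y
  g_le : ∀ x y, g x y ≤ ENNReal.ofReal b
  pos : 0 < σm
  lower : ∀ x, ENNReal.ofReal σm • lam ≤ Q x
  upper : ∀ x, Q x ≤ ENNReal.ofReal σp • lam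

section Bounds

variable {Q : Kernel 𝒳 𝒳} [IsMarkovKernel Q] {g : 𝒳 → 𝒴 → ℝ≥0∞} {lam : Measure 𝒳}
  [IsProbabilityMeasure lam] {σm σp b : ℝ}

theorem le_of_invariant {ν : Measure 𝒳} [IsProbabilityMeasure ν] (h : IsMixing Q g lam σm σp b)
    (hν : Kernel.Invariant Q ν) : ENNReal.ofReal σm • lam ≤ ν := by
  refine Measure.le_iff.2 fun S hS => ?_
  rw [← hν.def, Measure.bind_apply hS Q.aemeasurable]
  calc (ENNReal.ofReal σm • lam) S = ∫⁻ _, (ENNReal.ofReal σm • lam) S ∂ν := by simp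
    _ ≤ _ := lintegral_mono fun x => h.lower x S

theorem ge_of_invariant {ν : Measure 𝒳} [IsProbabilityMeasure ν] (h : IsMixing Q g lam σm σp b)
    (hν : Kernel.Invariant Q ν) : ν ≤ ENNReal.ofReal σp • lam := by
  refine Measure.le_iff.2 fun S hS => ?_
  rw [← hν.def, Measure.bind_apply hS Q.aemeasurable]
  calc _ ≤ ∫⁻ _, (ENNReal.ofReal σp • lam) S ∂ν := lintegral_mono fun x => h.upper x S
    _ = _ := by simp

theorem lik_le (h : IsMixing Q g lam σm σp b) {C : ℝ} (hb : b ≤ Real.exp C) :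
    ∀ (s : Shape) (x : 𝒳) (t : Obs 𝒴 s), lik Q g s x t ≤ ENNReal.ofReal (Real.exp (C * s.size))
  | .nil, _, _ => by simp [lik, Shape.size]
  | .node l r, x, t => by
    have key : ∀ (s : Shape) (t : Obs 𝒴 s),
        (∀ x, lik Q g s x t ≤ ENNReal.ofReal (Real.exp (C * s.size))) →
        ∫⁻ z, lik Q g s z t ∂Q x ≤ ENNReal.ofReal (Real.exp (C * s.size)) := fun s t hs => by
      calc _ ≤ ∫⁻ _, ENNReal.ofReal (Real.exp (C * s.size)) ∂Q x := lintegral_mono hs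
        _ = _ := by simp
    calc lik Q g (.node l r) x t ≤ ENNReal.ofReal (Real.exp C) *
          (ENNReal.ofReal (Real.exp (C * l.size)) * ENNReal.ofReal (Real.exp (C * r.size))) :=
        mul_le_mul' ((h.g_le x _).trans (ENNReal.ofReal_le_ofReal hb))
          (mul_le_mul' (key l _ fun z => lik_le h hb l z _) (key r _ fun z => lik_le h hb r z _))
      _ = _ := by
        rw [← ENNReal.ofReal_mul (by positivity), ← ENNReal.ofReal_mul (by positivity),
          ← Real.exp_add, ← Real.exp_add, Shape.size]
        push_cast
        ring_nf

/-- The likelihood of one observation, integrated against the reference measure. -/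
noncomputable def refLik (lam : Measure 𝒳) (g : 𝒳 → 𝒴 → ℝ≥0∞) (y : 𝒴) : ℝ≥0∞ :=
  ∫⁻ x, g x y ∂lam

theorem refLik_pos (h : IsMixing Q g lam σm σp b) (y : 𝒴) : 0 < refLik lam g y := by
  have hm : Measurable fun x => g x y := h.measurable_g.comp (measurable_id.prodMk measurable_const)
  unfold refLik
  rw [lintegral_pos_iff_support hm]
  have : Function.support (fun x => g x y) = Set.univ :=
    Set.eq_univ_of_forall fun x => (h.pos_g x y).ne'
  simp [this]

theorem refLik_lt_top (h : IsMixing Q g lam σm σp b) (y : 𝒴) : refLik lam g y < ∞ := by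
  calc refLik lam g y ≤ ∫⁻ _, ENNReal.ofReal b ∂lam := lintegral_mono fun x => h.g_le x y
    _ < ∞ := by simp

theorem ofReal_exp_log_refLik (h : IsMixing Q g lam σm σp b) (y : 𝒴) :
    ENNReal.ofReal (Real.exp (Real.log (refLik lam g y).toReal)) = refLik lam g y := by
  rw [Real.exp_log (ENNReal.toReal_pos (refLik_pos h y).ne' (refLik_lt_top h y).ne),
    ENNReal.ofReal_toReal (refLik_lt_top h y).ne]

/-- The absolute value of the logarithm of `refLik`. -/
noncomputable def absLog (lam : Measure 𝒳) (g : 𝒳 → 𝒴 → ℝ≥0∞) (y : 𝒴) : ℝ :=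
  |Real.log (refLik lam g y).toReal|

theorem le_lintegral_lik (h : IsMixing Q g lam σm σp b) {C : ℝ} (hC : Real.exp (-C) ≤ σm) :
    ∀ (s : Shape) (t : Obs 𝒴 s) (m : Measure 𝒳) [IsProbabilityMeasure m],
      ENNReal.ofReal σm • lam ≤ m →
      ENNReal.ofReal (Real.exp (-(C * s.size + labelSum (absLog lam g) s t))) ≤
        ∫⁻ z, lik Q g s z t ∂m
  | .nil, _, m, _, _ => by simp [lik, Shape.size, labelSum]
  | .node l r, t, m, _, hm => by
    have hmeas : Measurable fun x => g x t.1 :=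
      h.measurable_g.comp (measurable_id.prodMk measurable_const)
    set el := Real.exp (-(C * l.size + labelSum (absLog lam g) l t.2.1))
    set er := Real.exp (-(C * r.size + labelSum (absLog lam g) r t.2.2))
    have h1 : ENNReal.ofReal (Real.exp (-C)) * ENNReal.ofReal (Real.exp (-absLog lam g t.1)) ≤
        ∫⁻ z, g z t.1 ∂m := by
      calc _ ≤ ENNReal.ofReal σm * refLik lam g t.1 := by
            refine mul_le_mul' (ENNReal.ofReal_le_ofReal hC) ?_
            rw [← ofReal_exp_log_refLik h]
            exact ENNReal.ofReal_le_ofReal (Real.exp_le_exp.2 (neg_abs_le _))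
        _ = ∫⁻ z, g z t.1 ∂(ENNReal.ofReal σm • lam) := by rw [lintegral_smul_measure]; rfl
        _ ≤ _ := lintegral_mono' hm le_rfl
    calc _ = (ENNReal.ofReal (Real.exp (-C)) * ENNReal.ofReal (Real.exp (-absLog lam g t.1))) *
          (ENNReal.ofReal el * ENNReal.ofReal er) := by
          simp only [el, er]
          rw [← ENNReal.ofReal_mul (by positivity), ← ENNReal.ofReal_mul (by positivity),
            ← ENNReal.ofReal_mul (by positivity), ← Real.exp_add, ← Real.exp_add, ← Real.exp_add,
            Shape.size, labelSum]
          push_cast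
          ring_nf
      _ ≤ (∫⁻ z, g z t.1 ∂m) * (ENNReal.ofReal el * ENNReal.ofReal er) := mul_le_mul' h1 le_rfl
      _ = ∫⁻ z, g z t.1 * (ENNReal.ofReal el * ENNReal.ofReal er) ∂m := by
          rw [lintegral_mul_const _ hmeas]
      _ ≤ _ := lintegral_mono fun z => mul_le_mul' le_rfl (mul_le_mul'
          (le_lintegral_lik h hC l _ (Q z) (h.lower z))
          (le_lintegral_lik h hC r _ (Q z) (h.lower z)))

theorem exists_log_bound (σm b : ℝ) (hσ : 0 < σm) : ∃ C : ℝ, 0 ≤ C ∧ Real.exp (-C) ≤ σm ∧ b ≤ Real.exp C := by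
  refine ⟨|Real.log σm| + |b|, by positivity, ?_, ?_⟩
  · calc Real.exp (-(|Real.log σm| + |b|)) ≤ Real.exp (Real.log σm) := by
          gcongr
          linarith [neg_abs_le (Real.log σm), abs_nonneg b]
      _ = σm := Real.exp_log hσ
  · calc b ≤ |b| + 1 := by linarith [le_abs_self b]
      _ ≤ Real.exp |b| := Real.add_one_le_exp _
      _ ≤ _ := by gcongr; linarith [abs_nonneg (Real.log σm)]

theorem lintegral_lik_pos (h : IsMixing Q g lam σm σp b) (s : Shape) (t : Obs 𝒴 s)
    (m : Measure 𝒳) [IsProbabilityMeasure m] (hm : ENNReal.ofReal σm • lam ≤ m) :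
    0 < ∫⁻ z, lik Q g s z t ∂m := by
  obtain ⟨C, -, hC, -⟩ := exists_log_bound σm b h.pos
  exact lt_of_lt_of_le (ENNReal.ofReal_pos.2 (Real.exp_pos _)) (le_lintegral_lik h hC s t m hm)

theorem lintegral_lik_lt_top (h : IsMixing Q g lam σm σp b) (s : Shape) (t : Obs 𝒴 s)
    (m : Measure 𝒳) [IsProbabilityMeasure m] : ∫⁻ z, lik Q g s z t ∂m < ∞ := by
  obtain ⟨C, -, -, hC⟩ := exists_log_bound σm b h.pos
  calc _ ≤ ∫⁻ _, ENNReal.ofReal (Real.exp (C * s.size)) ∂m := lintegral_mono fun z => lik_le h hC s z t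
    _ < ∞ := by simp

theorem lik_pos (h : IsMixing Q g lam σm σp b) : ∀ (s : Shape) (x : 𝒳) (t : Obs 𝒴 s),
    0 < lik Q g s x t
  | .nil, _, _ => one_pos
  | .node l r, x, t => ENNReal.mul_pos (h.pos_g x _).ne' (ENNReal.mul_pos
      (lintegral_lik_pos h l _ (Q x) (h.lower x)).ne'
      (lintegral_lik_pos h r _ (Q x) (h.lower x)).ne').ne'

theorem lik_lt_top (h : IsMixing Q g lam σm σp b) (s : Shape) (x : 𝒳) (t : Obs 𝒴 s) :
    lik Q g s x t < ∞ := by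
  obtain ⟨C, -, -, hC⟩ := exists_log_bound σm b h.pos
  exact (lik_le h hC s x t).trans_lt ENNReal.ofReal_lt_top

variable {ν : Measure 𝒳} [IsProbabilityMeasure ν]

theorem meanLik_pos (h : IsMixing Q g lam σm σp b) (hν : Kernel.Invariant Q ν) (s : Shape)
    (t : Obs 𝒴 s) : 0 < meanLik Q g ν s t :=
  lintegral_lik_pos h s t ν (le_of_invariant h hν)

theorem meanLik_lt_top (h : IsMixing Q g lam σm σp b) (s : Shape) (t : Obs 𝒴 s) :
    meanLik Q g ν s t < ∞ :=
  lintegral_lik_lt_top h s t ν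

theorem exists_abs_log_meanLik_le (h : IsMixing Q g lam σm σp b) (hν : Kernel.Invariant Q ν)
    (s : Shape) : ∃ C : ℝ, ∀ t : Obs 𝒴 s,
      |Real.log (meanLik Q g ν s t).toReal| ≤ C + labelSum (absLog lam g) s t := by
  obtain ⟨C, h0, hC, hb⟩ := exists_log_bound σm b h.pos
  refine ⟨C * s.size, fun t => ?_⟩
  have hpos := ENNReal.toReal_pos (meanLik_pos h hν s t).ne' (meanLik_lt_top h s t).ne
  have hS : ∀ (s : Shape) (t : Obs 𝒴 s), 0 ≤ labelSum (absLog lam g) s t := by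
    intro s
    induction s with
    | nil => intro t; exact le_rfl
    | node l r hl hr => intro t; exact add_nonneg (abs_nonneg _) (add_nonneg (hl _) (hr _))
  rw [abs_le, Real.le_log_iff_exp_le hpos, Real.log_le_iff_le_exp hpos]
  constructor
  · rw [← ENNReal.ofReal_le_iff_le_toReal (meanLik_lt_top h s t).ne]
    exact le_lintegral_lik h hC s t ν (le_of_invariant h hν)
  · refine ENNReal.toReal_le_of_le_ofReal (by positivity) ?_
    calc meanLik Q g ν s t ≤ ∫⁻ _, ENNReal.ofReal (Real.exp (C * s.size)) ∂ν :=
          lintegral_mono fun z => lik_le h hb s z t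
      _ = ENNReal.ofReal (Real.exp (C * s.size)) := by simp
      _ ≤ _ := ENNReal.ofReal_le_ofReal (Real.exp_le_exp.2 (by linarith [hS s t]))

end Bounds

/-- The log-likelihood of the stationary process. -/
noncomputable def logMeanLik (Q : Kernel 𝒳 𝒳) (g : 𝒳 → 𝒴 → ℝ≥0∞) (ν : Measure 𝒳) (s : Shape)
    (t : Obs 𝒴 s) : ℝ :=
  Real.log (meanLik Q g ν s t).toReal

theorem integrable_logMeanLik {Q Q' : Kernel 𝒳 𝒳} [IsMarkovKernel Q] [IsMarkovKernel Q']
    {g : 𝒳 → 𝒴 → ℝ≥0∞} {G' : Kernel 𝒳 𝒴} [IsMarkovKernel G'] {lam : Measure 𝒳}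
    [IsProbabilityMeasure lam] {σm σp b : ℝ} {ν ν' : Measure 𝒳} [IsProbabilityMeasure ν]
    [IsProbabilityMeasure ν'] (h : IsMixing Q g lam σm σp b) (hν : Kernel.Invariant Q ν)
    (hν' : Kernel.Invariant Q' ν') (hint : Integrable (absLog lam g) (G' ∘ₘ ν')) (s : Shape) :
    Integrable (logMeanLik Q g ν s) (obsLaw Q' G' ν' s) := by
  obtain ⟨C, hC⟩ := exists_abs_log_meanLik_le h hν s
  refine ((integrable_const C).add (integrable_labelSum Q' G' hν' hint s)).mono' ?_
    (ae_of_all _ hC)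
  exact (measurable_meanLik Q h.measurable_g ν s).ennreal_toReal.log.aestronglyMeasurable

/-! ### Contraction of likelihood ratios -/

theorem toReal_lintegral_bounds {m lam : Measure 𝒳} {σm σp : ℝ} (hσ : 0 ≤ σm) (hσp : 0 ≤ σp)
    (lower : ENNReal.ofReal σm • lam ≤ m) (upper : m ≤ ENNReal.ofReal σp • lam) {f : 𝒳 → ℝ}
    (hf : Integrable f lam) (h0 : ∀ x, 0 ≤ f x) :
    Integrable f m ∧ σm * ∫ x, f x ∂lam ≤ ∫ x, f x ∂m ∧ ∫ x, f x ∂m ≤ σp * ∫ x, f x ∂lam := by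
  have i1 : Integrable f (ENNReal.ofReal σp • lam) := hf.smul_measure ENNReal.ofReal_ne_top
  have i2 : Integrable f m := i1.mono_measure upper
  refine ⟨i2, ?_, ?_⟩
  · have := integral_mono_measure lower (ae_of_all _ h0) i2
    rwa [integral_smul_measure, ENNReal.toReal_ofReal hσ] at this
  · have := integral_mono_measure upper (ae_of_all _ h0) i1
    rwa [integral_smul_measure, ENNReal.toReal_ofReal hσp] at this

/-- Averaging with respect to a kernel that is comparable to `lam` narrows the bounds on the ratio
of two functions. -/
theorem exists_ratio_bounds {Q : Kernel 𝒳 𝒳} {lam : Measure 𝒳} {σm σp : ℝ} (hσ : 0 < σm)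
    (hσp : σm ≤ σp) (lower : ∀ x, ENNReal.ofReal σm • lam ≤ Q x)
    (upper : ∀ x, Q x ≤ ENNReal.ofReal σp • lam) {N D : 𝒳 → ℝ} (hN : Integrable N lam)
    (hD : Integrable D lam) (hD0 : ∀ x, 0 ≤ D x) (hD1 : 0 < ∫ x, D x ∂lam) {a c : ℝ}
    (ha : ∀ x, a * D x ≤ N x) (hc : ∀ x, N x ≤ c * D x) :
    ∃ a' c', a ≤ a' ∧ a' ≤ c' ∧ c' ≤ c ∧ c' - a' = (1 - σm / σp) * (c - a) ∧
      ∀ x, a' * ∫ z, D z ∂Q x ≤ ∫ z, N z ∂Q x ∧ ∫ z, N z ∂Q x ≤ c' * ∫ z, D z ∂Q x := by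
  have hp : 0 < σp := hσ.trans_le hσp
  set d := ∫ x, D x ∂lam
  set n := ∫ x, N x ∂lam
  set κ := σm / σp
  have hκ : κ ≤ 1 := (div_le_one hp).2 hσp
  have hκ0 : 0 < κ := div_pos hσ hp
  have iA : Integrable (fun x => N x - a * D x) lam := hN.sub (hD.const_mul a)
  have iC : Integrable (fun x => c * D x - N x) lam := (hD.const_mul c).sub hN
  have eA : ∫ x, (N x - a * D x) ∂lam = n - a * d := by
    rw [integral_sub hN (hD.const_mul a), integral_const_mul]
  have eC : ∫ x, (c * D x - N x) ∂lam = c * d - n := by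
    rw [integral_sub (hD.const_mul c) hN, integral_const_mul]
  have hA : a * d ≤ n := by
    have : 0 ≤ ∫ x, (N x - a * D x) ∂lam := integral_nonneg fun x => sub_nonneg.2 (ha x)
    linarith
  have hC : n ≤ c * d := by
    have : 0 ≤ ∫ x, (c * D x - N x) ∂lam := integral_nonneg fun x => sub_nonneg.2 (hc x)
    linarith
  have hac : a ≤ c := le_of_mul_le_mul_right (hA.trans hC) hD1
  have hna : a ≤ n / d := (le_div_iff₀ hD1).2 hA
  have hnc : n / d ≤ c := (div_le_iff₀ hD1).2 hC
  refine ⟨a + κ * (n / d - a), c - κ * (c - n / d), ?_, ?_, ?_, by ring, fun x => ?_⟩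
  · nlinarith
  · nlinarith
  · nlinarith
  obtain ⟨jD, -, dU⟩ := toReal_lintegral_bounds hσ.le hp.le (lower x) (upper x) hD hD0
  obtain ⟨jA, A1, -⟩ := toReal_lintegral_bounds hσ.le hp.le (lower x) (upper x) iA
    fun x => sub_nonneg.2 (ha x)
  obtain ⟨-, C1, -⟩ := toReal_lintegral_bounds hσ.le hp.le (lower x) (upper x) iC
    fun x => sub_nonneg.2 (hc x)
  have jN : Integrable N (Q x) := by
    have := jA.add (jD.const_mul a)
    refine this.congr (ae_of_all _ fun x => ?_)
    simp
  rw [integral_sub jN (jD.const_mul a), integral_const_mul, eA] at A1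
  rw [integral_sub (jD.const_mul c) jN, integral_const_mul, eC] at C1
  have e1 : κ * ∫ z, D z ∂Q x ≤ σm * d := by
    calc κ * ∫ z, D z ∂Q x ≤ κ * (σp * d) := mul_le_mul_of_nonneg_left dU hκ0.le
      _ = σm * d := by simp only [κ]; field_simp
  have f1 : (n / d - a) * (κ * ∫ z, D z ∂Q x) ≤ σm * (n - a * d) :=
    calc _ ≤ (n / d - a) * (σm * d) := mul_le_mul_of_nonneg_left e1 (sub_nonneg.2 hna)
      _ = _ := by field_simp
  have f2 : (c - n / d) * (κ * ∫ z, D z ∂Q x) ≤ σm * (c * d - n) :=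
    calc _ ≤ (c - n / d) * (σm * d) := mul_le_mul_of_nonneg_left e1 (sub_nonneg.2 hnc)
      _ = _ := by field_simp
  constructor
  · calc _ = (n / d - a) * (κ * ∫ z, D z ∂Q x) + a * ∫ z, D z ∂Q x := by ring
      _ ≤ _ := by linarith
  · calc _ ≤ c * ∫ z, D z ∂Q x - (c - n / d) * (κ * ∫ z, D z ∂Q x) := by linarith
      _ = _ := by ring

/-! ### The past of the root as a shape -/

/-- The shape of `Δ_U(∂, k)`, seen from its root `p^k(∂)`. -/
def pastShape (U : ℕ → Bool) : ℕ → Shape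
  | 0 => .node .nil .nil
  | k + 1 => .node (pastShape U k) (.full (if U k then k + 1 else k))

/-- The shape of `Δ*_U(∂, k)`, seen from its root `p^k(∂)`. -/
def pastStarShape (U : ℕ → Bool) : ℕ → Shape
  | 0 => .nil
  | k + 1 => .node (pastStarShape U k) (.full (if U k then k + 1 else k))

/-- The labels of the shape `s` rooted at `v`. -/
def obs (y : Vertex → 𝒴) : ∀ s, Vertex → Obs 𝒴 s
  | .nil, _ => PUnit.unit
  | .node l r, v => (y v, obs y l (child v false), obs y r (child v true))

theorem parent_iterate_root_succ (k : ℕ) : parent^[k + 1] root = spine k := by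
  induction k with
  | zero => rfl
  | succ k ih => rw [Function.iterate_succ_apply', ih]; rfl

theorem child_parent_iterate_root (k : ℕ) :
    child (parent^[k + 1] root) false = parent^[k] root := by
  rw [parent_iterate_root_succ]
  cases k with
  | zero => rfl
  | succ k => rw [parent_iterate_root_succ]; rfl

section Ratios

variable (Q : Kernel 𝒳 𝒳) (g : 𝒳 → 𝒴 → ℝ≥0∞)

/-- The likelihood of `Δ_U(∂, k)` given the hidden state at `p^k(∂)`. -/
noncomputable def pastLik (U : ℕ → Bool) (y : Vertex → 𝒴) (k : ℕ) (x : 𝒳) : ℝ≥0∞ :=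
  lik Q g (pastShape U k) x (obs y _ (parent^[k] root))

/-- The likelihood of `Δ*_U(∂, k)` given the hidden state at `p^k(∂)`. -/
noncomputable def pastStarLik (U : ℕ → Bool) (y : Vertex → 𝒴) (k : ℕ) (x : 𝒳) : ℝ≥0∞ :=
  lik Q g (pastStarShape U k) x (obs y _ (parent^[k] root))

/-- The common factor of the recursions for `pastLik` and `pastStarLik`. -/
noncomputable def siblingLik (U : ℕ → Bool) (y : Vertex → 𝒴) (k : ℕ) (x : 𝒳) : ℝ≥0∞ :=
  g x (y (parent^[k + 1] root)) *
    ∫⁻ z, lik Q g (.full (if U k then k + 1 else k)) z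
      (obs y _ (child (parent^[k + 1] root) true)) ∂Q x

theorem pastLik_succ (U : ℕ → Bool) (y : Vertex → 𝒴) (k : ℕ) (x : 𝒳) :
    pastLik Q g U y (k + 1) x = siblingLik Q g U y k x * ∫⁻ z, pastLik Q g U y k z ∂Q x := by
  have := child_parent_iterate_root k
  unfold pastLik siblingLik
  conv_rhs => rw [← this]
  simp only [pastShape, lik, obs]
  ring

theorem pastStarLik_succ (U : ℕ → Bool) (y : Vertex → 𝒴) (k : ℕ) (x : 𝒳) :
    pastStarLik Q g U y (k + 1) x =
      siblingLik Q g U y k x * ∫⁻ z, pastStarLik Q g U y k z ∂Q x := by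
  have := child_parent_iterate_root k
  unfold pastStarLik siblingLik
  conv_rhs => rw [← this]
  simp only [pastStarShape, lik, obs]
  ring

variable {Q g} [IsMarkovKernel Q] {lam : Measure 𝒳} [IsProbabilityMeasure lam] {σm σp b : ℝ}

theorem IsMixing.le (h : IsMixing Q g lam σm σp b) : σm ≤ σp := by
  have : 0 < lam Set.univ := by simp
  obtain ⟨x, -⟩ := nonempty_of_measure_ne_zero this.ne'
  have := ((h.lower x).trans (h.upper x)) Set.univ
  simp only [Measure.smul_apply, measure_univ, smul_eq_mul, mul_one] at this
  by_contra! hlt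
  exact absurd this (not_le.2 ((ENNReal.ofReal_lt_ofReal_iff h.pos).2 hlt))

/-- Bounds `a ≤ H ≤ c` on a likelihood ratio, without division. -/
def RatioBounds (Q : Kernel 𝒳 𝒳) (g : 𝒳 → 𝒴 → ℝ≥0∞) (U : ℕ → Bool) (y : Vertex → 𝒴) (k : ℕ)
    (a c : ℝ) : Prop :=
  ∀ x, ENNReal.ofReal a * pastStarLik Q g U y k x ≤ pastLik Q g U y k x ∧
    pastLik Q g U y k x ≤ ENNReal.ofReal c * pastStarLik Q g U y k x

theorem RatioBounds.succ_of_lintegral {U : ℕ → Bool} {y : Vertex → 𝒴} {k : ℕ} {a c : ℝ}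
    (h : ∀ x, ENNReal.ofReal a * ∫⁻ z, pastStarLik Q g U y k z ∂Q x ≤
        ∫⁻ z, pastLik Q g U y k z ∂Q x ∧
      ∫⁻ z, pastLik Q g U y k z ∂Q x ≤ ENNReal.ofReal c * ∫⁻ z, pastStarLik Q g U y k z ∂Q x) :
    RatioBounds Q g U y (k + 1) a c := by
  intro x
  rw [pastLik_succ, pastStarLik_succ, mul_left_comm, mul_left_comm (ENNReal.ofReal c)]
  exact ⟨mul_le_mul' le_rfl (h x).1, mul_le_mul' le_rfl (h x).2⟩

theorem RatioBounds.lintegral (hm : IsMixing Q g lam σm σp b) {U : ℕ → Bool} {y : Vertex → 𝒴}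
    {k : ℕ} {a c : ℝ} (h : RatioBounds Q g U y k a c) (m : Measure 𝒳) :
    ENNReal.ofReal a * ∫⁻ z, pastStarLik Q g U y k z ∂m ≤ ∫⁻ z, pastLik Q g U y k z ∂m ∧
      ∫⁻ z, pastLik Q g U y k z ∂m ≤ ENNReal.ofReal c * ∫⁻ z, pastStarLik Q g U y k z ∂m := by
  have : Measurable (pastStarLik Q g U y k) := measurable_lik_left Q hm.measurable_g _ _
  rw [← lintegral_const_mul _ this, ← lintegral_const_mul _ this]
  exact ⟨lintegral_mono fun x => (h x).1, lintegral_mono fun x => (h x).2⟩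

theorem RatioBounds.of_le (hm : IsMixing Q g lam σm σp b) {U : ℕ → Bool} {y : Vertex → 𝒴}
    {k k' : ℕ} (hk : k ≤ k') {a c : ℝ} (h : RatioBounds Q g U y k a c) :
    RatioBounds Q g U y k' a c := by
  induction k', hk using Nat.le_induction with
  | base => exact h
  | succ n _ ih => exact .succ_of_lintegral fun x => ih.lintegral hm (Q x)

theorem exists_ratioBounds (hm : IsMixing Q g lam σm σp b) (U : ℕ → Bool) (y : Vertex → 𝒴)
    (k : ℕ) : ∃ a c : ℝ, σm * (refLik lam g (y root)).toReal ≤ a ∧ a ≤ c ∧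
      c ≤ σp * (refLik lam g (y root)).toReal ∧
      c - a ≤ (1 - σm / σp) ^ k * ((σp - σm) * (refLik lam g (y root)).toReal) ∧
      RatioBounds Q g U y (k + 1) a c := by
  have hp : 0 < σp := hm.pos.trans_le hm.le
  have hκ : 0 ≤ 1 - σm / σp := sub_nonneg.2 ((div_le_one hp).2 hm.le)
  have hI := refLik_lt_top hm (y root)
  induction k with
  | zero =>
    refine ⟨_, σp * (refLik lam g (y root)).toReal, le_rfl,
      mul_le_mul_of_nonneg_right hm.le ENNReal.toReal_nonneg, le_rfl, by simp [sub_mul], ?_⟩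
    refine .succ_of_lintegral fun x => ?_
    have e1 : ∀ z, pastLik Q g U y 0 z = g z (y root) := fun z => by
      simp [pastLik, pastShape, lik, obs]
    have e2 : ∀ z, pastStarLik Q g U y 0 z = 1 := fun z => rfl
    simp only [e1, e2, lintegral_const, measure_univ, mul_one, ENNReal.ofReal_mul hm.pos.le,
      ENNReal.ofReal_mul hp.le, ENNReal.ofReal_toReal hI.ne]
    constructor
    · calc _ = ∫⁻ z, g z (y root) ∂(ENNReal.ofReal σm • lam) := by rw [lintegral_smul_measure]; rfl
        _ ≤ _ := lintegral_mono' (hm.lower x) le_rfl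
    · calc _ ≤ ∫⁻ z, g z (y root) ∂(ENNReal.ofReal σp • lam) := lintegral_mono' (hm.upper x) le_rfl
        _ = _ := by rw [lintegral_smul_measure]; rfl
  | succ k ih =>
    obtain ⟨a, c, h1, h2, h5, h3, h4⟩ := ih
    have ha : 0 ≤ a := le_trans (mul_nonneg hm.pos.le ENNReal.toReal_nonneg) h1
    have mN : Measurable (pastLik Q g U y (k + 1)) := measurable_lik_left Q hm.measurable_g _ _
    have mD : Measurable (pastStarLik Q g U y (k + 1)) := measurable_lik_left Q hm.measurable_g _ _
    have tN : ∀ x, pastLik Q g U y (k + 1) x < ∞ := fun x => lik_lt_top hm _ _ _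
    have tD : ∀ x, pastStarLik Q g U y (k + 1) x < ∞ := fun x => lik_lt_top hm _ _ _
    have iN : ∫⁻ x, pastLik Q g U y (k + 1) x ∂lam < ∞ := lintegral_lik_lt_top hm _ _ _
    have iD : ∫⁻ x, pastStarLik Q g U y (k + 1) x ∂lam < ∞ := lintegral_lik_lt_top hm _ _ _
    have pD : 0 < ∫⁻ x, pastStarLik Q g U y (k + 1) x ∂lam := by
      rw [lintegral_pos_iff_support mD]
      have : Function.support (pastStarLik Q g U y (k + 1)) = Set.univ :=
        Set.eq_univ_of_forall fun x => (lik_pos hm _ _ _).ne'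
      simp [this]
    have eN : ∀ m : Measure 𝒳, ∫ x, (pastLik Q g U y (k + 1) x).toReal ∂m =
        (∫⁻ x, pastLik Q g U y (k + 1) x ∂m).toReal := fun m =>
      integral_toReal mN.aemeasurable (ae_of_all _ tN)
    have eD : ∀ m : Measure 𝒳, ∫ x, (pastStarLik Q g U y (k + 1) x).toReal ∂m =
        (∫⁻ x, pastStarLik Q g U y (k + 1) x ∂m).toReal := fun m =>
      integral_toReal mD.aemeasurable (ae_of_all _ tD)
    obtain ⟨a', c', g1, g2, g5, g3, g4⟩ := exists_ratio_bounds hm.pos hm.le hm.lower hm.upper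
      (N := fun x => (pastLik Q g U y (k + 1) x).toReal)
      (D := fun x => (pastStarLik Q g U y (k + 1) x).toReal) (a := a) (c := c)
      (integrable_toReal_of_lintegral_ne_top mN.aemeasurable iN.ne)
      (integrable_toReal_of_lintegral_ne_top mD.aemeasurable iD.ne)
      (fun x => ENNReal.toReal_nonneg) (by rw [eD]; exact ENNReal.toReal_pos pD.ne' iD.ne)
      (fun x => by
        have := ENNReal.toReal_mono (tN x).ne (h4 x).1
        rwa [ENNReal.toReal_mul, ENNReal.toReal_ofReal ha] at this)
      (fun x => by
        have := ENNReal.toReal_mono (ENNReal.mul_ne_top ENNReal.ofReal_ne_top (tD x).ne) (h4 x).2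
        rwa [ENNReal.toReal_mul, ENNReal.toReal_ofReal (ha.trans h2)] at this)
    refine ⟨a', c', h1.trans g1, g2, g5.trans h5, ?_, .succ_of_lintegral fun x => ?_⟩
    · rw [g3, pow_succ', mul_assoc]
      exact mul_le_mul_of_nonneg_left h3 hκ
    · have fN : ∫⁻ x, pastLik Q g U y (k + 1) x ∂Q x < ∞ := lintegral_lik_lt_top hm _ _ _
      have fD : ∫⁻ x, pastStarLik Q g U y (k + 1) x ∂Q x < ∞ := lintegral_lik_lt_top hm _ _ _
      have := g4 x
      rw [eN, eD] at this
      rw [← ENNReal.toReal_le_toReal (ENNReal.mul_ne_top ENNReal.ofReal_ne_top fD.ne) fN.ne,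
        ← ENNReal.toReal_le_toReal fN.ne (ENNReal.mul_ne_top ENNReal.ofReal_ne_top fD.ne),
        ENNReal.toReal_mul, ENNReal.toReal_mul, ENNReal.toReal_ofReal (ha.trans g1),
        ENNReal.toReal_ofReal ((ha.trans g1).trans g2)]
      exact this

theorem log_ratio_bounds {a c : ℝ} (ha : 0 < a) (hac : a ≤ c) {N D : ℝ≥0∞} (hN : N ≠ ∞)
    (hD0 : D ≠ 0) (hD : D ≠ ∞) (h1 : ENNReal.ofReal a * D ≤ N) (h2 : N ≤ ENNReal.ofReal c * D) :
    Real.log a ≤ Real.log (N.toReal / D.toReal) ∧ Real.log (N.toReal / D.toReal) ≤ Real.log c := by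
  have pD := ENNReal.toReal_pos hD0 hD
  have r1 := ENNReal.toReal_mono hN h1
  have r2 := ENNReal.toReal_mono (ENNReal.mul_ne_top ENNReal.ofReal_ne_top hD) h2
  rw [ENNReal.toReal_mul, ENNReal.toReal_ofReal ha.le] at r1
  rw [ENNReal.toReal_mul, ENNReal.toReal_ofReal (ha.le.trans hac)] at r2
  have q1 := (le_div_iff₀ pD).2 r1
  exact ⟨Real.log_le_log ha q1, Real.log_le_log (ha.trans_le q1) ((div_le_iff₀ pD).2 r2)⟩

/-- The log-likelihood increment at the root, given the hidden state at `p^k(∂)`. -/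
noncomputable def increment (Q : Kernel 𝒳 𝒳) (g : 𝒳 → 𝒴 → ℝ≥0∞) (U : ℕ → Bool) (y : Vertex → 𝒴)
    (k : ℕ) (x : 𝒳) : ℝ :=
  Real.log ((pastLik Q g U y k x).toReal / (pastStarLik Q g U y k x).toReal)

/-- The log-likelihood increment at the root, when the hidden state at `p^k(∂)` has law `ν`. -/
noncomputable def meanIncrement (Q : Kernel 𝒳 𝒳) (g : 𝒳 → 𝒴 → ℝ≥0∞) (ν : Measure 𝒳)
    (U : ℕ → Bool) (y : Vertex → 𝒴) (k : ℕ) : ℝ :=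
  Real.log ((∫⁻ x, pastLik Q g U y k x ∂ν).toReal / (∫⁻ x, pastStarLik Q g U y k x ∂ν).toReal)

/-- All increments from depth `k + 1` on are close to each other, uniformly in the observations. -/
theorem exists_increment_bounds (hm : IsMixing Q g lam σm σp b) {ν : Measure 𝒳}
    [IsProbabilityMeasure ν] (hν : Kernel.Invariant Q ν) (U : ℕ → Bool) (y : Vertex → 𝒴) (k : ℕ) :
    ∃ α β : ℝ, Real.log (σm * (refLik lam g (y root)).toReal) ≤ α ∧
      β ≤ Real.log (σp * (refLik lam g (y root)).toReal) ∧
      β - α ≤ (σp - σm) / σm * (1 - σm / σp) ^ k ∧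
      ∀ k', k ≤ k' → (∀ x, α ≤ increment Q g U y (k' + 1) x ∧ increment Q g U y (k' + 1) x ≤ β) ∧
        α ≤ meanIncrement Q g ν U y (k' + 1) ∧ meanIncrement Q g ν U y (k' + 1) ≤ β := by
  obtain ⟨a, c, h1, h2, h0, h3, h4⟩ := exists_ratioBounds hm U y k
  have hI : 0 < (refLik lam g (y root)).toReal :=
    ENNReal.toReal_pos (refLik_pos hm _).ne' (refLik_lt_top hm _).ne
  have hσI := mul_pos hm.pos hI
  have ha : 0 < a := hσI.trans_le h1
  refine ⟨Real.log a, Real.log c, Real.log_le_log hσI h1,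
    Real.log_le_log (ha.trans_le h2) h0, ?_, fun k' hk' => ?_⟩
  · rw [← Real.log_div (ha.trans_le h2).ne' ha.ne']
    calc Real.log (c / a) ≤ c / a - 1 := Real.log_le_sub_one_of_pos (div_pos (ha.trans_le h2) ha)
      _ = (c - a) / a := by field_simp
      _ ≤ ((1 - σm / σp) ^ k * ((σp - σm) * (refLik lam g (y root)).toReal)) /
          (σm * (refLik lam g (y root)).toReal) :=
        div_le_div₀ ((sub_nonneg.2 h2).trans h3) h3 hσI h1
      _ = _ := by field_simp
  · have h5 := h4.of_le hm (Nat.succ_le_succ hk')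
    refine ⟨fun x => log_ratio_bounds ha h2 (lik_lt_top hm _ _ _).ne (lik_pos hm _ _ _).ne'
      (lik_lt_top hm _ _ _).ne (h5 x).1 (h5 x).2, ?_⟩
    have h6 := h5.lintegral hm ν
    exact log_ratio_bounds ha h2 (lintegral_lik_lt_top hm _ _ _).ne
      (lintegral_lik_pos hm _ _ _ (le_of_invariant hm hν)).ne' (lintegral_lik_lt_top hm _ _ _).ne
      h6.1 h6.2

end Ratios

end Likelihoods

/-! ### The vertices of a shape -/

/-- The vertices of the shape `s` rooted at `v`. -/
def verts : Shape → Vertex → Finset Vertex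
  | .nil, _ => ∅
  | .node l r, v => insert v (verts l (child v false) ∪ verts r (child v true))

theorem child_injective (v : Vertex) : Function.Injective (child v) := by
  intro b b' h
  rcases v with ⟨j, w⟩ | ⟨_ | j⟩ <;> cases b <;> cases b' <;> simp_all [child, root]

theorem height_child (v : Vertex) (b : Bool) : height (child v b) = height v + 1 := by
  have := height_parent (child v b)
  rw [parent_child] at this
  omega

theorem parent_ne (v : Vertex) : parent v ≠ v := fun h => by
  have := height_parent v
  rw [h] at this
  omega

theorem exists_ancestor_of_mem_verts {s : Shape} {u v : Vertex} (h : u ∈ verts s v) :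
    ∃ n : ℕ, parent^[n] u = v ∧ height u = height v + n := by
  induction s generalizing v with
  | nil => simp [verts] at h
  | node l r hl hr =>
    have key : ∀ b, (∃ n : ℕ, parent^[n] u = child v b ∧ height u = height (child v b) + n) →
        ∃ n : ℕ, parent^[n] u = v ∧ height u = height v + n := by
      rintro b ⟨n, h1, h2⟩
      refine ⟨n + 1, ?_, ?_⟩
      · rw [Function.iterate_succ_apply', h1, parent_child]
      · rw [h2, height_child]; push_cast; ring
    simp only [verts, Finset.mem_insert, Finset.mem_union] at h
    rcases h with rfl | h | h
    · exact ⟨0, rfl, by simp⟩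
    · exact key _ (hl h)
    · exact key _ (hr h)

theorem notMem_verts_child (s : Shape) (v : Vertex) (b : Bool) : v ∉ verts s (child v b) :=
  fun h => by
    obtain ⟨n, -, hn⟩ := exists_ancestor_of_mem_verts h
    rw [height_child] at hn
    omega

theorem parent_notMem_verts (s : Shape) (v : Vertex) : parent v ∉ verts s v := fun h => by
  obtain ⟨n, -, hn⟩ := exists_ancestor_of_mem_verts h
  rw [height_parent] at hn
  omega

theorem disjoint_verts_child (s s' : Shape) (v : Vertex) :
    Disjoint (verts s (child v false)) (verts s' (child v true)) := by
  refine Finset.disjoint_left.2 fun u h h' => ?_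
  obtain ⟨n, h1, h2⟩ := exists_ancestor_of_mem_verts h
  obtain ⟨n', h1', h2'⟩ := exists_ancestor_of_mem_verts h'
  rw [height_child] at h2 h2'
  obtain rfl : n = n' := by omega
  exact absurd (child_injective v (h1.symm.trans h1')) (by simp)

theorem notMem_verts_union (l r : Shape) (v : Vertex) :
    v ∉ verts l (child v false) ∪ verts r (child v true) := by
  simp [notMem_verts_child]

theorem parent_mem_of_mem_verts {s : Shape} {u v : Vertex} (h : u ∈ verts s v) (hu : u ≠ v) :
    parent u ∈ verts s v := by
  induction s generalizing v with
  | nil => simp [verts] at h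
  | node l r hl hr =>
    simp only [verts, Finset.mem_insert, Finset.mem_union] at h ⊢
    rcases h with h | h | h
    · exact absurd h hu
    · by_cases e : u = child v false
      · exact .inl (by rw [e, parent_child])
      · exact .inr (.inl (hl h e))
    · by_cases e : u = child v true
      · exact .inl (by rw [e, parent_child])
      · exact .inr (.inr (hr h e))

/-! ### Likelihoods as integrals over the hidden states -/

section Marginal

variable {𝒳 : Type*} {𝒴 : Type u} [MeasurableSpace 𝒳] [MeasurableSpace 𝒴]

theorem lmarginal_mul_left {δ : Type*} [DecidableEq δ] {E : δ → Type*}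
    [∀ i, MeasurableSpace (E i)] (μ : ∀ i, Measure (E i)) (S : Finset δ)
    {f h : (∀ i, E i) → ℝ≥0∞} (hh : Measurable h)
    (hf : ∀ x x', (∀ i, i ∉ S → x i = x' i) → f x = f x') (x : ∀ i, E i) :
    (∫⋯∫⁻_S, (fun z => f z * h z) ∂μ) x = f x * (∫⋯∫⁻_S, h ∂μ) x := by
  unfold lmarginal
  have : ∀ y, f (Function.updateFinset x S y) = f x := fun y =>
    hf _ _ fun i hi => by simp [Function.updateFinset, hi]
  simp_rw [this]
  exact lintegral_const_mul _ (hh.comp measurable_updateFinset)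

/-- The joint density of the hidden states and observations on `S`, given the parent states. -/
noncomputable def hiddenWeight (q : 𝒳 → 𝒳 → ℝ≥0∞) (g : 𝒳 → 𝒴 → ℝ≥0∞) (y : Vertex → 𝒴)
    (S : Finset Vertex) (z : Vertex → 𝒳) : ℝ≥0∞ :=
  ∏ u ∈ S, q (z (parent u)) (z u) * g (z u) (y u)

variable {q : 𝒳 → 𝒳 → ℝ≥0∞} {g : 𝒳 → 𝒴 → ℝ≥0∞}

theorem measurable_hiddenWeight (hq : Measurable fun p : 𝒳 × 𝒳 => q p.1 p.2)
    (hg : Measurable fun p : 𝒳 × 𝒴 => g p.1 p.2) (y : Vertex → 𝒴) (S : Finset Vertex) :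
    Measurable (hiddenWeight q g y S) :=
  Finset.measurable_fun_prod S fun u _ => by
    have h1 : Measurable fun z : Vertex → 𝒳 => q (z (parent u)) (z u) :=
      hq.comp (f := fun z : Vertex → 𝒳 => (z (parent u), z u)) (by fun_prop)
    have h2 : Measurable fun z : Vertex → 𝒳 => g (z u) (y u) :=
      hg.comp (f := fun z : Vertex → 𝒳 => (z u, y u)) (by fun_prop)
    exact h1.mul h2

variable (Q : Kernel 𝒳 𝒳) [IsMarkovKernel Q] {lam : Measure 𝒳} [IsProbabilityMeasure lam]

theorem lmarginal_hiddenWeight_children (hq : Measurable fun p : 𝒳 × 𝒳 => q p.1 p.2)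
    (hg : Measurable fun p : 𝒳 × 𝒴 => g p.1 p.2) (y : Vertex → 𝒴) {l r : Shape} {c : Vertex}
    (hl : ∀ z, (∫⋯∫⁻_verts l (child c false), hiddenWeight q g y (verts l (child c false))
      ∂fun _ => lam) z = ∫⁻ a, lik Q g l a (obs y l (child c false)) ∂Q (z c))
    (hr : ∀ z, (∫⋯∫⁻_verts r (child c true), hiddenWeight q g y (verts r (child c true))
      ∂fun _ => lam) z = ∫⁻ a, lik Q g r a (obs y r (child c true)) ∂Q (z c)) (z : Vertex → 𝒳) :
    (∫⋯∫⁻_verts l (child c false) ∪ verts r (child c true),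
      hiddenWeight q g y (verts l (child c false) ∪ verts r (child c true)) ∂fun _ => lam) z =
    (∫⁻ a, lik Q g l a (obs y l (child c false)) ∂Q (z c)) *
      ∫⁻ a, lik Q g r a (obs y r (child c true)) ∂Q (z c) := by
  have hd := disjoint_verts_child l r c
  set A := verts l (child c false)
  set B := verts r (child c true)
  have mA := measurable_hiddenWeight hq hg y A
  have mB := measurable_hiddenWeight hq hg y B
  have e : hiddenWeight q g y (A ∪ B) = fun z => hiddenWeight q g y A z * hiddenWeight q g y B z :=
    funext fun z => Finset.prod_union hd
  rw [lmarginal_union _ _ (measurable_hiddenWeight hq hg y _) hd, e]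
  have e1 : (∫⋯∫⁻_B, (fun z => hiddenWeight q g y A z * hiddenWeight q g y B z) ∂fun _ => lam) =
      fun z => (∫⁻ a, lik Q g r a (obs y r (child c true)) ∂Q (z c)) * hiddenWeight q g y A z := by
    funext z
    rw [lmarginal_mul_left _ _ mB, hr, mul_comm]
    intro x x' hx
    refine Finset.prod_congr rfl fun u hu => ?_
    have h1 : x u = x' u := hx u (Finset.disjoint_left.1 hd hu)
    have h2 : x (parent u) = x' (parent u) := by
      by_cases hc : u = child c false
      · rw [hc, parent_child]; exact hx c (notMem_verts_child _ _ _)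
      · exact hx _ (Finset.disjoint_left.1 hd (parent_mem_of_mem_verts hu hc))
    rw [h1, h2]
  rw [e1, lmarginal_mul_left _ _ mA, hl, mul_comm]
  intro x x' hx
  rw [hx c (notMem_verts_child _ _ _)]

theorem lmarginal_hiddenWeight (hq : Measurable fun p : 𝒳 × 𝒳 => q p.1 p.2)
    (hg : Measurable fun p : 𝒳 × 𝒴 => g p.1 p.2) (hQ : ∀ x, Q x = lam.withDensity (q x))
    (y : Vertex → 𝒴) (s : Shape) (c : Vertex) (z : Vertex → 𝒳) :
    (∫⋯∫⁻_verts s c, hiddenWeight q g y (verts s c) ∂fun _ => lam) z =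
      ∫⁻ a, lik Q g s a (obs y s c) ∂Q (z (parent c)) := by
  induction s generalizing c z with
  | nil => simp [verts, hiddenWeight, lik]
  | node l r hl hr =>
    have hc := notMem_verts_union l r c
    have key := lmarginal_hiddenWeight_children Q hq hg y (l := l) (r := r) (c := c)
      (fun z => by rw [hl, parent_child]) (fun z => by rw [hr, parent_child])
    simp only [verts]
    set S := verts l (child c false) ∪ verts r (child c true)
    have mq : Measurable (q (z (parent c))) := hq.comp (measurable_const.prodMk measurable_id)
    rw [lmarginal_insert _ (measurable_hiddenWeight hq hg y _) hc, hQ,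
      lintegral_withDensity_eq_lintegral_mul _ mq (measurable_lik_left Q hg _ _)]
    refine lintegral_congr fun a => ?_
    have e : hiddenWeight q g y (insert c S) = fun z =>
        (q (z (parent c)) (z c) * g (z c) (y c)) * hiddenWeight q g y S z :=
      funext fun z => Finset.prod_insert hc
    rw [e, lmarginal_mul_left _ _ (measurable_hiddenWeight hq hg y _), key]
    · simp only [Function.update_self, Function.update_of_ne (parent_ne c), Pi.mul_apply, lik, obs]
      ring
    · intro x x' hx
      have : parent c ∉ S := fun h => by
        have := parent_notMem_verts (.node l r) c
        simp only [verts] at this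
        exact this (Finset.mem_insert_of_mem h)
      rw [hx c hc, hx _ this]

theorem condDensity_verts {q : 𝒳 → 𝒳 → ℝ} {g : 𝒳 → 𝒴 → ℝ} (hq0 : ∀ x x', 0 ≤ q x x')
    (hg0 : ∀ x y, 0 ≤ g x y) (hq : Measurable fun p : 𝒳 × 𝒳 => q p.1 p.2)
    (hg : Measurable fun p : 𝒳 × 𝒴 => g p.1 p.2)
    (hQ : ∀ x, Q x = lam.withDensity fun x' => ENNReal.ofReal (q x x'))
    (s : Shape) (v : Vertex) (x : 𝒳) (y : Vertex → 𝒴) :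
    condDensity lam q g (verts s v) v x y =
      (lik Q (fun x y => ENNReal.ofReal (g x y)) s x (obs y s v)).toReal := by
  cases s with
  | nil => simp [verts, condDensity, lik]
  | node l r =>
    let qe : 𝒳 → 𝒳 → ℝ≥0∞ := fun x x' => ENNReal.ofReal (q x x')
    let ge : 𝒳 → 𝒴 → ℝ≥0∞ := fun x y => ENNReal.ofReal (g x y)
    have hq' : Measurable fun p : 𝒳 × 𝒳 => qe p.1 p.2 := hq.ennreal_ofReal
    have hg' : Measurable fun p : 𝒳 × 𝒴 => ge p.1 p.2 := hg.ennreal_ofReal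
    have hne : verts (.node l r) v ≠ ∅ := by simp [verts]
    have key := lmarginal_hiddenWeight_children Q (q := qe) (g := ge) hq' hg' y (l := l) (r := r) (c := v)
      (fun z => by rw [lmarginal_hiddenWeight Q (q := qe) (g := ge) hq' hg' hQ, parent_child])
      (fun z => by rw [lmarginal_hiddenWeight Q (q := qe) (g := ge) hq' hg' hQ, parent_child]) (fun _ => x)
    have hS : (verts (.node l r) v).erase v =
        verts l (child v false) ∪ verts r (child v true) := by
      simp only [verts]
      exact Finset.erase_insert (notMem_verts_union l r v)
    have hp : ∀ u ∈ (verts (.node l r) v).erase v,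
        parent u ∉ (verts (.node l r) v).erase v → parent u = v := fun u hu hpu => by
      rw [Finset.mem_erase] at hu
      by_contra hne
      exact hpu (Finset.mem_erase.2 ⟨hne, parent_mem_of_mem_verts hu.2 hu.1⟩)
    rw [condDensity, if_neg hne]
    simp only [lik, obs, ENNReal.toReal_mul, ENNReal.toReal_ofReal (hg0 _ _)]
    congr 1
    rw [← ENNReal.toReal_mul, ← key, ← hS]
    set S := (verts (.node l r) v).erase v
    rw [integral_eq_lintegral_of_nonneg_ae]
    · unfold lmarginal
      congr 1
      refine lintegral_congr fun z => ?_
      rw [ENNReal.ofReal_prod_of_nonneg fun u _ => mul_nonneg (hq0 _ _) (hg0 _ _), hiddenWeight]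
      refine Eq.trans (Finset.prod_congr rfl fun u _ => ?_) (Finset.prod_coe_sort S fun u =>
        qe (Function.updateFinset (fun _ => x) S z (parent u))
          (Function.updateFinset (fun _ => x) S z u) *
        ge (Function.updateFinset (fun _ => x) S z u) (y u))
      rw [ENNReal.ofReal_mul (hq0 _ _)]
      congr 2
      · congr 1
        simp [Function.updateFinset]
      · simp [Function.updateFinset]
    · exact ae_of_all _ fun z => Finset.prod_nonneg fun u _ => mul_nonneg (hq0 _ _) (hg0 _ _)
    · refine (Finset.measurable_fun_prod _ fun u _ => ?_).aestronglyMeasurable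
      have h1 : Measurable fun z : S → 𝒳 =>
          if h : parent (u : Vertex) ∈ S then z ⟨parent u, h⟩ else x := by
        by_cases h : parent (u : Vertex) ∈ S
        · simpa only [dif_pos h] using measurable_pi_apply _
        · simpa only [dif_neg h] using measurable_const
      have h2 : Measurable fun z : S → 𝒳 => g (z u) (y u) :=
        hg.comp (f := fun z : S → 𝒳 => (z u, y u)) (by fun_prop)
      exact (hq.comp (h1.prodMk (measurable_pi_apply u))).mul h2

end Marginal

/-! ### The shape of the past -/

theorem subtree_eq_verts (n : ℕ) (v : Vertex) : subtree n v = verts (.full (n + 1)) v := by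
  induction n generalizing v with
  | zero => simp [subtree, Shape.full, verts]
  | succ n ih => rw [subtree, ih, ih]; rfl

theorem mem_verts_full {n j : ℕ} {w : List Bool} {u : Vertex} :
    u ∈ verts (.full n) (node j w) ↔ ∃ w' : List Bool, w'.length < n ∧ u = node j (w' ++ w) := by
  induction n generalizing w with
  | zero => simp [Shape.full, verts]
  | succ n ih =>
    simp only [Shape.full, verts, Finset.mem_insert, Finset.mem_union, child, ih]
    constructor
    · rintro (rfl | ⟨w', h, rfl⟩ | ⟨w', h, rfl⟩)
      · exact ⟨[], by simp, rfl⟩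
      · exact ⟨w' ++ [false], by simpa using h, by simp⟩
      · exact ⟨w' ++ [true], by simpa using h, by simp⟩
    · rintro ⟨w', h, rfl⟩
      rcases w'.eq_nil_or_concat with rfl | ⟨w'', b, rfl⟩
      · exact .inl rfl
      · right
        simp only [List.concat_eq_append, List.length_append, List.length_singleton] at h
        cases b
        · exact .inl ⟨w'', by omega, by simp⟩
        · exact .inr ⟨w'', by omega, by simp⟩

theorem height_parent_iterate_root (k : ℕ) : height (parent^[k] root) = -k := by
  cases k with
  | zero => rfl
  | succ k => rw [parent_iterate_root_succ]; simp [height]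

theorem label_parent_iterate_root (U : ℕ → Bool) (k : ℕ) : label U (parent^[k] root) = U k := by
  cases k with
  | zero => rfl
  | succ k => rw [parent_iterate_root_succ]; rfl

theorem parent_iterate_node (j n : ℕ) (w : List Bool) (h : n ≤ w.length) :
    parent^[n] (node j w) = node j (w.drop n) := by
  induction n generalizing w with
  | zero => rfl
  | succ n ih =>
    cases w with
    | nil => simp at h
    | cons b w => exact ih w (by simpa using h)

theorem parent_iterate_sibling (k : ℕ) (w : List Bool) (h : w.length = k) (m : ℕ) :
    parent^[k + 1 + m] (node (k + 1) w) = parent^[k + 1 + m] root := by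
  rw [add_comm _ m, Function.iterate_add_apply, Function.iterate_add_apply _ m,
    parent_iterate_root_succ, Function.iterate_succ_apply', parent_iterate_node _ _ _ h.ge]
  simp [← h, parent]

theorem bfsLT_sibling_iff (U : ℕ → Bool) (k : ℕ) (w : List Bool) (hw : w.length ≤ k) :
    bfsLT U (node (k + 1) w) root ↔ w.length < if U k then k + 1 else k := by
  have hh : height (node (k + 1) w) = w.length - k := rfl
  have h0 : height root = 0 := rfl
  rw [bfsLT, hh, h0]
  rcases hw.lt_or_eq with hlt | heq
  · have h1 : ((w.length : ℤ) - k < 0) := by omega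
    have h2 : w.length < if U k then k + 1 else k := by split_ifs <;> omega
    simp [h1, h2]
  · have e1 : parent^[k] (node (k + 1) w) = node (k + 1) [] := by
      rw [parent_iterate_node _ _ _ heq.ge]; simp [← heq]
    constructor
    · rintro (h | ⟨-, n, h1, h2, h3⟩)
      · omega
      · rcases lt_trichotomy n k with hn | rfl | hn
        · rw [parent_iterate_node _ _ _ (by omega), parent_iterate_root_succ] at h1
          cases h1
        · rw [label_parent_iterate_root] at h3
          simp [h3, heq]
        · obtain ⟨m, rfl⟩ := Nat.exists_eq_add_of_lt hn
          rw [add_right_comm, parent_iterate_sibling k w heq] at h2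
          rw [add_right_comm, h2] at h3
          cases h3
    · intro h
      have hU : U k = true := by
        by_contra hU
        simp [hU, heq] at h
      refine .inr ⟨by omega, k, parent_iterate_sibling k w heq 0, ?_, ?_⟩
      · rw [e1]; simp [label, hU]
      · rw [label_parent_iterate_root, hU]

theorem pastStar_root (U : ℕ → Bool) (k : ℕ) :
    pastStar U root k = verts (pastStarShape U k) (parent^[k] root) := by
  classical
  induction k with
  | zero =>
    have : ¬ bfsLT U root root := by
      rintro (h | ⟨-, n, -, h1, h2⟩)
      · exact lt_irrefl _ h
      · rw [h1] at h2; cases h2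
    simp [pastStar, subtree, pastStarShape, verts, this]
  | succ k ih =>
    have hlt : bfsLT U (parent^[k + 1] root) root := by
      left
      rw [height_parent_iterate_root]
      change _ < (0 : ℤ)
      push_cast
      omega
    have hc := child_parent_iterate_root k
    have hs : child (parent^[k + 1] root) true = node (k + 1) [] := by
      rw [parent_iterate_root_succ]
      cases k <;> rfl
    have hsib : (subtree k (node (k + 1) [])).filter (fun v => bfsLT U v root) =
        verts (.full (if U k then k + 1 else k)) (node (k + 1) []) := by
      ext u
      rw [Finset.mem_filter, subtree_eq_verts, mem_verts_full, mem_verts_full]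
      constructor
      · rintro ⟨⟨w, h, rfl⟩, hb⟩
        rw [List.append_nil, bfsLT_sibling_iff U k w (by omega)] at hb
        exact ⟨w, hb, rfl⟩
      · rintro ⟨w, h, rfl⟩
        have hw : w.length ≤ k := by
          split_ifs at h <;> omega
        refine ⟨⟨w, by omega, rfl⟩, ?_⟩
        rw [List.append_nil, bfsLT_sibling_iff U k w hw]
        exact h
    unfold pastStar at ih ⊢
    rw [subtree, Finset.filter_insert, if_pos hlt, Finset.filter_union, hc, hs, ih, pastStarShape,
      verts, hc, hs]
    congr 2

theorem past_root (U : ℕ → Bool) (k : ℕ) :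
    past U root k = verts (pastShape U k) (parent^[k] root) := by
  rw [past, pastStar_root]
  induction k with
  | zero => simp [pastShape, pastStarShape, verts]
  | succ k ih =>
    rw [pastShape, pastStarShape, verts, verts, child_parent_iterate_root, ← ih,
      Finset.insert_comm, Finset.insert_union]

/-! ### The law of a hidden Markov tree process on a shape -/

section Rectangles

variable {𝒴 : Type u}

/-- Measurable rectangles of labellings. -/
def rect : ∀ s, Vertex → (Vertex → Set 𝒴) → Set (Obs 𝒴 s)
  | .nil, _, _ => Set.univ
  | .node l r, v, B => B v ×ˢ (rect l (child v false) B ×ˢ rect r (child v true) B)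

theorem rect_congr {s : Shape} {v : Vertex} {B B' : Vertex → Set 𝒴}
    (h : ∀ u ∈ verts s v, B u = B' u) : rect s v B = rect s v B' := by
  induction s generalizing v with
  | nil => rfl
  | node l r hl hr =>
    simp only [verts, Finset.mem_insert, Finset.mem_union] at h
    rw [rect, rect, h v (.inl rfl), hl fun u hu => h u (.inr (.inl hu)),
      hr fun u hu => h u (.inr (.inr hu))]

theorem obs_mem_rect {s : Shape} {v : Vertex} {B : Vertex → Set 𝒴} {y : Vertex → 𝒴} :
    obs y s v ∈ rect s v B ↔ ∀ u ∈ verts s v, y u ∈ B u := by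
  induction s generalizing v with
  | nil => simp [rect, verts]
  | node l r hl hr =>
    simp only [rect, obs, verts, Set.mem_prod, hl, hr, Finset.forall_mem_insert,
      Finset.forall_mem_union]

theorem rect_inter (s : Shape) (v : Vertex) (B B' : Vertex → Set 𝒴) :
    rect s v B ∩ rect s v B' = rect s v fun u => B u ∩ B' u := by
  induction s generalizing v with
  | nil => simp [rect]
  | node l r hl hr => simp only [rect, Set.prod_inter_prod, hl, hr]

theorem rect_univ (s : Shape) (v : Vertex) : rect s v (fun _ => (Set.univ : Set 𝒴)) = Set.univ := by
  induction s generalizing v with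
  | nil => rfl
  | node l r hl hr => rw [rect, hl, hr, Set.univ_prod_univ, Set.univ_prod_univ]

variable [MeasurableSpace 𝒴]

/-- The set of measurable rectangles. -/
def rects (𝒴 : Type u) [MeasurableSpace 𝒴] (s : Shape) (v : Vertex) : Set (Set (Obs 𝒴 s)) :=
  {R | ∃ B : Vertex → Set 𝒴, (∀ u, MeasurableSet (B u)) ∧ rect s v B = R}

theorem measurableSet_rect {s : Shape} {v : Vertex} {B : Vertex → Set 𝒴}
    (h : ∀ u, MeasurableSet (B u)) : MeasurableSet (rect s v B) := by
  induction s generalizing v with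
  | nil => exact MeasurableSet.univ
  | node l r hl hr => exact (h v).prod (hl.prod hr)

theorem univ_mem_rects (s : Shape) (v : Vertex) : Set.univ ∈ rects 𝒴 s v :=
  ⟨fun _ => Set.univ, fun _ => MeasurableSet.univ, rect_univ s v⟩

theorem isPiSystem_rects (s : Shape) (v : Vertex) : IsPiSystem (rects 𝒴 s v) := by
  rintro _ ⟨B, hB, rfl⟩ _ ⟨B', hB', rfl⟩ -
  exact ⟨fun u => B u ∩ B' u, fun u => (hB u).inter (hB' u), (rect_inter s v B B').symm⟩

theorem generateFrom_rects (s : Shape) (v : Vertex) :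
    MeasurableSpace.generateFrom (rects 𝒴 s v) = Obs.measurableSpace 𝒴 s := by
  classical
  refine le_antisymm (MeasurableSpace.generateFrom_le ?_) ?_
  · rintro _ ⟨B, hB, rfl⟩
    exact measurableSet_rect hB
  have span : ∀ {s : Shape} {v : Vertex}, IsCountablySpanning (rects 𝒴 s v) := fun {s v} =>
    ⟨fun _ => Set.univ, fun _ => univ_mem_rects s v, Set.iUnion_const _⟩
  induction s generalizing v with
  | nil =>
    intro S _
    rcases S.eq_empty_or_nonempty with rfl | ⟨t, ht⟩
    · exact MeasurableSpace.measurableSet_empty _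
    · have : S = Set.univ := Set.eq_univ_of_forall fun t' => by
        rwa [Subsingleton.elim t' t]
      rw [this]
      exact MeasurableSpace.measurableSet_generateFrom (univ_mem_rects _ _)
  | node l r hl hr =>
    have el := le_antisymm (MeasurableSpace.generateFrom_le (by
      rintro _ ⟨B, hB, rfl⟩
      exact measurableSet_rect hB)) (hl (child v false))
    have er := le_antisymm (MeasurableSpace.generateFrom_le (by
      rintro _ ⟨B, hB, rfl⟩
      exact measurableSet_rect hB)) (hr (child v true))
    have e1 := generateFrom_eq_prod el er span span
    have span2 : IsCountablySpanning (Set.image2 (fun x1 x2 => x1 ×ˢ x2)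
        (rects 𝒴 l (child v false)) (rects 𝒴 r (child v true))) := span.prod span
    have e2 := generateFrom_eq_prod (MeasurableSpace.generateFrom_measurableSet (α := 𝒴)) e1
      isCountablySpanning_measurableSet span2
    change Prod.instMeasurableSpace ≤ _
    rw [← e2]
    refine MeasurableSpace.generateFrom_le ?_
    rintro _ ⟨S, hS, _, ⟨_, ⟨B1, h1, rfl⟩, _, ⟨B2, h2, rfl⟩, rfl⟩, rfl⟩
    refine MeasurableSpace.measurableSet_generateFrom ⟨fun u => if u = v then S else
      if u ∈ verts l (child v false) then B1 u else B2 u, fun u => ?_, ?_⟩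
    · dsimp only
      split_ifs
      exacts [hS, h1 u, h2 u]
    · rw [rect, if_pos rfl]
      congr 2
      · refine rect_congr fun u hu => ?_
        have : u ≠ v := fun e => notMem_verts_child l v false (e ▸ hu)
        rw [if_neg this, if_pos hu]
      · refine rect_congr fun u hu => ?_
        have : u ≠ v := fun e => notMem_verts_child r v true (e ▸ hu)
        rw [if_neg this, if_neg (Finset.disjoint_right.1 (disjoint_verts_child l r v) hu)]

theorem ext_of_rect {s : Shape} (v : Vertex) {m m' : Measure (Obs 𝒴 s)} [IsFiniteMeasure m]
    (h : ∀ B : Vertex → Set 𝒴, (∀ u, MeasurableSet (B u)) → m (rect s v B) = m' (rect s v B)) :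
    m = m' := by
  refine ext_of_generate_finite (rects 𝒴 s v) (generateFrom_rects s v).symm (isPiSystem_rects s v)
    ?_ ?_
  · rintro _ ⟨B, hB, rfl⟩
    exact h B hB
  · have := h (fun _ => Set.univ) fun _ => MeasurableSet.univ
    rwa [rect_univ] at this

theorem measurable_obs {Ω : Type*} [MeasurableSpace Ω] {Y : Vertex → Ω → 𝒴}
    (hY : ∀ v, Measurable (Y v)) (s : Shape) (v : Vertex) :
    Measurable fun ω => obs (fun u => Y u ω) s v := by
  induction s generalizing v with
  | nil => exact measurable_const
  | node l r hl hr => exact (hY v).prodMk ((hl _).prodMk (hr _))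

end Rectangles

/-- The number of generations of a shape. -/
def Shape.depth : Shape → ℕ
  | .nil => 0
  | .node l r => max l.depth r.depth + 1

theorem verts_subset_subtree {s : Shape} {n : ℕ} (h : s.depth ≤ n) (v : Vertex) :
    verts s v ⊆ subtree n v := by
  induction s generalizing n v with
  | nil => simp [verts]
  | node l r hl hr =>
    obtain ⟨m, rfl⟩ : ∃ m, n = m + 1 := ⟨n - 1, by simp only [Shape.depth] at h; omega⟩
    simp only [Shape.depth] at h
    rw [verts, subtree]
    exact Finset.insert_subset_insert _ (Finset.union_subset_union (hl (by omega) _)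
      (hr (by omega) _))

section Laws

variable {𝒳 : Type*} {𝒴 : Type u} {Ω : Type*} [MeasurableSpace 𝒳] [MeasurableSpace 𝒴]
  [MeasurableSpace Ω] (Q : Kernel 𝒳 𝒳) [IsMarkovKernel Q] (G : Kernel 𝒳 𝒴) [IsMarkovKernel G]

theorem obsKernel_nil_univ (x : 𝒳) : obsKernel Q G .nil x Set.univ = 1 := by
  simp [obsKernel]

theorem obsKernel_node_prod {l r : Shape} (x : 𝒳) (S : Set 𝒴) {R : Set (Obs 𝒴 l)}
    {R' : Set (Obs 𝒴 r)} (hR : MeasurableSet R) (hR' : MeasurableSet R') :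
    obsKernel Q G (.node l r) x (S ×ˢ (R ×ˢ R')) =
      G x S * ((∫⁻ z, obsKernel Q G l z R ∂Q x) * ∫⁻ z, obsKernel Q G r z R' ∂Q x) := by
  change (G ×ₖ ((obsKernel Q G l ∘ₖ Q) ×ₖ (obsKernel Q G r ∘ₖ Q))) x _ = _
  rw [Kernel.prod_apply, Measure.prod_prod, Kernel.prod_apply, Measure.prod_prod,
    Kernel.comp_apply' _ _ _ hR, Kernel.comp_apply' _ _ _ hR']

theorem branchMass_eq_one {A : Vertex → Set 𝒳} {n : ℕ} {v : Vertex}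
    (h : ∀ u ∈ subtree n v, A u = Set.univ) (x : 𝒳) : branchMass Q A n v x = 1 := by
  induction n generalizing v x with
  | zero => simp [branchMass, h v (by simp [subtree])]
  | succ n ih =>
    simp only [subtree, Finset.mem_insert, Finset.mem_union] at h
    simp [branchMass, h v (.inl rfl), ih fun u hu => h u (.inr (.inl hu)),
      ih fun u hu => h u (.inr (.inr hu))]

theorem branchMass_eq {A : Vertex → Set 𝒳} (hA : ∀ v, MeasurableSet (A v)) {s : Shape} {n : ℕ}
    (hs : s.depth ≤ n) {v : Vertex} (h : ∀ u ∈ subtree n v, u ∉ verts s v → A u = Set.univ)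
    (x : 𝒳) : branchMass Q A n v x = obsKernel Q Kernel.id s x (rect s v A) := by
  induction s generalizing n v x with
  | nil =>
    rw [branchMass_eq_one Q (fun u hu => h u hu (by simp [verts])), rect, obsKernel_nil_univ]
  | node l r hl hr =>
    obtain ⟨m, rfl⟩ : ∃ m, n = m + 1 := ⟨n - 1, by simp only [Shape.depth] at hs; omega⟩
    simp only [Shape.depth] at hs
    have key : ∀ b u, u ∈ subtree m (child v b) → u ≠ v := fun b u hu e => by
      rw [subtree_eq_verts] at hu
      exact notMem_verts_child _ v b (e ▸ hu)
    have h1 := fun z => hl (n := m) (by omega) (v := child v false) (fun u hu hu' => h u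
      (by simp [subtree, hu]) (by
        simp only [verts, Finset.mem_insert, Finset.mem_union, not_or]
        refine ⟨key _ _ hu, hu', fun hr => ?_⟩
        rw [subtree_eq_verts] at hu
        exact Finset.disjoint_left.1 (disjoint_verts_child _ _ v) hu hr)) z
    have h2 := fun z => hr (n := m) (by omega) (v := child v true) (fun u hu hu' => h u
      (by simp [subtree, hu]) (by
        simp only [verts, Finset.mem_insert, Finset.mem_union, not_or]
        refine ⟨key _ _ hu, fun hl => ?_, hu'⟩
        rw [subtree_eq_verts] at hu
        exact Finset.disjoint_left.1 (disjoint_verts_child _ _ v) hl hu)) z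
    rw [rect, obsKernel_node_prod Q _ x _ (measurableSet_rect hA) (measurableSet_rect hA),
      Kernel.id_apply, Measure.dirac_apply' _ (hA v), branchMass, Fintype.prod_bool, mul_comm (∫⁻ _, _ ∂_)]
    simp_rw [h1, h2]

variable {Q G} {ν : Measure 𝒳} [IsProbabilityMeasure ν] {P : Measure Ω} [IsProbabilityMeasure P]
  {X : Vertex → Ω → 𝒳} {Y : Vertex → Ω → 𝒴} {v : Vertex}

theorem IsBranchingMarkov.map_obs (h : IsBranchingMarkov v Q ν X P) (s : Shape) :
    P.map (fun ω => obs (fun u => X u ω) s v) = obsLaw Q Kernel.id ν s := by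
  classical
  have hm := measurable_obs h.measurable s v
  have := Measure.isProbabilityMeasure_map (μ := P) hm.aemeasurable
  refine ext_of_rect v fun B hB => ?_
  let A : Vertex → Set 𝒳 := fun u => if u ∈ verts s v then B u else Set.univ
  have hA : ∀ u, MeasurableSet (A u) := fun u => by
    dsimp only [A]
    split_ifs
    exacts [hB u, MeasurableSet.univ]
  have e : rect s v B = rect s v A := rect_congr fun u hu => by simp [A, hu]
  rw [Measure.map_apply hm (measurableSet_rect hB), e, obsLaw,
    Measure.bind_apply (measurableSet_rect hA) (Kernel.aemeasurable _)]
  have h1 := h.law s.depth A hA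
  have h2 : {ω | ∀ u ∈ subtree s.depth v, X u ω ∈ A u} =
      (fun ω => obs (fun u => X u ω) s v) ⁻¹' rect s v A := by
    ext ω
    simp only [Set.mem_ofPred_eq, Set.mem_preimage, obs_mem_rect]
    refine ⟨fun h u hu => h u (verts_subset_subtree le_rfl v hu), fun h u _ => ?_⟩
    by_cases hu : u ∈ verts s v
    · exact h u hu
    · simp [A, hu]
  rw [← h2, h1]
  exact lintegral_congr fun x => branchMass_eq Q hA le_rfl (fun u _ hu => by simp [A, hu]) x

/-- The product of a family of functions over the labels. -/
noncomputable def labelProd (φ : Vertex → 𝒳 → ℝ≥0∞) : ∀ s, Vertex → Obs 𝒳 s → ℝ≥0∞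
  | .nil, _, _ => 1
  | .node l r, v, t =>
    φ v t.1 * (labelProd φ l (child v false) t.2.1 * labelProd φ r (child v true) t.2.2)

theorem measurable_labelProd {φ : Vertex → 𝒳 → ℝ≥0∞} (hφ : ∀ u, Measurable (φ u)) (s : Shape)
    (v : Vertex) : Measurable (labelProd φ s v) := by
  induction s generalizing v with
  | nil => exact measurable_const
  | node l r hl hr =>
    exact ((hφ v).comp measurable_fst).mul (((hl _).comp measurable_snd.fst).mul
      ((hr _).comp measurable_snd.snd))

theorem labelProd_obs (φ : Vertex → 𝒳 → ℝ≥0∞) (s : Shape) (v : Vertex) (x : Vertex → 𝒳) :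
    labelProd φ s v (obs x s v) = ∏ u ∈ verts s v, φ u (x u) := by
  induction s generalizing v with
  | nil => simp [labelProd, verts]
  | node l r hl hr =>
    rw [verts, Finset.prod_insert (notMem_verts_union l r v),
      Finset.prod_union (disjoint_verts_child l r v), labelProd, obs, hl, hr]

variable (Q G) in
theorem lintegral_labelProd {B : Vertex → Set 𝒴} (hB : ∀ u, MeasurableSet (B u)) (s : Shape)
    (v : Vertex) (x : 𝒳) :
    ∫⁻ t, labelProd (fun u z => G z (B u)) s v t ∂obsKernel Q Kernel.id s x =
      obsKernel Q G s x (rect s v B) := by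
  have mφ : ∀ u, Measurable fun z => G z (B u) := fun u => Kernel.measurable_coe _ (hB u)
  induction s generalizing v x with
  | nil =>
    calc _ = ∫⁻ _, 1 ∂obsKernel Q (Kernel.id : Kernel 𝒳 𝒳) .nil x := rfl
      _ = 1 := by rw [lintegral_one, obsKernel_nil_univ]
      _ = _ := (obsKernel_nil_univ Q G x).symm
  | node l r hl hr =>
    have ml := measurable_labelProd mφ l (child v false)
    have mr := measurable_labelProd mφ r (child v true)
    rw [rect, obsKernel_node_prod Q _ x _ (measurableSet_rect hB) (measurableSet_rect hB)]
    simp_rw [← hl, ← hr]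
    rw [← Kernel.lintegral_comp _ _ _ ml, ← Kernel.lintegral_comp _ _ _ mr,
      ← lintegral_prod_mul ml.aemeasurable mr.aemeasurable]
    have e : obsKernel Q (Kernel.id : Kernel 𝒳 𝒳) (.node l r) x =
        (Measure.dirac x).prod (((obsKernel Q Kernel.id l ∘ₖ Q) x).prod
          ((obsKernel Q Kernel.id r ∘ₖ Q) x)) := by
      change (Kernel.id ×ₖ ((obsKernel Q Kernel.id l ∘ₖ Q) ×ₖ (obsKernel Q Kernel.id r ∘ₖ Q))) x = _
      rw [Kernel.prod_apply, Kernel.prod_apply, Kernel.id_apply]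
    have mp : Measurable fun p : Obs 𝒳 l × Obs 𝒳 r =>
        labelProd (fun u z => G z (B u)) l (child v false) p.1 *
          labelProd (fun u z => G z (B u)) r (child v true) p.2 :=
      (ml.comp measurable_fst).mul (mr.comp measurable_snd)
    have e2 := lintegral_prod_mul (μ := Measure.dirac x)
      (ν := ((obsKernel Q Kernel.id l ∘ₖ Q) x).prod ((obsKernel Q Kernel.id r ∘ₖ Q) x))
      (mφ v).aemeasurable mp.aemeasurable
    rw [lintegral_dirac' _ (mφ v)] at e2
    rw [e, ← e2]
    rfl

theorem IsHMT.map_obs (h : IsHMT v Q G ν X Y P) (s : Shape) :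
    P.map (fun ω => obs (fun u => Y u ω) s v) = obsLaw Q G ν s := by
  classical
  have hm := measurable_obs h.measurable s v
  have := Measure.isProbabilityMeasure_map (μ := P) hm.aemeasurable
  refine ext_of_rect v fun B hB => ?_
  let A : Vertex → Set 𝒴 := fun u => if u ∈ verts s v then B u else Set.univ
  have hA : ∀ u, MeasurableSet (A u) := fun u => by
    dsimp only [A]
    split_ifs
    exacts [hB u, MeasurableSet.univ]
  have e : rect s v B = rect s v A := rect_congr fun u hu => by simp [A, hu]
  rw [Measure.map_apply hm (measurableSet_rect hB), e, obsLaw,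
    Measure.bind_apply (measurableSet_rect hA) (Kernel.aemeasurable _)]
  have h1 := h.observed s.depth (fun _ => Set.univ) A (fun _ => MeasurableSet.univ) hA
  have h2 : {ω | ∀ u ∈ subtree s.depth v, X u ω ∈ Set.univ ∧ Y u ω ∈ A u} =
      (fun ω => obs (fun u => Y u ω) s v) ⁻¹' rect s v A := by
    ext ω
    simp only [Set.mem_ofPred_eq, Set.mem_preimage, obs_mem_rect, Set.mem_univ, true_and]
    refine ⟨fun h u hu => h u (verts_subset_subtree le_rfl v hu), fun h u _ => ?_⟩
    by_cases hu : u ∈ verts s v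
    · exact h u hu
    · simp [A, hu]
  have mφ : ∀ u, Measurable fun z => G z (A u) := fun u => Kernel.measurable_coe _ (hA u)
  have h3 : ∀ ω, ∏ u ∈ subtree s.depth v,
      (Set.univ : Set 𝒳).indicator 1 (X u ω) * G (X u ω) (A u) =
      labelProd (fun u z => G z (A u)) s v (obs (fun u => X u ω) s v) := fun ω => by
    rw [labelProd_obs]
    refine (Finset.prod_subset (verts_subset_subtree le_rfl v) fun u _ hu => ?_).symm.trans ?_
    · simp [A, hu]
    · simp
  rw [← h2, h1]
  simp_rw [h3]
  have h4 := lintegral_map (μ := P) (measurable_labelProd mφ s v)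
    (measurable_obs h.hidden.measurable s v)
  rw [← h4, h.hidden.map_obs, obsLaw, Measure.lintegral_bind (Kernel.aemeasurable _)
    (measurable_labelProd mφ s v).aemeasurable]
  exact lintegral_congr fun x => lintegral_labelProd Q G hA s v x

end Laws

/-! ### Averages over the random plane order -/

theorem measurable_pastShape_comp {α β : Type*} [MeasurableSpace α] [MeasurableSpace β] (k : ℕ)
    {F : Shape → Shape → β → α} (hF : ∀ s s', Measurable (F s s')) :
    Measurable fun p : (ℕ → Bool) × β => F (pastShape p.1 k) (pastStarShape p.1 k) p.2 := by
  induction k generalizing F with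
  | zero => exact (hF _ _).comp measurable_snd
  | succ k ih =>
    have hset : MeasurableSet {p : (ℕ → Bool) × β | p.1 k = true} :=
      measurableSet_eq_fun (by fun_prop) measurable_const
    have h : Measurable fun p : (ℕ → Bool) × β => if p.1 k = true then
        F (.node (pastShape p.1 k) (.full (k + 1))) (.node (pastStarShape p.1 k) (.full (k + 1))) p.2
        else F (.node (pastShape p.1 k) (.full k)) (.node (pastStarShape p.1 k) (.full k)) p.2 :=
      Measurable.ite hset
      (ih (F := fun s s' => F (.node s (.full (k + 1))) (.node s' (.full (k + 1)))) fun _ _ => hF _ _)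
      (ih (F := fun s s' => F (.node s (.full k)) (.node s' (.full k))) fun _ _ => hF _ _)
    convert h using 1
    funext p
    simp only [pastShape, pastStarShape]
    split_ifs <;> rfl

theorem exists_bound_pastShape (k : ℕ) (D : Shape → Shape → ℝ) :
    ∃ C, ∀ U, |D (pastShape U k) (pastStarShape U k)| ≤ C := by
  induction k generalizing D with
  | zero => exact ⟨|D (.node .nil .nil) .nil|, fun U => le_rfl⟩
  | succ k ih =>
    obtain ⟨C, hC⟩ := ih fun s s' => D (.node s (.full (k + 1))) (.node s' (.full (k + 1)))
    obtain ⟨C', hC'⟩ := ih fun s s' => D (.node s (.full k)) (.node s' (.full k))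
    refine ⟨max C C', fun U => ?_⟩
    simp only [pastShape, pastStarShape]
    split_ifs
    · exact (hC U).trans (le_max_left _ _)
    · exact (hC' U).trans (le_max_right _ _)

theorem integrable_pastShape (k : ℕ) (D : Shape → Shape → ℝ) :
    Integrable (fun U => D (pastShape U k) (pastStarShape U k)) spineLaw := by
  obtain ⟨C, hC⟩ := exists_bound_pastShape k D
  have hm : Measurable fun U : ℕ → Bool => D (pastShape U k) (pastStarShape U k) :=
    (measurable_pastShape_comp (β := Unit) k (F := fun s s' _ => D s s')
      fun _ _ => measurable_const).comp (measurable_id.prodMk (measurable_const (a := ())))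
  exact (integrable_const C).mono' hm.aestronglyMeasurable (ae_of_all _ hC)

/-- Exchange of the labels at level `k`. -/
def flipBit (k : ℕ) (U : ℕ → Bool) (i : ℕ) : Bool := if i = k then !U i else U i

theorem pastShape_flipBit {j k : ℕ} (h : k ≤ j) (U : ℕ → Bool) :
    pastShape (flipBit j U) k = pastShape U k ∧
      pastStarShape (flipBit j U) k = pastStarShape U k := by
  induction k with
  | zero => exact ⟨rfl, rfl⟩
  | succ k ih =>
    have : flipBit j U k = U k := if_neg (by omega)
    rw [pastShape, pastStarShape, (ih (by omega)).1, (ih (by omega)).2, this]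
    exact ⟨rfl, rfl⟩

theorem measurePreserving_flipBit (k : ℕ) : MeasurePreserving (flipBit k) spineLaw spineLaw := by
  have hm : ∀ i, Measurable (fun b : Bool => if i = k then !b else b) := fun i =>
    measurable_of_countable _
  refine ⟨measurable_pi_iff.2 fun i => (hm i).comp (measurable_pi_apply i), ?_⟩
  unfold spineLaw
  have := Measure.infinitePi_map_pi (μ := fun _ : ℕ => (PMF.uniformOfFintype Bool).toMeasure) hm
  refine (this.trans ?_)
  congr 1
  funext i
  split_ifs
  · rw [PMF.toMeasure_map _ _ (measurable_of_countable _)]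
    congr 1
    ext b
    cases b <;> simp [PMF.map_apply]
  · exact Measure.map_id

theorem integral_pastShape_succ (k : ℕ) (D : Shape → Shape → ℝ) :
    ∫ U, D (pastShape U (k + 1)) (pastStarShape U (k + 1)) ∂spineLaw =
      2⁻¹ * (∫ U, D (.node (pastShape U k) (.full (k + 1)))
          (.node (pastStarShape U k) (.full (k + 1))) ∂spineLaw +
        ∫ U, D (.node (pastShape U k) (.full k)) (.node (pastStarShape U k) (.full k))
          ∂spineLaw) := by
  have hfl := measurePreserving_flipBit k
  have i1 := integrable_pastShape (k + 1) D
  have e1 : ∫ U, D (pastShape (flipBit k U) (k + 1)) (pastStarShape (flipBit k U) (k + 1))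
      ∂spineLaw = ∫ U, D (pastShape U (k + 1)) (pastStarShape U (k + 1)) ∂spineLaw := by
    have := i1.aestronglyMeasurable
    rw [← hfl.map_eq] at this
    have := integral_map hfl.measurable.aemeasurable this
    rw [hfl.map_eq] at this
    exact this.symm
  have i2 : Integrable (fun U => D (pastShape (flipBit k U) (k + 1))
      (pastStarShape (flipBit k U) (k + 1))) spineLaw := hfl.integrable_comp_of_integrable i1
  have e2 : ∫ U, (D (pastShape U (k + 1)) (pastStarShape U (k + 1)) +
      D (pastShape (flipBit k U) (k + 1)) (pastStarShape (flipBit k U) (k + 1))) ∂spineLaw =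
      ∫ U, (D (.node (pastShape U k) (.full (k + 1))) (.node (pastStarShape U k) (.full (k + 1))) +
        D (.node (pastShape U k) (.full k)) (.node (pastStarShape U k) (.full k))) ∂spineLaw := by
    refine integral_congr_ae (ae_of_all _ fun U => ?_)
    have hk : flipBit k U k = !U k := if_pos rfl
    simp only [pastShape, pastStarShape, pastShape_flipBit le_rfl, hk]
    cases U k
    · simp [add_comm]
    · simp
  rw [integral_add i1 i2, e1, integral_add
    (integrable_pastShape k fun s s' => D (.node s (.full (k + 1))) (.node s' (.full (k + 1))))
    (integrable_pastShape k fun s s' => D (.node s (.full k)) (.node s' (.full k)))] at e2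
  linarith

/-- Averaged over the plane orders, the increments of an exchangeable functional along the last
generation telescope. -/
theorem integral_pastShape_sub (k : ℕ) {A : Shape → ℝ} (hA : ∀ s s', s.Swap s' → A s = A s') :
    ∫ U, (A (pastShape U k) - A (pastStarShape U k)) ∂spineLaw =
      (2 ^ k)⁻¹ * (A (.full (k + 1)) - A (.full k)) := by
  induction k generalizing A with
  | zero => simp [pastShape, pastStarShape, Shape.full]
  | succ k ih =>
    rw [integral_pastShape_succ k fun s s' => A s - A s',
      ih (A := fun s => A (.node s (.full (k + 1)))) fun s s' h => hA _ _ (.left _ h),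
      ih (A := fun s => A (.node s (.full k))) fun s s' h => hA _ _ (.left _ h),
      hA (.node (.full (k + 1)) (.full k)) _ (.swap _ _)]
    have e1 : Shape.full (k + 1 + 1) = .node (.full (k + 1)) (.full (k + 1)) := rfl
    have e2 : A (.full (k + 1)) = A (.node (.full k) (.full k)) := rfl
    rw [e1, e2, pow_succ]
    field_simp
    ring

/-! ### The increment with infinite past -/

section Limit

variable {𝒳 : Type*} {𝒴 : Type u} {Ω : Type*} [MeasurableSpace 𝒳] [MeasurableSpace 𝒴]
  [MeasurableSpace Ω]
  {Q : Kernel 𝒳 𝒳} [IsMarkovKernel Q] {g : 𝒳 → 𝒴 → ℝ≥0∞} {lam : Measure 𝒳}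
  [IsProbabilityMeasure lam] {σm σp b : ℝ} {ν : Measure 𝒳} [IsProbabilityMeasure ν]

theorem IsMixing.rate_nonneg (h : IsMixing Q g lam σm σp b) : 0 ≤ 1 - σm / σp :=
  sub_nonneg.2 ((div_le_one (h.pos.trans_le h.le)).2 h.le)

theorem IsMixing.rate_lt_one (h : IsMixing Q g lam σm σp b) : 1 - σm / σp < 1 :=
  sub_lt_self _ (div_pos h.pos (h.pos.trans_le h.le))

theorem IsMixing.tendsto_rate (h : IsMixing Q g lam σm σp b) (B : ℝ) :
    Tendsto (fun k : ℕ => B * (1 - σm / σp) ^ k) atTop (𝓝 0) := by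
  simpa using (tendsto_pow_atTop_nhds_zero_of_lt_one h.rate_nonneg h.rate_lt_one).const_mul B

/-- The increments converge geometrically, uniformly in the observations and the base state. -/
theorem exists_limit_increment (hm : IsMixing Q g lam σm σp b) (hν : Kernel.Invariant Q ν)
    (U : ℕ → Bool) (y : Vertex → 𝒴) : ∃ h : ℝ, ∀ k : ℕ,
      (∀ x, |increment Q g U y (k + 1) x - h| ≤ (σp - σm) / σm * (1 - σm / σp) ^ k) ∧
        |meanIncrement Q g ν U y (k + 1) - h| ≤ (σp - σm) / σm * (1 - σm / σp) ^ k := by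
  have hne : (lam Set.univ) ≠ 0 := by simp
  obtain ⟨x₀, -⟩ := nonempty_of_measure_ne_zero hne
  have hb := exists_increment_bounds hm hν U y
  have hc : CauchySeq fun k : ℕ => increment Q g U y (k + 1) x₀ := by
    refine cauchySeq_of_le_tendsto_0 _ (fun n m N hn hN => ?_) (hm.tendsto_rate ((σp - σm) / σm))
    obtain ⟨α, β, -, -, h1, h2⟩ := hb N
    have e1 := (h2 n hn).1 x₀
    have e2 := (h2 m hN).1 x₀
    rw [Real.dist_eq, abs_le]
    constructor <;> linarith [e1.1, e1.2, e2.1, e2.2]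
  obtain ⟨h, hh⟩ := cauchySeq_tendsto_of_complete hc
  refine ⟨h, fun k => ?_⟩
  obtain ⟨α, β, -, -, h1, h2⟩ := hb k
  have hα : α ≤ h := ge_of_tendsto hh (eventually_atTop.2 ⟨k, fun n hn => ((h2 n hn).1 x₀).1⟩)
  have hβ : h ≤ β := le_of_tendsto hh (eventually_atTop.2 ⟨k, fun n hn => ((h2 n hn).1 x₀).2⟩)
  obtain ⟨h3, h4, h5⟩ := h2 k le_rfl
  refine ⟨fun x => ?_, ?_⟩
  · rw [abs_le]
    constructor <;> linarith [(h3 x).1, (h3 x).2]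
  · rw [abs_le]
    constructor <;> linarith

theorem abs_increment_one_le (hm : IsMixing Q g lam σm σp b) (hν : Kernel.Invariant Q ν)
    (U : ℕ → Bool) (y : Vertex → 𝒴) (x : 𝒳) :
    |increment Q g U y 1 x| ≤ |Real.log σm| + |Real.log σp| + absLog lam g (y root) := by
  obtain ⟨α, β, h1, h2, -, h3⟩ := exists_increment_bounds hm hν U y 0
  obtain ⟨h4, h5⟩ := (h3 0 le_rfl).1 x
  have hI : (refLik lam g (y root)).toReal ≠ 0 :=
    (ENNReal.toReal_pos (refLik_pos hm _).ne' (refLik_lt_top hm _).ne).ne'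
  rw [Real.log_mul hm.pos.ne' hI] at h1
  rw [Real.log_mul (hm.pos.trans_le hm.le).ne' hI] at h2
  have a1 := neg_abs_le (Real.log σm)
  have a2 := le_abs_self (Real.log σp)
  have a3 := neg_abs_le (Real.log (refLik lam g (y root)).toReal)
  have a4 := le_abs_self (Real.log (refLik lam g (y root)).toReal)
  have a5 := abs_nonneg (Real.log σm)
  have a6 := abs_nonneg (Real.log σp)
  rw [zero_add] at h4 h5
  unfold absLog
  rw [abs_le]
  constructor <;> linarith

theorem measurable_increment (hm : IsMixing Q g lam σm σp b) {Y : Vertex → Ω → 𝒴}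
    (hY : ∀ v, Measurable (Y v)) (k : ℕ) (x : 𝒳) :
    Measurable fun s : (ℕ → Bool) × Ω => increment Q g s.1 (fun v => Y v s.2) k x :=
  measurable_pastShape_comp k (F := fun s s' ω => Real.log
    ((lik Q g s x (obs (fun v => Y v ω) s (parent^[k] root))).toReal /
      (lik Q g s' x (obs (fun v => Y v ω) s' (parent^[k] root))).toReal)) fun s s' =>
    (((measurable_lik_right Q hm.measurable_g s x).comp (measurable_obs hY s _)).ennreal_toReal.div
      ((measurable_lik_right Q hm.measurable_g s' x).comp
        (measurable_obs hY s' _)).ennreal_toReal).log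

theorem meanIncrement_eq (hm : IsMixing Q g lam σm σp b) (hν : Kernel.Invariant Q ν)
    (U : ℕ → Bool) (y : Vertex → 𝒴) (k : ℕ) :
    meanIncrement Q g ν U y k = logMeanLik Q g ν (pastShape U k) (obs y _ (parent^[k] root)) -
      logMeanLik Q g ν (pastStarShape U k) (obs y _ (parent^[k] root)) :=
  Real.log_div (ENNReal.toReal_pos (meanLik_pos hm hν _ _).ne' (meanLik_lt_top hm _ _).ne).ne'
    (ENNReal.toReal_pos (meanLik_pos hm hν _ _).ne' (meanLik_lt_top hm _ _).ne).ne'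

theorem measurable_meanIncrement (hm : IsMixing Q g lam σm σp b) {Y : Vertex → Ω → 𝒴}
    (hY : ∀ v, Measurable (Y v)) (k : ℕ) :
    Measurable fun s : (ℕ → Bool) × Ω => meanIncrement Q g ν s.1 (fun v => Y v s.2) k :=
  measurable_pastShape_comp k (F := fun s s' ω => Real.log
    ((meanLik Q g ν s (obs (fun v => Y v ω) s (parent^[k] root))).toReal /
      (meanLik Q g ν s' (obs (fun v => Y v ω) s' (parent^[k] root))).toReal)) fun s s' =>
    (((measurable_meanLik Q hm.measurable_g ν s).comp (measurable_obs hY s _)).ennreal_toReal.div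
      ((measurable_meanLik Q hm.measurable_g ν s').comp
        (measurable_obs hY s' _)).ennreal_toReal).log

/-- The expected log-likelihood, on a shape, of the model `(Q, g, ν)` under the law of the model
`(Q', G', ν')`. -/
noncomputable def expLogLik (Q : Kernel 𝒳 𝒳) (g : 𝒳 → 𝒴 → ℝ≥0∞) (ν : Measure 𝒳)
    (Q' : Kernel 𝒳 𝒳) (G' : Kernel 𝒳 𝒴) (ν' : Measure 𝒳) (s : Shape) : ℝ :=
  ∫ t, logMeanLik Q g ν s t ∂obsLaw Q' G' ν' s

variable {Q' : Kernel 𝒳 𝒳} [IsMarkovKernel Q'] {G' : Kernel 𝒳 𝒴} [IsMarkovKernel G']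
  {ν' : Measure 𝒳} [IsProbabilityMeasure ν']

theorem measurable_logMeanLik (hm : IsMixing Q g lam σm σp b) (s : Shape) :
    Measurable (logMeanLik Q g ν s) :=
  (measurable_meanLik Q hm.measurable_g ν s).ennreal_toReal.log

theorem expLogLik_swap (hm : IsMixing Q g lam σm σp b) {s s' : Shape} (h : s.Swap s') :
    expLogLik Q g ν Q' G' ν' s = expLogLik Q g ν Q' G' ν' s' := by
  obtain ⟨σ, hσ, h1, h2⟩ := h.exists_map (𝒳 := 𝒳) (𝒴 := 𝒴)
  have e : (obsLaw Q' G' ν' s).map σ = obsLaw Q' G' ν' s' := by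
    unfold obsLaw
    rw [Measure.map_comp _ _ hσ]
    congr 1
    ext1 x
    rw [Kernel.map_apply _ hσ, h1]
  have e2 : ∀ t, logMeanLik Q g ν s t = logMeanLik Q g ν s' (σ t) := fun t => by
    unfold logMeanLik meanLik
    simp_rw [h2]
  unfold expLogLik
  rw [← e, integral_map hσ.aemeasurable (measurable_logMeanLik hm s').aestronglyMeasurable]
  exact integral_congr_ae (ae_of_all _ e2)

variable {P : Measure Ω} [IsProbabilityMeasure P] {Y : Vertex → Ω → 𝒴}

/-- A function on the probability space that is uniformly approximated by the increments. -/
structure IsLimitIncrement (Q : Kernel 𝒳 𝒳) (g : 𝒳 → 𝒴 → ℝ≥0∞) (ν : Measure 𝒳)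
    (Y : Vertex → Ω → 𝒴) (B ρ : ℝ) (L : (ℕ → Bool) × Ω → ℝ) : Prop where
  increment_sub : ∀ k s x, |increment Q g s.1 (fun v => Y v s.2) (k + 1) x - L s| ≤ B * ρ ^ k
  meanIncrement_sub : ∀ k s, |meanIncrement Q g ν s.1 (fun v => Y v s.2) (k + 1) - L s| ≤ B * ρ ^ k

theorem IsLimitIncrement.tendsto {L : (ℕ → Bool) × Ω → ℝ}
    (hm : IsMixing Q g lam σm σp b)
    (hL : IsLimitIncrement Q g ν Y ((σp - σm) / σm) (1 - σm / σp) L) (x : 𝒳)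
    (s : (ℕ → Bool) × Ω) :
    Tendsto (fun k : ℕ => increment Q g s.1 (fun v => Y v s.2) k x) atTop (𝓝 (L s)) := by
  rw [← tendsto_add_atTop_iff_nat 1, tendsto_iff_dist_tendsto_zero]
  exact squeeze_zero (fun _ => dist_nonneg) (fun k => hL.increment_sub k s x)
    (hm.tendsto_rate _)

theorem IsLimitIncrement.measurable {L : (ℕ → Bool) × Ω → ℝ} (hm : IsMixing Q g lam σm σp b)
    (hL : IsLimitIncrement Q g ν Y ((σp - σm) / σm) (1 - σm / σp) L)
    (hY : ∀ v, Measurable (Y v)) : Measurable L := by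
  have hne : (lam Set.univ) ≠ 0 := by simp
  obtain ⟨x₀, -⟩ := nonempty_of_measure_ne_zero hne
  exact measurable_of_tendsto_metrizable (fun k => measurable_increment hm hY k x₀)
    (tendsto_pi_nhds.2 fun s => hL.tendsto hm x₀ s)

theorem IsLimitIncrement.integrable {L : (ℕ → Bool) × Ω → ℝ} (hm : IsMixing Q g lam σm σp b)
    (hν : Kernel.Invariant Q ν)
    (hL : IsLimitIncrement Q g ν Y ((σp - σm) / σm) (1 - σm / σp) L)
    (hY : ∀ v, Measurable (Y v)) (hint : Integrable (fun ω => absLog lam g (Y root ω)) P) :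
    Integrable L (spineLaw.prod P) := by
  have hne : (lam Set.univ) ≠ 0 := by simp
  obtain ⟨x₀, -⟩ := nonempty_of_measure_ne_zero hne
  refine (((integrable_const (|Real.log σm| + |Real.log σp|)).add (hint.comp_snd spineLaw)).add
    (integrable_const ((σp - σm) / σm))).mono' (hL.measurable hm hY).aestronglyMeasurable
    (ae_of_all _ fun s => ?_)
  have h1 := hL.increment_sub 0 s x₀
  have h2 := abs_increment_one_le hm hν s.1 (fun v => Y v s.2) x₀
  rw [pow_zero, mul_one, zero_add] at h1
  have h3 := abs_sub_abs_le_abs_sub (L s) (increment Q g s.1 (fun v => Y v s.2) 1 x₀)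
  rw [abs_sub_comm] at h3
  simp only [Real.norm_eq_abs, Pi.add_apply]
  linarith

theorem IsLimitIncrement.tendsto_eLpNorm {L : (ℕ → Bool) × Ω → ℝ}
    (hm : IsMixing Q g lam σm σp b)
    (hL : IsLimitIncrement Q g ν Y ((σp - σm) / σm) (1 - σm / σp) L) (x : 𝒳) :
    Tendsto (fun k : ℕ => eLpNorm (fun s : (ℕ → Bool) × Ω =>
      increment Q g s.1 (fun v => Y v s.2) k x - L s) 1 (spineLaw.prod P)) atTop (𝓝 0) := by
  rw [← tendsto_add_atTop_iff_nat 1]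
  have h0 : Tendsto (fun k : ℕ => ENNReal.ofReal ((σp - σm) / σm * (1 - σm / σp) ^ k)) atTop
      (𝓝 0) := by
    simpa using ENNReal.tendsto_ofReal (hm.tendsto_rate ((σp - σm) / σm))
  refine tendsto_of_tendsto_of_tendsto_of_le_of_le tendsto_const_nhds h0 (fun _ => zero_le)
    fun k => ?_
  have := eLpNorm_le_of_ae_bound (p := 1) (μ := spineLaw.prod P)
    (f := fun s : (ℕ → Bool) × Ω => increment Q g s.1 (fun v => Y v s.2) (k + 1) x - L s)
    (C := (σp - σm) / σm * (1 - σm / σp) ^ k) (ae_of_all _ fun s => hL.increment_sub k s x)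
  simpa using this

theorem integral_meanIncrement (hm : IsMixing Q g lam σm σp b) (hν : Kernel.Invariant Q ν)
    (hν' : Kernel.Invariant Q' ν') (hint' : Integrable (absLog lam g) (G' ∘ₘ ν')) {k : ℕ}
    (hY : ∀ v, Measurable (Y v))
    (hlaw : ∀ s, P.map (fun ω => obs (fun u => Y u ω) s (parent^[k] root)) = obsLaw Q' G' ν' s)
    (hi : Integrable (fun s : (ℕ → Bool) × Ω => meanIncrement Q g ν s.1 (fun v => Y v s.2) k)
      (spineLaw.prod P)) :
    ∫ s, meanIncrement Q g ν s.1 (fun v => Y v s.2) k ∂(spineLaw.prod P) =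
      (2 ^ k)⁻¹ * (expLogLik Q g ν Q' G' ν' (.full (k + 1)) -
        expLogLik Q g ν Q' G' ν' (.full k)) := by
  have hmo := fun s => (measurable_obs hY s (parent^[k] root)).aemeasurable (μ := P)
  have i1 : ∀ s, Integrable (fun ω => logMeanLik Q g ν s
      (obs (fun u => Y u ω) s (parent^[k] root))) P := fun s => by
    have := integrable_logMeanLik (G' := G') hm hν hν' hint' s
    rw [← hlaw s] at this
    exact this.comp_aemeasurable (hmo s)
  have e1 : ∀ s, ∫ ω, logMeanLik Q g ν s (obs (fun u => Y u ω) s (parent^[k] root)) ∂P =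
      expLogLik Q g ν Q' G' ν' s := fun s => by
    rw [expLogLik, ← hlaw s, integral_map (hmo s) (measurable_logMeanLik hm s).aestronglyMeasurable]
  rw [integral_prod _ hi, ← integral_pastShape_sub k fun s s' h => expLogLik_swap hm h]
  refine integral_congr_ae (ae_of_all _ fun U => ?_)
  simp_rw [meanIncrement_eq hm hν]
  rw [integral_sub (i1 _) (i1 _), e1, e1]

theorem IsLimitIncrement.tendsto_expLogLik {L : (ℕ → Bool) × Ω → ℝ}
    (hm : IsMixing Q g lam σm σp b) (hν : Kernel.Invariant Q ν)
    (hL : IsLimitIncrement Q g ν Y ((σp - σm) / σm) (1 - σm / σp) L)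
    (hν' : Kernel.Invariant Q' ν') (hint' : Integrable (absLog lam g) (G' ∘ₘ ν'))
    (hY : ∀ v, Measurable (Y v)) (hint : Integrable (fun ω => absLog lam g (Y root ω)) P)
    (hlaw : ∀ k s,
      P.map (fun ω => obs (fun u => Y u ω) s (parent^[k] root)) = obsLaw Q' G' ν' s) :
    Tendsto (fun k : ℕ => ((2 : ℝ) ^ k)⁻¹ * (expLogLik Q g ν Q' G' ν' (.full (k + 1)) -
      expLogLik Q g ν Q' G' ν' (.full k))) atTop (𝓝 (∫ s, L s ∂(spineLaw.prod P))) := by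
  have hLi := hL.integrable hm hν hY hint
  have hd : ∀ k, Integrable (fun s : (ℕ → Bool) × Ω =>
      meanIncrement Q g ν s.1 (fun v => Y v s.2) (k + 1) - L s) (spineLaw.prod P) := fun k =>
    (integrable_const ((σp - σm) / σm * (1 - σm / σp) ^ k)).mono'
      ((measurable_meanIncrement hm hY _).sub (hL.measurable hm hY)).aestronglyMeasurable
      (ae_of_all _ fun s => hL.meanIncrement_sub k s)
  have hi : ∀ k, Integrable (fun s : (ℕ → Bool) × Ω =>
      meanIncrement Q g ν s.1 (fun v => Y v s.2) (k + 1)) (spineLaw.prod P) := fun k => by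
    refine ((hd k).add hLi).congr (ae_of_all _ fun s => ?_)
    simp
  rw [← tendsto_add_atTop_iff_nat 1, tendsto_iff_dist_tendsto_zero]
  refine squeeze_zero (fun _ => dist_nonneg) (fun k => ?_) (hm.tendsto_rate ((σp - σm) / σm))
  rw [← integral_meanIncrement hm hν hν' hint' hY (hlaw (k + 1)) (hi k), Real.dist_eq,
    ← integral_sub (hi k) hLi]
  have := norm_integral_le_of_norm_le_const (μ := spineLaw.prod P)
    (f := fun s : (ℕ → Bool) × Ω => meanIncrement Q g ν s.1 (fun v => Y v s.2) (k + 1) - L s)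
    (C := (σp - σm) / σm * (1 - σm / σp) ^ k) (ae_of_all _ fun s => hL.meanIncrement_sub k s)
  simpa using this

end Limit

/-! ### Relative entropy -/

section Entropy

variable {α : Type*} [MeasurableSpace α] {ref : Measure α} {p p' F : α → ℝ≥0∞}

theorem lintegral_ratio (hp : Measurable p) (hp' : Measurable p') (hF : Measurable F)
    (h0' : ∀ t, 0 < p' t) (h1' : ∀ t, p' t < ∞) :
    ∫⁻ t, F t * (p t / p' t) ∂ref.withDensity p' = ∫⁻ t, F t ∂ref.withDensity p := by
  have hR : Measurable fun t => F t * (p t / p' t) := hF.mul (hp.div hp')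
  rw [lintegral_withDensity_eq_lintegral_mul _ hp' hR,
    lintegral_withDensity_eq_lintegral_mul _ hp hF]
  refine lintegral_congr fun t => ?_
  simp only [Pi.mul_apply]
  rw [mul_left_comm, ENNReal.mul_div_cancel (h0' t).ne' (h1' t).ne, mul_comm]

/-- The variational bound for the relative entropy. -/
theorem integral_log_le (hp : Measurable p) (hp' : Measurable p') (hF : Measurable F)
    (h0 : ∀ t, 0 < p t) (h1 : ∀ t, p t < ∞) (h0' : ∀ t, 0 < p' t) (h1' : ∀ t, p' t < ∞)
    (hF0 : ∀ t, 0 < F t) (hF1 : ∀ t, F t < ∞) [IsProbabilityMeasure (ref.withDensity p')]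
    (ip : Integrable (fun t => Real.log (p t).toReal) (ref.withDensity p'))
    (ip' : Integrable (fun t => Real.log (p' t).toReal) (ref.withDensity p'))
    (iF : Integrable (fun t => Real.log (F t).toReal) (ref.withDensity p')) {C : ℝ} (hC : 0 < C)
    (hFC : ∫⁻ t, F t ∂ref.withDensity p ≤ ENNReal.ofReal C) :
    ∫ t, Real.log (F t).toReal ∂ref.withDensity p' -
      (∫ t, Real.log (p' t).toReal ∂ref.withDensity p' -
        ∫ t, Real.log (p t).toReal ∂ref.withDensity p') ≤ Real.log C := by
  set m := ref.withDensity p'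
  let R : α → ℝ≥0∞ := fun t => F t * (p t / p' t)
  have hR : Measurable R := hF.mul (hp.div hp')
  have lR : ∫⁻ t, R t ∂m ≤ ENNReal.ofReal C := by
    rw [lintegral_ratio hp hp' hF h0' h1']; exact hFC
  have R0 : ∀ t, 0 < (R t).toReal := fun t => ENNReal.toReal_pos
    (mul_ne_zero (hF0 t).ne' (ENNReal.div_pos (h0 t).ne' (h1' t).ne).ne')
    (ENNReal.mul_ne_top (hF1 t).ne (ENNReal.div_lt_top (h1 t).ne (h0' t).ne').ne)
  have iR : Integrable (fun t => (R t).toReal) m :=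
    integrable_toReal_of_lintegral_ne_top hR.aemeasurable (lR.trans_lt ENNReal.ofReal_lt_top).ne
  have eR : ∫ t, (R t).toReal ∂m ≤ C := by
    rw [integral_toReal hR.aemeasurable
      (ae_lt_top hR (lR.trans_lt ENNReal.ofReal_lt_top).ne)]
    exact ENNReal.toReal_le_of_le_ofReal hC.le lR
  have elog : ∀ t, Real.log (R t).toReal = Real.log (F t).toReal -
      (Real.log (p' t).toReal - Real.log (p t).toReal) := fun t => by
    simp only [R]
    rw [ENNReal.toReal_mul, ENNReal.toReal_div,
      Real.log_mul (ENNReal.toReal_pos (hF0 t).ne' (hF1 t).ne).ne'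
        (div_pos (ENNReal.toReal_pos (h0 t).ne' (h1 t).ne)
          (ENNReal.toReal_pos (h0' t).ne' (h1' t).ne)).ne',
      Real.log_div (ENNReal.toReal_pos (h0 t).ne' (h1 t).ne).ne'
        (ENNReal.toReal_pos (h0' t).ne' (h1' t).ne).ne']
    ring
  have il : Integrable (fun t => Real.log (p' t).toReal - Real.log (p t).toReal) m := ip'.sub ip
  rw [← integral_sub ip' ip, ← integral_sub iF il]
  have ib : Integrable (fun t => Real.log C - 1 + C⁻¹ * (R t).toReal) m :=
    (integrable_const _).add (iR.const_mul _)
  calc _ ≤ ∫ t, (Real.log C - 1 + C⁻¹ * (R t).toReal) ∂m := by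
        refine integral_mono (iF.sub il) ib fun t => ?_
        dsimp only
        rw [← elog]
        have := Real.log_le_sub_one_of_pos (mul_pos (inv_pos.2 hC) (R0 t))
        rw [Real.log_mul (inv_pos.2 hC).ne' (R0 t).ne', Real.log_inv] at this
        linarith
    _ = Real.log C - 1 + C⁻¹ * ∫ t, (R t).toReal ∂m := by
        rw [integral_add (integrable_const _) (iR.const_mul _), integral_const_mul]
        simp
    _ ≤ Real.log C - 1 + C⁻¹ * C := by gcongr
    _ = Real.log C := by rw [inv_mul_cancel₀ hC.ne']; ring

/-- Densities with nonpositive relative entropy agree. -/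
theorem ae_eq_of_entropy_nonpos (hp : Measurable p) (hp' : Measurable p')
    (h0 : ∀ t, 0 < p t) (h1 : ∀ t, p t < ∞) (h0' : ∀ t, 0 < p' t) (h1' : ∀ t, p' t < ∞)
    [IsProbabilityMeasure (ref.withDensity p')] [IsProbabilityMeasure (ref.withDensity p)]
    (ip : Integrable (fun t => Real.log (p t).toReal) (ref.withDensity p'))
    (ip' : Integrable (fun t => Real.log (p' t).toReal) (ref.withDensity p'))
    (h : ∫ t, Real.log (p' t).toReal ∂ref.withDensity p' -
        ∫ t, Real.log (p t).toReal ∂ref.withDensity p' ≤ 0) : p =ᵐ[ref] p' := by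
  set m := ref.withDensity p' with hm
  let R : α → ℝ≥0∞ := fun t => p t / p' t
  have hR : Measurable R := hp.div hp'
  have lR : ∫⁻ t, R t ∂m = 1 := by
    have := lintegral_ratio (ref := ref) hp hp' (measurable_const (a := (1 : ℝ≥0∞))) h0' h1'
    simpa [R] using this
  have R0 : ∀ t, 0 < (R t).toReal := fun t => ENNReal.toReal_pos
    (ENNReal.div_pos (h0 t).ne' (h1' t).ne).ne' (ENNReal.div_lt_top (h1 t).ne (h0' t).ne').ne
  have iR : Integrable (fun t => (R t).toReal) m :=
    integrable_toReal_of_lintegral_ne_top hR.aemeasurable (by simp [lR])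
  have eR : ∫ t, (R t).toReal ∂m = 1 := by
    rw [integral_toReal hR.aemeasurable (ae_lt_top hR (by simp [lR])), lR, ENNReal.toReal_one]
  have elog : ∀ t, Real.log (R t).toReal = Real.log (p t).toReal - Real.log (p' t).toReal :=
    fun t => by
      simp only [R]
      rw [ENNReal.toReal_div, Real.log_div (ENNReal.toReal_pos (h0 t).ne' (h1 t).ne).ne'
        (ENNReal.toReal_pos (h0' t).ne' (h1' t).ne).ne']
  have iD : Integrable (fun t => (R t).toReal - 1 -
      (Real.log (p t).toReal - Real.log (p' t).toReal)) m :=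
    (iR.sub (integrable_const 1)).sub (ip.sub ip')
  have nD : ∀ t, 0 ≤ (R t).toReal - 1 - (Real.log (p t).toReal - Real.log (p' t).toReal) :=
    fun t => by
      rw [← elog]
      linarith [Real.log_le_sub_one_of_pos (R0 t)]
  have zD : ∫ t, ((R t).toReal - 1 - (Real.log (p t).toReal - Real.log (p' t).toReal)) ∂m = 0 := by
    refine le_antisymm ?_ (integral_nonneg nD)
    have j1 : Integrable (fun t => (R t).toReal - 1) m := iR.sub (integrable_const 1)
    have j2 : Integrable (fun t => Real.log (p t).toReal - Real.log (p' t).toReal) m := ip.sub ip'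
    rw [integral_sub j1 j2, integral_sub iR
      (integrable_const 1), integral_sub ip ip', eR]
    simp only [integral_const, probReal_univ, one_smul]
    linarith
  have ae1 := (integral_eq_zero_iff_of_nonneg nD iD).1 zD
  rw [hm] at ae1
  have ae2 := (ae_withDensity_iff hp').1 ae1
  filter_upwards [ae2] with t ht
  have h3 := ht (h0' t).ne'
  simp only [Pi.zero_apply, ← elog] at h3
  have h4 : (R t).toReal = 1 := by
    by_contra hne
    linarith [Real.log_lt_sub_one_of_pos (R0 t) hne]
  have h5 : R t = 1 := by
    rw [← ENNReal.toReal_one] at h4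
    exact (ENNReal.toReal_eq_toReal_iff' (ENNReal.div_lt_top (h1 t).ne (h0' t).ne').ne
      ENNReal.one_ne_top).1 h4
  exact (ENNReal.div_eq_one_iff (h0' t).ne' (h1' t).ne).1 h5

end Entropy

/-! ### Blocks -/

/-- The complete binary shape with `j` generations, with a copy of `s` below each leaf. -/
def Shape.graft (s : Shape) : ℕ → Shape
  | 0 => s
  | j + 1 => .node (s.graft j) (s.graft j)

theorem Shape.graft_full (n j : ℕ) : (Shape.full n).graft j = .full (n + j) := by
  induction j with
  | zero => rfl
  | succ j ih => rw [Shape.graft, ih]; rfl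

section Blocks

variable {𝒳 : Type*} {𝒴 : Type u} [MeasurableSpace 𝒳] [MeasurableSpace 𝒴] {s : Shape}

/-- The function `f` of the labels of the leftmost copy of `s`. -/
def leftmost (f : Obs 𝒴 s → ℝ≥0∞) : ∀ j, Obs 𝒴 (s.graft j) → ℝ≥0∞
  | 0, t => f t
  | j + 1, t => leftmost f j t.2.1

/-- The product of the function `f` of the labels over all the copies of `s`. -/
noncomputable def blockProd (f : Obs 𝒴 s → ℝ≥0∞) : ∀ m, Obs 𝒴 (s.graft m) → ℝ≥0∞
  | 0, t => f t
  | m + 1, t => blockProd f m t.2.1 * blockProd f m t.2.2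

theorem measurable_leftmost {f : Obs 𝒴 s → ℝ≥0∞} (hf : Measurable f) :
    ∀ j, Measurable (leftmost f j)
  | 0 => hf
  | j + 1 => (measurable_leftmost hf j).comp measurable_snd.fst

theorem measurable_blockProd {f : Obs 𝒴 s → ℝ≥0∞} (hf : Measurable f) :
    ∀ m, Measurable (blockProd f m)
  | 0 => hf
  | m + 1 => ((measurable_blockProd hf m).comp measurable_snd.fst).mul
      ((measurable_blockProd hf m).comp measurable_snd.snd)

theorem leftmost_pos {f : Obs 𝒴 s → ℝ≥0∞} (hf : ∀ t, 0 < f t ∧ f t < ∞) :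
    ∀ j t, 0 < leftmost f j t ∧ leftmost f j t < ∞
  | 0, t => hf t
  | j + 1, t => leftmost_pos hf j t.2.1

theorem blockProd_pos {f : Obs 𝒴 s → ℝ≥0∞} (hf : ∀ t, 0 < f t ∧ f t < ∞) :
    ∀ m t, 0 < blockProd f m t ∧ blockProd f m t < ∞
  | 0, t => hf t
  | m + 1, t => ⟨ENNReal.mul_pos (blockProd_pos hf m _).1.ne' (blockProd_pos hf m _).1.ne',
      ENNReal.mul_lt_top (blockProd_pos hf m _).2 (blockProd_pos hf m _).2⟩

variable {Q : Kernel 𝒳 𝒳} [IsMarkovKernel Q] {G : Kernel 𝒳 𝒴} [IsMarkovKernel G]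
  {ν : Measure 𝒳} [IsProbabilityMeasure ν]

theorem lintegral_obsKernel_node {l r : Shape} (x : 𝒳) {F : Obs 𝒴 l → ℝ≥0∞}
    {H : Obs 𝒴 r → ℝ≥0∞} (hF : Measurable F) (hH : Measurable H) :
    ∫⁻ t, F t.2.1 * H t.2.2 ∂obsKernel Q G (.node l r) x =
      (∫⁻ z, ∫⁻ t, F t ∂obsKernel Q G l z ∂Q x) * ∫⁻ z, ∫⁻ t, H t ∂obsKernel Q G r z ∂Q x := by
  rw [← Kernel.lintegral_comp _ _ _ hF, ← Kernel.lintegral_comp _ _ _ hH,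
    ← lintegral_prod_mul hF.aemeasurable hH.aemeasurable]
  have mp : Measurable fun p : Obs 𝒴 l × Obs 𝒴 r => F p.1 * H p.2 :=
    (hF.comp measurable_fst).mul (hH.comp measurable_snd)
  have e := lintegral_prod_mul (μ := G x)
    (ν := ((obsKernel Q G l ∘ₖ Q) x).prod ((obsKernel Q G r ∘ₖ Q) x))
    (measurable_const (a := (1 : ℝ≥0∞))).aemeasurable mp.aemeasurable
  simp only [one_mul, lintegral_one, measure_univ] at e
  rw [← e]
  change ∫⁻ t, F t.2.1 * H t.2.2 ∂(G ×ₖ ((obsKernel Q G l ∘ₖ Q) ×ₖ (obsKernel Q G r ∘ₖ Q))) x = _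
  rw [Kernel.prod_apply, Kernel.prod_apply]

theorem lintegral_leftmost_succ {f : Obs 𝒴 s → ℝ≥0∞} (hf : Measurable f) (j : ℕ) (x : 𝒳) :
    ∫⁻ t, leftmost f (j + 1) t ∂obsKernel Q G (s.graft (j + 1)) x =
      ∫⁻ z, ∫⁻ t, leftmost f j t ∂obsKernel Q G (s.graft j) z ∂Q x := by
  have := lintegral_obsKernel_node (Q := Q) (G := G) x (measurable_leftmost hf j)
    (measurable_const : Measurable fun _ : Obs 𝒴 (s.graft j) => (1 : ℝ≥0∞))
  simp only [mul_one, lintegral_one, measure_univ] at this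
  exact this

theorem lintegral_leftmost {f : Obs 𝒴 s → ℝ≥0∞} (hν : Kernel.Invariant Q ν) (hf : Measurable f)
    (j : ℕ) : ∫⁻ t, leftmost f j t ∂obsLaw Q G ν (s.graft j) = ∫⁻ t, f t ∂obsLaw Q G ν s := by
  induction j with
  | zero => rfl
  | succ j ih =>
    rw [← ih, ← map_left_obsLaw Q G (s.graft j) (s.graft j) hν,
      lintegral_map (measurable_leftmost hf j) measurable_snd.fst]
    rfl

theorem lintegral_blockProd_le {f : Obs 𝒴 s → ℝ≥0∞} (hf : Measurable f) {c : ℝ≥0∞}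
    (hc : ∀ x, ∫⁻ t, f t ∂obsKernel Q G s x ≤ c) (m : ℕ) (x : 𝒳) :
    ∫⁻ t, blockProd f m t ∂obsKernel Q G (s.graft m) x ≤ c ^ 2 ^ m := by
  induction m generalizing x with
  | zero => rw [pow_zero, pow_one]; exact hc x
  | succ m ih =>
    have h1 : ∫⁻ z, ∫⁻ t, blockProd f m t ∂obsKernel Q G (s.graft m) z ∂Q x ≤ c ^ 2 ^ m := by
      calc _ ≤ ∫⁻ _, c ^ 2 ^ m ∂Q x := lintegral_mono ih
        _ = _ := by simp
    calc _ = _ := lintegral_obsKernel_node x (measurable_blockProd hf m) (measurable_blockProd hf m)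
      _ ≤ c ^ 2 ^ m * c ^ 2 ^ m := mul_le_mul' h1 h1
      _ = c ^ 2 ^ (m + 1) := by rw [← pow_add, pow_succ, mul_two]

theorem integral_log_leftmost {f : Obs 𝒴 s → ℝ≥0∞} (hν : Kernel.Invariant Q ν)
    (hf : Measurable f)
    (hi : Integrable (fun t => Real.log (f t).toReal) (obsLaw Q G ν s)) (j : ℕ) :
    Integrable (fun t => Real.log (leftmost f j t).toReal) (obsLaw Q G ν (s.graft j)) ∧
      ∫ t, Real.log (leftmost f j t).toReal ∂obsLaw Q G ν (s.graft j) =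
        ∫ t, Real.log (f t).toReal ∂obsLaw Q G ν s := by
  induction j with
  | zero => exact ⟨hi, rfl⟩
  | succ j ih =>
    have hm := map_left_obsLaw Q G (s.graft j) (s.graft j) hν
    have hl : Measurable fun t => Real.log (leftmost f j t).toReal :=
      (measurable_leftmost hf j).ennreal_toReal.log
    obtain ⟨i1, e1⟩ := ih
    rw [← hm] at i1 e1
    rw [integral_map measurable_snd.fst.aemeasurable hl.aestronglyMeasurable] at e1
    exact ⟨i1.comp_measurable measurable_snd.fst, e1⟩

theorem integral_log_blockProd {f : Obs 𝒴 s → ℝ≥0∞} (hν : Kernel.Invariant Q ν)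
    (hf : Measurable f) (hpos : ∀ t, 0 < f t ∧ f t < ∞)
    (hi : Integrable (fun t => Real.log (f t).toReal) (obsLaw Q G ν s)) (m : ℕ) :
    Integrable (fun t => Real.log (blockProd f m t).toReal) (obsLaw Q G ν (s.graft m)) ∧
      ∫ t, Real.log (blockProd f m t).toReal ∂obsLaw Q G ν (s.graft m) =
        2 ^ m * ∫ t, Real.log (f t).toReal ∂obsLaw Q G ν s := by
  induction m with
  | zero => exact ⟨hi, by rw [pow_zero, one_mul]; rfl⟩
  | succ m ih =>
    have hml := map_left_obsLaw Q G (s.graft m) (s.graft m) hν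
    have hmr := map_right_obsLaw Q G (s.graft m) (s.graft m) hν
    have hl : Measurable fun t => Real.log (blockProd f m t).toReal :=
      (measurable_blockProd hf m).ennreal_toReal.log
    obtain ⟨i1, e1⟩ := ih
    have i2 := i1
    have e2 := e1
    rw [← hml] at i1 e1
    rw [← hmr] at i2 e2
    have j1 := i1.comp_measurable measurable_snd.fst
    have j2 := i2.comp_measurable measurable_snd.snd
    rw [integral_map measurable_snd.fst.aemeasurable hl.aestronglyMeasurable] at e1
    rw [integral_map measurable_snd.snd.aemeasurable hl.aestronglyMeasurable] at e2
    have e : ∀ t : Obs 𝒴 (s.graft (m + 1)), Real.log (blockProd f (m + 1) t).toReal =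
        Real.log (blockProd f m t.2.1).toReal + Real.log (blockProd f m t.2.2).toReal := fun t => by
      have h1 := blockProd_pos hpos m t.2.1
      have h2 := blockProd_pos hpos m t.2.2
      rw [blockProd, ENNReal.toReal_mul, Real.log_mul (ENNReal.toReal_pos h1.1.ne' h1.2.ne).ne'
        (ENNReal.toReal_pos h2.1.ne' h2.2.ne).ne']
    simp_rw [e]
    refine ⟨j1.add j2, (integral_add j1 j2).trans ?_⟩
    calc _ = 2 ^ m * ∫ t, Real.log (f t).toReal ∂obsLaw Q G ν s +
          2 ^ m * ∫ t, Real.log (f t).toReal ∂obsLaw Q G ν s := congrArg₂ _ e1 e2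
      _ = _ := by ring

variable {g : 𝒳 → 𝒴 → ℝ≥0∞} {lam : Measure 𝒳} [IsProbabilityMeasure lam] {σm σp b : ℝ}

/-- One step of the chain contracts the excess of a function over its mean. -/
theorem lintegral_le_of_le (hm : IsMixing Q g lam σm σp b) (hν : Kernel.Invariant Q ν)
    {φ : 𝒳 → ℝ≥0∞} (hφ : Measurable φ) {c : ℝ} (hc : 1 ≤ c) (h : ∀ x, φ x ≤ ENNReal.ofReal c)
    (h1 : ∫⁻ x, φ x ∂ν ≤ 1) (x : 𝒳) :
    ∫⁻ z, φ z ∂Q x ≤ ENNReal.ofReal (1 + (c - 1) * (1 - σm / σp)) := by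
  have hp : 0 < σp := hm.pos.trans_le hm.le
  have hκ : 0 < σm / σp := div_pos hm.pos hp
  have hle : ENNReal.ofReal (σm / σp) • ν ≤ Q x := by
    refine le_trans ?_ (hm.lower x)
    refine Measure.le_iff.2 fun S hS => ?_
    have := ge_of_invariant hm hν S
    simp only [Measure.smul_apply, smul_eq_mul] at this ⊢
    calc _ ≤ ENNReal.ofReal (σm / σp) * (ENNReal.ofReal σp * lam S) := mul_le_mul' le_rfl this
      _ = _ := by
        rw [← mul_assoc, ← ENNReal.ofReal_mul hκ.le, div_mul_cancel₀ _ hp.ne']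
  have fin : ∀ (m : Measure 𝒳) [IsProbabilityMeasure m], ∫⁻ z, φ z ∂m ≤ ENNReal.ofReal c :=
    fun m _ => by
      calc _ ≤ ∫⁻ _, ENNReal.ofReal c ∂m := lintegral_mono h
        _ = _ := by simp
  have sub : ∀ (m : Measure 𝒳) [IsProbabilityMeasure m],
      ∫⁻ z, (ENNReal.ofReal c - φ z) ∂m = ENNReal.ofReal c - ∫⁻ z, φ z ∂m := fun m _ => by
    rw [lintegral_sub hφ ((fin m).trans_lt ENNReal.ofReal_lt_top).ne (ae_of_all _ h)]
    simp
  have key : ENNReal.ofReal (σm / σp) * ENNReal.ofReal (c - 1) ≤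
      ENNReal.ofReal c - ∫⁻ z, φ z ∂Q x := by
    calc _ ≤ ENNReal.ofReal (σm / σp) * (ENNReal.ofReal c - ∫⁻ z, φ z ∂ν) := by
          refine mul_le_mul' le_rfl ?_
          rw [ENNReal.ofReal_sub _ zero_le_one, ENNReal.ofReal_one]
          exact tsub_le_tsub_left h1 _
      _ = ∫⁻ z, (ENNReal.ofReal c - φ z) ∂(ENNReal.ofReal (σm / σp) • ν) := by
          rw [lintegral_smul_measure, sub ν]; rfl
      _ ≤ ∫⁻ z, (ENNReal.ofReal c - φ z) ∂Q x := lintegral_mono' hle le_rfl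
      _ = _ := sub (Q x)
  have htop := ((fin (Q x)).trans_lt ENNReal.ofReal_lt_top).ne
  rw [← ENNReal.ofReal_mul hκ.le] at key
  have key2 := ENNReal.toReal_mono (ENNReal.sub_ne_top ENNReal.ofReal_ne_top) key
  rw [ENNReal.toReal_sub_of_le (fin (Q x)) ENNReal.ofReal_ne_top, ENNReal.toReal_ofReal
    (mul_nonneg hκ.le (by linarith)), ENNReal.toReal_ofReal (by linarith)] at key2
  rw [← ENNReal.ofReal_toReal htop]
  refine ENNReal.ofReal_le_ofReal ?_
  linarith

theorem lintegral_leftmost_le (hm : IsMixing Q g lam σm σp b) (hν : Kernel.Invariant Q ν)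
    {f : Obs 𝒴 s → ℝ≥0∞} (hf : Measurable f) (h1 : ∫⁻ t, f t ∂obsLaw Q G ν s = 1) (j : ℕ)
    (x : 𝒳) : ∫⁻ t, leftmost f (j + 1) t ∂obsKernel Q G (s.graft (j + 1)) x ≤
      ENNReal.ofReal (1 + (σp / σm - 1) * (1 - σm / σp) ^ j) := by
  have hp : 0 < σp := hm.pos.trans_le hm.le
  have hone : 0 ≤ σp / σm - 1 := sub_nonneg.2 ((one_le_div hm.pos).2 hm.le)
  have mk : ∀ j, Measurable fun z => ∫⁻ t, leftmost f j t ∂obsKernel Q G (s.graft j) z := fun j =>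
    (measurable_leftmost hf j).lintegral_kernel
  have mean : ∀ j, ∫⁻ z, ∫⁻ t, leftmost f j t ∂obsKernel Q G (s.graft j) z ∂ν = 1 := fun j => by
    rw [← h1, ← lintegral_leftmost hν hf j, obsLaw, Measure.lintegral_bind (Kernel.aemeasurable _)
      (measurable_leftmost hf j).aemeasurable]
  induction j generalizing x with
  | zero =>
    rw [lintegral_leftmost_succ hf]
    have e := mean 0
    set ψ := fun z => ∫⁻ t, leftmost f 0 t ∂obsKernel Q G (s.graft 0) z
    have a1 : ENNReal.ofReal σm * ∫⁻ z, ψ z ∂lam ≤ 1 := by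
      calc _ = ∫⁻ z, ψ z ∂(ENNReal.ofReal σm • lam) := by rw [lintegral_smul_measure]; rfl
        _ ≤ ∫⁻ z, ψ z ∂ν := lintegral_mono' (le_of_invariant hm hν) le_rfl
        _ = 1 := e
    calc ∫⁻ z, ψ z ∂Q x ≤ ∫⁻ z, ψ z ∂(ENNReal.ofReal σp • lam) :=
          lintegral_mono' (hm.upper x) le_rfl
      _ = ENNReal.ofReal (σp / σm) * (ENNReal.ofReal σm * ∫⁻ z, ψ z ∂lam) := by
          rw [lintegral_smul_measure, ← mul_assoc, ← ENNReal.ofReal_mul (div_pos hp hm.pos).le,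
            div_mul_cancel₀ _ hm.pos.ne']; rfl
      _ ≤ ENNReal.ofReal (σp / σm) * 1 := mul_le_mul' le_rfl a1
      _ = _ := by rw [mul_one, pow_zero, mul_one]; congr 1; ring
  | succ j ih =>
    rw [lintegral_leftmost_succ hf]
    refine (lintegral_le_of_le hm hν (mk (j + 1)) ?_ ih (mean _).le x).trans_eq ?_
    · linarith [mul_nonneg hone (pow_nonneg hm.rate_nonneg j)]
    · congr 1; ring

end Blocks

/-! ### Relative entropy of two models -/

/-- A sequence whose increments are asymptotically proportional to `2 ^ k` is asymptotically
proportional to `2 ^ k`. -/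
theorem tendsto_div_two_pow {a : ℕ → ℝ} {l : ℝ}
    (h : Tendsto (fun k : ℕ => ((2 : ℝ) ^ k)⁻¹ * (a (k + 1) - a k)) atTop (𝓝 l)) :
    Tendsto (fun k : ℕ => ((2 : ℝ) ^ k)⁻¹ * a k) atTop (𝓝 l) := by
  have h1 : (fun k : ℕ => a (k + 1) - a k - l * 2 ^ k) =o[atTop] fun k : ℕ => (2 : ℝ) ^ k := by
    rw [Asymptotics.isLittleO_iff_tendsto fun k hk => absurd hk (by positivity)]
    have := h.sub_const l
    rw [sub_self] at this
    refine this.congr fun k => ?_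
    field_simp
  have gs : ∀ n : ℕ, ∑ k ∈ Finset.range n, (2 : ℝ) ^ k = 2 ^ n - 1 := fun n => by
    rw [geom_sum_eq (by norm_num)]; norm_num
  have ht : Tendsto (fun n : ℕ => (2 : ℝ) ^ n - 1) atTop atTop :=
    tendsto_atTop_add_const_right _ _ (tendsto_pow_atTop_atTop_of_one_lt (by norm_num))
  have h2 := h1.sum_range (fun k => by positivity) (by simpa only [gs] using ht)
  have hs : ∀ n : ℕ, ∑ k ∈ Finset.range n, (a (k + 1) - a k - l * 2 ^ k) =
      a n - a 0 - l * (2 ^ n - 1) := fun n => by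
    rw [Finset.sum_sub_distrib, Finset.sum_range_sub, ← Finset.mul_sum, gs]
  simp only [gs, hs] at h2
  have h3 : (fun n : ℕ => (2 : ℝ) ^ n - 1) =O[atTop] fun n : ℕ => (2 : ℝ) ^ n := by
    refine Asymptotics.IsBigO.of_bound 1 (Eventually.of_forall fun n => ?_)
    have : (1 : ℝ) ≤ 2 ^ n := one_le_pow₀ (by norm_num)
    rw [Real.norm_of_nonneg (by linarith), Real.norm_of_nonneg (by positivity)]
    linarith
  have h4 := (h2.trans_isBigO h3)
  rw [Asymptotics.isLittleO_iff_tendsto fun k hk => absurd hk (by positivity)] at h4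
  have h5 : Tendsto (fun n : ℕ => (a 0 - l) * ((2 : ℝ) ^ n)⁻¹) atTop (𝓝 0) := by
    have : Tendsto (fun n : ℕ => ((2 : ℝ) ^ n)⁻¹) atTop (𝓝 0) :=
      tendsto_inv_atTop_zero.comp (tendsto_pow_atTop_atTop_of_one_lt (by norm_num))
    simpa using this.const_mul (a 0 - l)
  have h6 := (h4.add h5).add_const l
  rw [zero_add, zero_add] at h6
  refine h6.congr fun n => ?_
  field_simp
  ring

section RelEntropy

variable {𝒳 : Type*} {𝒴 : Type u} [MeasurableSpace 𝒳] [MeasurableSpace 𝒴]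
  {lam : Measure 𝒳} [IsProbabilityMeasure lam] {μ : Measure 𝒴} [SigmaFinite μ]
  {Q : Kernel 𝒳 𝒳} [IsMarkovKernel Q] {G : Kernel 𝒳 𝒴} [IsMarkovKernel G] {ν : Measure 𝒳}
  [IsProbabilityMeasure ν] {g : 𝒳 → 𝒴 → ℝ≥0∞}
  {Q' : Kernel 𝒳 𝒳} [IsMarkovKernel Q'] {G' : Kernel 𝒳 𝒴} [IsMarkovKernel G'] {ν' : Measure 𝒳}
  [IsProbabilityMeasure ν'] {g' : 𝒳 → 𝒴 → ℝ≥0∞} {σm σp b : ℝ}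

/-- A stationary hidden Markov model with a mixing transition kernel. -/
structure IsMixingModel (Q : Kernel 𝒳 𝒳) (G : Kernel 𝒳 𝒴) (ν : Measure 𝒳) (g : 𝒳 → 𝒴 → ℝ≥0∞)
    (lam : Measure 𝒳) (μ : Measure 𝒴) (σm σp b : ℝ) : Prop where
  isMixing : IsMixing Q g lam σm σp b
  invariant : Kernel.Invariant Q ν
  density : ∀ x, G x = μ.withDensity (g x)

theorem IsMixingModel.obsLaw_eq (h : IsMixingModel Q G ν g lam μ σm σp b) (s : Shape) :
    obsLaw Q G ν s = (refMeasure μ s).withDensity (meanLik Q g ν s) :=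
  obsLaw_eq_withDensity Q G h.isMixing.measurable_g μ h.density ν s

/-- The relative entropy, on a shape, of the law of the model `(Q', g', ν')` with respect to the
law of the model `(Q, g, ν)`. -/
noncomputable def relEntropy (Q : Kernel 𝒳 𝒳) (g : 𝒳 → 𝒴 → ℝ≥0∞) (ν : Measure 𝒳)
    (Q' : Kernel 𝒳 𝒳) (G' : Kernel 𝒳 𝒴) (g' : 𝒳 → 𝒴 → ℝ≥0∞) (ν' : Measure 𝒳) (s : Shape) : ℝ :=
  expLogLik Q' g' ν' Q' G' ν' s - expLogLik Q g ν Q' G' ν' s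

theorem integral_log_sub_relEntropy_le (h : IsMixingModel Q G ν g lam μ σm σp b)
    (h' : IsMixingModel Q' G' ν' g' lam μ σm σp b) (hi : Integrable (absLog lam g) (G' ∘ₘ ν'))
    (hi' : Integrable (absLog lam g') (G' ∘ₘ ν')) {s : Shape} {F : Obs 𝒴 s → ℝ≥0∞}
    (hF : Measurable F) (hF0 : ∀ t, 0 < F t ∧ F t < ∞)
    (iF : Integrable (fun t => Real.log (F t).toReal) (obsLaw Q' G' ν' s)) {C : ℝ} (hC : 0 < C)
    (hFC : ∫⁻ t, F t ∂obsLaw Q G ν s ≤ ENNReal.ofReal C) :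
    ∫ t, Real.log (F t).toReal ∂obsLaw Q' G' ν' s - relEntropy Q g ν Q' G' g' ν' s ≤
      Real.log C := by
  have e := h.obsLaw_eq s
  have e' := h'.obsLaw_eq s
  have ip := integrable_logMeanLik (G' := G') h.isMixing h.invariant h'.invariant hi s
  have ip' := integrable_logMeanLik (G' := G') h'.isMixing h'.invariant h'.invariant hi' s
  have prob : IsProbabilityMeasure (obsLaw Q' G' ν' s) := inferInstance
  unfold relEntropy expLogLik
  rw [e'] at ip ip' iF prob ⊢
  rw [e] at hFC
  exact integral_log_le (measurable_meanLik Q h.isMixing.measurable_g ν s)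
    (measurable_meanLik Q' h'.isMixing.measurable_g ν' s) hF
    (fun t => meanLik_pos h.isMixing h.invariant s t) (fun t => meanLik_lt_top h.isMixing s t)
    (fun t => meanLik_pos h'.isMixing h'.invariant s t) (fun t => meanLik_lt_top h'.isMixing s t)
    (fun t => (hF0 t).1) (fun t => (hF0 t).2) ip ip' iF hC hFC

theorem relEntropy_nonneg (h : IsMixingModel Q G ν g lam μ σm σp b)
    (h' : IsMixingModel Q' G' ν' g' lam μ σm σp b) (hi : Integrable (absLog lam g) (G' ∘ₘ ν'))
    (hi' : Integrable (absLog lam g') (G' ∘ₘ ν')) (s : Shape) :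
    0 ≤ relEntropy Q g ν Q' G' g' ν' s := by
  have := integral_log_sub_relEntropy_le h h' hi hi' (s := s) (F := fun _ => 1) measurable_const
    (fun _ => ⟨one_pos, ENNReal.one_lt_top⟩) (by simp) one_pos (by simp)
  simpa using this

theorem obsLaw_eq_of_relEntropy_nonpos (h : IsMixingModel Q G ν g lam μ σm σp b)
    (h' : IsMixingModel Q' G' ν' g' lam μ σm σp b) (hi : Integrable (absLog lam g) (G' ∘ₘ ν'))
    (hi' : Integrable (absLog lam g') (G' ∘ₘ ν')) (s : Shape)
    (hs : relEntropy Q g ν Q' G' g' ν' s ≤ 0) : obsLaw Q G ν s = obsLaw Q' G' ν' s := by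
  have e := h.obsLaw_eq s
  have e' := h'.obsLaw_eq s
  have ip := integrable_logMeanLik (G' := G') h.isMixing h.invariant h'.invariant hi s
  have ip' := integrable_logMeanLik (G' := G') h'.isMixing h'.invariant h'.invariant hi' s
  have prob : IsProbabilityMeasure (obsLaw Q G ν s) := inferInstance
  have prob' : IsProbabilityMeasure (obsLaw Q' G' ν' s) := inferInstance
  unfold relEntropy expLogLik at hs
  rw [e'] at ip ip' prob' hs ⊢
  rw [e] at prob ⊢
  exact withDensity_congr_ae (ae_eq_of_entropy_nonpos
    (measurable_meanLik Q h.isMixing.measurable_g ν s)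
    (measurable_meanLik Q' h'.isMixing.measurable_g ν' s)
    (fun t => meanLik_pos h.isMixing h.invariant s t) (fun t => meanLik_lt_top h.isMixing s t)
    (fun t => meanLik_pos h'.isMixing h'.invariant s t) (fun t => meanLik_lt_top h'.isMixing s t)
    ip ip' hs)

theorem relEntropy_eq_zero (h : IsMixingModel Q G ν g lam μ σm σp b)
    (h' : IsMixingModel Q' G' ν' g' lam μ σm σp b) {s : Shape}
    (hs : obsLaw Q G ν s = obsLaw Q' G' ν' s) : relEntropy Q g ν Q' G' g' ν' s = 0 := by
  have e := h.obsLaw_eq s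
  have e' := h'.obsLaw_eq s
  have hae : meanLik Q g ν s =ᵐ[refMeasure μ s] meanLik Q' g' ν' s := by
    rw [e, e'] at hs
    exact (withDensity_eq_iff_of_sigmaFinite
      (measurable_meanLik Q h.isMixing.measurable_g ν s).aemeasurable
      (measurable_meanLik Q' h'.isMixing.measurable_g ν' s).aemeasurable).1 hs
  unfold relEntropy expLogLik
  rw [sub_eq_zero, e']
  refine integral_congr_ae ?_
  filter_upwards [(withDensity_absolutelyContinuous (refMeasure μ s) _).ae_le hae] with t ht
  unfold logMeanLik
  rw [ht]

/-- Comparison of the relative entropy of a block with that of a large tree, which contains many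
well-separated copies of the block. -/
theorem two_pow_mul_relEntropy_le (h : IsMixingModel Q G ν g lam μ σm σp b)
    (h' : IsMixingModel Q' G' ν' g' lam μ σm σp b) (hi : Integrable (absLog lam g) (G' ∘ₘ ν'))
    (hi' : Integrable (absLog lam g') (G' ∘ₘ ν')) (s : Shape) (j m : ℕ) :
    2 ^ m * relEntropy Q g ν Q' G' g' ν' s -
        relEntropy Q g ν Q' G' g' ν' ((s.graft (j + 1)).graft m) ≤
      2 ^ m * Real.log (1 + (σp / σm - 1) * (1 - σm / σp) ^ j) := by
  have hm := h.isMixing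
  have hm' := h'.isMixing
  set c := 1 + (σp / σm - 1) * (1 - σm / σp) ^ j with hc
  have c1 : 1 ≤ c := by
    have : 0 ≤ σp / σm - 1 := sub_nonneg.2 ((one_le_div hm.pos).2 hm.le)
    linarith [mul_nonneg this (pow_nonneg hm.rate_nonneg j)]
  let p := meanLik Q g ν s
  let p' := meanLik Q' g' ν' s
  have mp : Measurable p := measurable_meanLik Q hm.measurable_g ν s
  have mp' : Measurable p' := measurable_meanLik Q' hm'.measurable_g ν' s
  have pp : ∀ t, 0 < p t := fun t => meanLik_pos hm h.invariant s t
  have pt : ∀ t, p t < ∞ := fun t => meanLik_lt_top hm s t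
  have pp' : ∀ t, 0 < p' t := fun t => meanLik_pos hm' h'.invariant s t
  have pt' : ∀ t, p' t < ∞ := fun t => meanLik_lt_top hm' s t
  let f : Obs 𝒴 s → ℝ≥0∞ := fun t => p' t / p t
  have mf : Measurable f := mp'.div mp
  have hf : ∀ t, 0 < f t ∧ f t < ∞ := fun t =>
    ⟨ENNReal.div_pos (pp' t).ne' (pt t).ne, ENNReal.div_lt_top (pt' t).ne (pp t).ne'⟩
  have ip := integrable_logMeanLik (G' := G') hm h.invariant h'.invariant hi s
  have ip' := integrable_logMeanLik (G' := G') hm' h'.invariant h'.invariant hi' s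
  have elog : ∀ t, Real.log (f t).toReal = logMeanLik Q' g' ν' s t - logMeanLik Q g ν s t :=
    fun t => by
      simp only [f]
      rw [ENNReal.toReal_div, Real.log_div (ENNReal.toReal_pos (pp' t).ne' (pt' t).ne).ne'
        (ENNReal.toReal_pos (pp t).ne' (pt t).ne).ne']
      rfl
  have ilog : Integrable (fun t => Real.log (f t).toReal) (obsLaw Q' G' ν' s) := by
    simp_rw [elog]; exact ip'.sub ip
  have e1 : ∫ t, Real.log (f t).toReal ∂obsLaw Q' G' ν' s = relEntropy Q g ν Q' G' g' ν' s := by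
    simp_rw [elog]; exact integral_sub ip' ip
  have f1 : ∫⁻ t, f t ∂obsLaw Q G ν s = 1 := by
    have prob' : IsProbabilityMeasure (obsLaw Q' G' ν' s) := inferInstance
    have := lintegral_ratio (ref := refMeasure μ s) mp' mp
      (measurable_const (a := (1 : ℝ≥0∞))) pp pt
    rw [← h.obsLaw_eq s, ← h'.obsLaw_eq s] at this
    simpa [f] using this
  have ml := measurable_leftmost mf (j + 1)
  have hl := leftmost_pos hf (j + 1)
  obtain ⟨il, el⟩ := integral_log_leftmost h'.invariant mf ilog (j + 1)
  obtain ⟨ib, eb⟩ := integral_log_blockProd h'.invariant ml hl il m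
  have hb : ∫⁻ t, blockProd (leftmost f (j + 1)) m t ∂obsLaw Q G ν ((s.graft (j + 1)).graft m) ≤
      ENNReal.ofReal (c ^ 2 ^ m) := by
    rw [obsLaw, Measure.lintegral_bind (Kernel.aemeasurable _)
      (measurable_blockProd ml m).aemeasurable]
    calc _ ≤ ∫⁻ _, ENNReal.ofReal c ^ 2 ^ m ∂ν := lintegral_mono
          (lintegral_blockProd_le ml (lintegral_leftmost_le hm h.invariant mf f1 j) m)
      _ = _ := by simp [ENNReal.ofReal_pow (zero_le_one.trans c1)]
  have := integral_log_sub_relEntropy_le h h' hi hi' (measurable_blockProd ml m)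
    (blockProd_pos hl m) ib (pow_pos (zero_lt_one.trans_le c1) _) hb
  rw [eb, el, e1, Real.log_pow] at this
  exact_mod_cast this

theorem relEntropy_nonpos_of_tendsto (h : IsMixingModel Q G ν g lam μ σm σp b)
    (h' : IsMixingModel Q' G' ν' g' lam μ σm σp b) (hi : Integrable (absLog lam g) (G' ∘ₘ ν'))
    (hi' : Integrable (absLog lam g') (G' ∘ₘ ν'))
    (hlim : Tendsto (fun k : ℕ => ((2 : ℝ) ^ k)⁻¹ * relEntropy Q g ν Q' G' g' ν' (.full k)) atTop
      (𝓝 0)) (n : ℕ) : relEntropy Q g ν Q' G' g' ν' (.full n) ≤ 0 := by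
  have key : ∀ j : ℕ, relEntropy Q g ν Q' G' g' ν' (.full n) ≤
      Real.log (1 + (σp / σm - 1) * (1 - σm / σp) ^ j) := fun j => by
    have h1 := (hlim.comp (tendsto_add_atTop_nat (n + (j + 1)))).const_mul
      ((2 : ℝ) ^ (n + (j + 1)))
    rw [mul_zero] at h1
    have h2 : Tendsto (fun m : ℕ => relEntropy Q g ν Q' G' g' ν' (.full n) - (2 : ℝ) ^ (n + (j + 1)) *
        (((2 : ℝ) ^ (m + (n + (j + 1))))⁻¹ *
          relEntropy Q g ν Q' G' g' ν' (.full (m + (n + (j + 1)))))) atTop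
        (𝓝 (relEntropy Q g ν Q' G' g' ν' (.full n) - 0)) := tendsto_const_nhds.sub h1
    rw [sub_zero] at h2
    refine le_of_tendsto h2 (Eventually.of_forall fun m => ?_)
    have h3 := two_pow_mul_relEntropy_le h h' hi hi' (.full n) j m
    rw [Shape.graft_full, Shape.graft_full, add_comm _ m] at h3
    refine le_of_mul_le_mul_left ?_ (pow_pos (two_pos : (0 : ℝ) < 2) m)
    refine le_trans (le_of_eq ?_) h3
    rw [pow_add _ m]
    field_simp
  have hl : Tendsto (fun j : ℕ => Real.log (1 + (σp / σm - 1) * (1 - σm / σp) ^ j)) atTop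
      (𝓝 0) := by
    have := (h.isMixing.tendsto_rate (σp / σm - 1)).const_add 1
    rw [add_zero] at this
    simpa using this.log one_ne_zero
  exact ge_of_tendsto hl (Eventually.of_forall key)

end RelEntropy

/-! ### The law of the observed process -/

section ObservedLaw

variable {𝒴 : Type u} {Ω : Type*} [MeasurableSpace 𝒴] [MeasurableSpace Ω]

/-- The label of the vertex `u` (or `d` if `u` is not a vertex of the shape `s` rooted at `v`). -/
def getLabel (d : 𝒴) : ∀ s, Vertex → Vertex → Obs 𝒴 s → 𝒴
  | .nil, _, _, _ => d
  | .node l r, v, u, t =>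
    if u = v then t.1 else
      if u ∈ verts l (child v false) then getLabel d l (child v false) u t.2.1
      else getLabel d r (child v true) u t.2.2

theorem measurable_getLabel (d : 𝒴) (s : Shape) (v u : Vertex) :
    Measurable (getLabel d s v u) := by
  induction s generalizing v with
  | nil => exact measurable_const
  | node l r hl hr =>
    by_cases h1 : u = v
    · have : getLabel d (.node l r) v u = fun t => t.1 := funext fun t => if_pos h1
      rw [this]
      exact measurable_fst
    by_cases h2 : u ∈ verts l (child v false)
    · have : getLabel d (.node l r) v u = fun t => getLabel d l (child v false) u t.2.1 :=
        funext fun t => by rw [getLabel, if_neg h1, if_pos h2]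
      rw [this]
      exact (hl _).comp measurable_snd.fst
    · have : getLabel d (.node l r) v u = fun t => getLabel d r (child v true) u t.2.2 :=
        funext fun t => by rw [getLabel, if_neg h1, if_neg h2]
      rw [this]
      exact (hr _).comp measurable_snd.snd

theorem getLabel_obs (d : 𝒴) {s : Shape} {v u : Vertex} (y : Vertex → 𝒴) (h : u ∈ verts s v) :
    getLabel d s v u (obs y s v) = y u := by
  induction s generalizing v with
  | nil => simp [verts] at h
  | node l r hl hr =>
    simp only [verts, Finset.mem_insert, Finset.mem_union] at h
    simp only [getLabel, obs]
    split_ifs with h1 h2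
    · rw [h1]
    · exact hl h2
    · exact hr ((h.resolve_left h1).resolve_left h2)

/-- The extension by `d` of labels of the vertices of `T`. -/
def extendLabels (d : 𝒴) (z : List Bool → 𝒴) : Vertex → 𝒴
  | .node 0 w => z w
  | _ => d

theorem obs_extendLabels (d : 𝒴) (y : Vertex → 𝒴) (s : Shape) (w : List Bool) :
    obs (extendLabels d fun w => y (.node 0 w)) s (.node 0 w) = obs y s (.node 0 w) := by
  induction s generalizing w with
  | nil => rfl
  | node l r hl hr => exact congrArg₂ _ rfl (congrArg₂ _ (hl _) (hr _))

theorem measurable_extendLabels (d : 𝒴) (v : Vertex) :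
    Measurable fun z : List Bool → 𝒴 => extendLabels d z v := by
  rcases v with ⟨_ | j, w⟩ | j
  · exact measurable_pi_apply w
  · exact measurable_const
  · exact measurable_const

/-- The law of the observations on `T` is determined by its restrictions to the complete finite
trees. -/
theorem sameObservedLaw_iff {P P' : Measure Ω} [IsProbabilityMeasure P] [IsProbabilityMeasure P']
    {Y : Vertex → Ω → 𝒴} (hY : ∀ v, Measurable (Y v)) :
    SameObservedLaw Y P P' ↔ ∀ n : ℕ,
      P.map (fun ω => obs (fun u => Y u ω) (.full n) root) =
        P'.map fun ω => obs (fun u => Y u ω) (.full n) root := by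
  have hne : P Set.univ ≠ 0 := by simp
  obtain ⟨ω₀, -⟩ := nonempty_of_measure_ne_zero hne
  let d := Y root ω₀
  have hZ : Measurable fun ω (w : List Bool) => Y (.node 0 w) ω :=
    measurable_pi_iff.2 fun w => hY _
  constructor
  · intro h n
    have hE : Measurable fun z : List Bool → 𝒴 =>
        obs (fun u => extendLabels d z u) (.full n) root :=
      measurable_obs (measurable_extendLabels d) (.full n) root
    have e : ∀ R : Measure Ω, R.map (fun ω => obs (fun u => Y u ω) (.full n) root) =
        (R.map fun ω (w : List Bool) => Y (.node 0 w) ω).map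
          fun z => obs (fun u => extendLabels d z u) (.full n) root := fun R => by
      rw [Measure.map_map hE hZ]
      congr 1
      funext ω
      exact (obs_extendLabels d (fun u => Y u ω) _ []).symm
    rw [e, e, h]
  · intro h
    have key : ∀ I : Finset (List Bool),
        (P.map fun ω (w : List Bool) => Y (.node 0 w) ω).map I.restrict =
          (P'.map fun ω (w : List Bool) => Y (.node 0 w) ω).map I.restrict := fun I => by
      let n := I.sup List.length + 1
      have hG : Measurable fun (t : Obs 𝒴 (.full n)) (w : I) =>
          getLabel d (.full n) root (.node 0 w) t :=
        measurable_pi_iff.2 fun w => measurable_getLabel d _ _ _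
      have e : ∀ R : Measure Ω, (R.map fun ω (w : List Bool) => Y (.node 0 w) ω).map I.restrict =
          (R.map fun ω => obs (fun u => Y u ω) (.full n) root).map
            fun t (w : I) => getLabel d (.full n) root (.node 0 w) t := fun R => by
        rw [Measure.map_map (Finset.measurable_restrict I) hZ,
          Measure.map_map hG (measurable_obs hY _ _)]
        congr 1
        funext ω w
        refine (getLabel_obs d (fun u => Y u ω) (mem_verts_full.2 ⟨w, ?_, ?_⟩)).symm
        · exact Nat.lt_succ_of_le (Finset.le_sup (f := List.length) w.2)
        · simp
      rw [e, e, h]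
    have p1 := Measure.isProbabilityMeasure_map (μ := P) hZ.aemeasurable
    exact IsProjectiveLimit.unique
      (P := fun I => (P.map fun ω (w : List Bool) => Y (.node 0 w) ω).map I.restrict)
      (fun _ => rfl) fun I => (key I).symm

end ObservedLaw

/-! ### Translation of the assumptions -/

section Assumptions

variable {Θ 𝒳 : Type*} {𝒴 : Type u} {Ω : Type*} [MeasurableSpace 𝒳] [MeasurableSpace 𝒴]
  [MeasurableSpace Ω]
  {Q : Θ → Kernel 𝒳 𝒳} {G : Θ → Kernel 𝒳 𝒴} {lam : Measure 𝒳} {μ : Measure 𝒴}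
  {q : Θ → 𝒳 → 𝒳 → ℝ} {g : Θ → 𝒳 → 𝒴 → ℝ}

theorem FullyDominated.isMixing (hdom : FullyDominated Q G lam μ q g)
    (hpos : ∀ θ x y, 0 < g θ x y) {σm σp b : ℝ} (hσ : 0 < σm)
    (hq : ∀ θ x x', σm ≤ q θ x x' ∧ q θ x x' ≤ σp) (hb : ∀ θ x y, g θ x y ≤ b) (θ : Θ) :
    IsMixing (Q θ) (fun x y => ENNReal.ofReal (g θ x y)) lam σm σp b where
  measurable_g := (hdom.measurable_g θ).ennreal_ofReal
  pos_g x y := ENNReal.ofReal_pos.2 (hpos θ x y)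
  g_le x y := ENNReal.ofReal_le_ofReal (hb θ x y)
  pos := hσ
  lower x := by
    rw [hdom.density_q, ← withDensity_const]
    exact withDensity_mono (ae_of_all _ fun x' => ENNReal.ofReal_le_ofReal (hq θ x x').1)
  upper x := by
    rw [hdom.density_q, ← withDensity_const]
    exact withDensity_mono (ae_of_all _ fun x' => ENNReal.ofReal_le_ofReal (hq θ x x').2)

variable [∀ θ, IsMarkovKernel (Q θ)] [IsProbabilityMeasure lam]

theorem toReal_refLik (hdom : FullyDominated Q G lam μ q g) (θ : Θ) (y : 𝒴) :
    (refLik lam (fun x y => ENNReal.ofReal (g θ x y)) y).toReal = ∫ x, g θ x y ∂lam := by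
  have hm : Measurable fun x => g θ x y :=
    (hdom.measurable_g θ).comp (measurable_id.prodMk measurable_const)
  rw [integral_eq_lintegral_of_nonneg_ae (ae_of_all _ fun x => hdom.nonneg_g θ x y)
    hm.aestronglyMeasurable]
  rfl

theorem measurable_absLog {g : 𝒳 → 𝒴 → ℝ≥0∞} (hg : Measurable fun p : 𝒳 × 𝒴 => g p.1 p.2) :
    Measurable (absLog lam g) := by
  have : Measurable (refLik lam g) := hg.lintegral_prod_left'
  exact _root_.measurable_abs.comp this.ennreal_toReal.log

theorem integrable_absLog (hdom : FullyDominated Q G lam μ q g) (hreg : Regular lam q g)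
    {P : Measure Ω} [IsProbabilityMeasure P] {Y₀ : Ω → 𝒴} (hY : Measurable Y₀)
    (hL1 : L1Regular lam g Y₀ P) (θ : Θ) :
    Integrable (fun ω => absLog lam (fun x y => ENNReal.ofReal (g θ x y)) (Y₀ ω)) P := by
  obtain ⟨σm, σp, hσ, hq⟩ := hreg.bounded_q
  obtain ⟨b, hb⟩ := hL1.bounded_g
  have hm := hdom.isMixing hreg.pos_g hσ hq hb θ
  refine (hL1.integrable_log.abs.add (integrable_const |Real.log b|)).mono'
    ((measurable_absLog hm.measurable_g).comp hY).aestronglyMeasurable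
    (ae_of_all _ fun ω => ?_)
  set y := Y₀ ω
  have hI := ENNReal.toReal_pos (refLik_pos hm y).ne' (refLik_lt_top hm y).ne
  obtain ⟨c, C, hc, hcC⟩ := hreg.integral_g y
  have : Nonempty Θ := ⟨θ⟩
  have h1 : bMinus lam g y ≤ (refLik lam (fun x y => ENNReal.ofReal (g θ x y)) y).toReal := by
    rw [toReal_refLik hdom]
    exact ciInf_le ⟨c, by rintro _ ⟨θ', rfl⟩; exact (hcC θ').1⟩ θ
  have h2 : 0 < bMinus lam g y := hc.trans_le (le_ciInf fun θ' => (hcC θ').1)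
  have h3 : (refLik lam (fun x y => ENNReal.ofReal (g θ x y)) y).toReal ≤ b := by
    have hle : refLik lam (fun x y => ENNReal.ofReal (g θ x y)) y ≤ ENNReal.ofReal b := by
      calc _ ≤ ∫⁻ _, ENNReal.ofReal b ∂lam := lintegral_mono fun x => hm.g_le x y
        _ = _ := by simp
    by_contra! hlt
    have h4 := ENNReal.toReal_mono ENNReal.ofReal_ne_top hle
    rcases le_total 0 b with h0 | h0
    · rw [ENNReal.toReal_ofReal h0] at h4
      linarith
    · rw [ENNReal.ofReal_of_nonpos h0, ENNReal.toReal_zero] at h4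
      linarith
  have l1 := Real.log_le_log h2 h1
  have l2 := Real.log_le_log hI h3
  have a1 := neg_abs_le (Real.log (bMinus lam g y))
  have a2 := le_abs_self (Real.log b)
  have a3 := abs_nonneg (Real.log (bMinus lam g y))
  have a4 := abs_nonneg (Real.log b)
  simp only [absLog, Real.norm_eq_abs, abs_abs, Pi.add_apply]
  rw [abs_le]
  constructor <;> linarith

theorem rootIncrement_eq (hdom : FullyDominated Q G lam μ q g) (Y : Vertex → Ω → 𝒴) (θ : Θ)
    (k : ℕ) (x : 𝒳) (s : (ℕ → Bool) × Ω) :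
    rootIncrement lam (q θ) (g θ) Y k x s =
      increment (Q θ) (fun x y => ENNReal.ofReal (g θ x y)) s.1 (fun v => Y v s.2) k x := by
  have key := condDensity_verts (Q := Q θ) (hdom.nonneg_q θ) (hdom.nonneg_g θ)
    (hdom.measurable_q θ) (hdom.measurable_g θ) (hdom.density_q θ)
  rw [rootIncrement, smallH, bigH, past_root, pastStar_root, key, key]
  rfl

theorem isLimitIncrement (hdom : FullyDominated Q G lam μ q g) (hpos : ∀ θ x y, 0 < g θ x y)
    {σm σp b : ℝ} (hσ : 0 < σm) (hq : ∀ θ x x', σm ≤ q θ x x' ∧ q θ x x' ≤ σp)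
    (hb : ∀ θ x y, g θ x y ≤ b) {ν : Measure 𝒳} [IsProbabilityMeasure ν] (Y : Vertex → Ω → 𝒴)
    (θ : Θ) (hν : Kernel.Invariant (Q θ) ν) (x : 𝒳) :
    IsLimitIncrement (Q θ) (fun x y => ENNReal.ofReal (g θ x y)) ν Y ((σp - σm) / σm)
      (1 - σm / σp) (limitIncrement lam (q θ) (g θ) Y x) := by
  have hm := hdom.isMixing hpos hσ hq hb θ
  have key : ∀ s : (ℕ → Bool) × Ω, ∃ h : ℝ, limitIncrement lam (q θ) (g θ) Y x s = h ∧ ∀ k : ℕ,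
      (∀ x, |increment (Q θ) (fun x y => ENNReal.ofReal (g θ x y)) s.1 (fun v => Y v s.2)
        (k + 1) x - h| ≤ (σp - σm) / σm * (1 - σm / σp) ^ k) ∧
      |meanIncrement (Q θ) (fun x y => ENNReal.ofReal (g θ x y)) ν s.1 (fun v => Y v s.2)
        (k + 1) - h| ≤ (σp - σm) / σm * (1 - σm / σp) ^ k := fun s => by
    obtain ⟨h, hh⟩ := exists_limit_increment hm hν s.1 fun v => Y v s.2
    refine ⟨h, ?_, hh⟩
    refine Tendsto.limUnder_eq ?_
    simp_rw [rootIncrement_eq hdom]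
    rw [← tendsto_add_atTop_iff_nat 1, tendsto_iff_dist_tendsto_zero]
    exact squeeze_zero (fun _ => dist_nonneg) (fun k => (hh k).1 x) (hm.tendsto_rate _)
  constructor
  · intro k s x'
    obtain ⟨h, e, hh⟩ := key s
    rw [e]
    exact (hh k).1 x'
  · intro k s
    obtain ⟨h, e, hh⟩ := key s
    rw [e]
    exact (hh k).2

end Assumptions

end HMT

open HMT in
theorem mainTheorem8
    {𝒳 𝒴 Ω : Type*}
    [MetricSpace 𝒳] [MeasurableSpace 𝒳] [BorelSpace 𝒳]
    [MetricSpace 𝒴] [MeasurableSpace 𝒴] [BorelSpace 𝒴]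
    [MeasurableSpace Ω]
    {d : ℕ} (Θ : Set (EuclideanSpace ℝ (Fin d))) (θs : Θ)
    (Q : Θ → Kernel 𝒳 𝒳) [∀ θ, IsMarkovKernel (Q θ)]
    (G : Θ → Kernel 𝒳 𝒴) [∀ θ, IsMarkovKernel (G θ)]
    (ν : Θ → Measure 𝒳) [∀ θ, IsProbabilityMeasure (ν θ)]
    (P : Θ → Measure Ω) [∀ θ, IsProbabilityMeasure (P θ)]
    (X : HMT.Vertex → Ω → 𝒳) (Y : HMT.Vertex → Ω → 𝒴)
    (hstat : ∀ θ, HMT.IsStationaryHMT (Q θ) (G θ) (ν θ) X Y (P θ))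
    (lam : Measure 𝒳) [IsProbabilityMeasure lam]
    (μ : Measure 𝒴) [SigmaFinite μ]
    (q : Θ → 𝒳 → 𝒳 → ℝ) (g : Θ → 𝒳 → 𝒴 → ℝ)
    (hdom : HMT.FullyDominated Q G lam μ q g)
    (hreg : HMT.Regular lam q g)
    (hL1 : HMT.L1Regular lam g (Y HMT.Vertex.root) (P θs))
    (hL2 : HMT.L2Regular lam g (Y HMT.Vertex.root) (P θs))
    (x : 𝒳) :
    -- the limit `h_{∂,∞}(θ)` exists, is integrable and does not depend on the base point,
    (∀ θ, Integrable (HMT.limitIncrement lam (q θ) (g θ) Y x) (HMT.spineLaw.prod (P θs)) ∧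
      ∀ x' : 𝒳,
        (∀ᵐ s ∂(HMT.spineLaw.prod (P θs)),
          Tendsto (fun k : ℕ => HMT.rootIncrement lam (q θ) (g θ) Y k x' s) atTop
            (𝓝 (HMT.limitIncrement lam (q θ) (g θ) Y x s))) ∧
        Tendsto (fun k : ℕ =>
          eLpNorm (fun s => HMT.rootIncrement lam (q θ) (g θ) Y k x' s -
            HMT.limitIncrement lam (q θ) (g θ) Y x s) 1 (HMT.spineLaw.prod (P θs))) atTop (𝓝 0)) ∧
    -- and the global maxima of the contrast are the parameters equivalent to the true one
    ∀ θ : Θ,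
      (∀ θ' : Θ, HMT.contrast lam (q θ') (g θ') Y (P θs) x ≤
          HMT.contrast lam (q θ) (g θ) Y (P θs) x) ↔
        HMT.SameObservedLaw Y (P θ) (P θs) := by
  obtain ⟨σm, σp, hσ, hq⟩ := hreg.bounded_q
  obtain ⟨b, hb⟩ := hL1.bounded_g
  let ge : Θ → 𝒳 → 𝒴 → ℝ≥0∞ := fun θ x y => ENNReal.ofReal (g θ x y)
  have hmod : ∀ θ, IsMixingModel (Q θ) (G θ) (ν θ) (ge θ) lam μ σm σp b := fun θ =>
    ⟨hdom.isMixing hreg.pos_g hσ hq hb θ, (hstat θ).invariant, hdom.density_g θ⟩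
  have hY : ∀ v, Measurable (Y v) := ((hstat θs).isHMT 0).measurable
  have hL : ∀ θ, IsLimitIncrement (Q θ) (ge θ) (ν θ) Y ((σp - σm) / σm) (1 - σm / σp)
      (limitIncrement lam (q θ) (g θ) Y x) := fun θ =>
    isLimitIncrement hdom hreg.pos_g hσ hq hb Y θ (hstat θ).invariant x
  have hint : ∀ θ, Integrable (fun ω => absLog lam (ge θ) (Y Vertex.root ω)) (P θs) := fun θ =>
    integrable_absLog hdom hreg (hY _) hL1 θ
  have hlaw : ∀ θ k s, (P θ).map (fun ω => obs (fun u => Y u ω) s (Vertex.parent^[k] Vertex.root)) =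
      obsLaw (Q θ) (G θ) (ν θ) s := fun θ k s => ((hstat θ).isHMT k).map_obs s
  have hroot : (P θs).map (Y Vertex.root) = G θs ∘ₘ ν θs := by
    rw [← map_root_obsLaw (Q θs) (G θs) .nil .nil, ← hlaw θs 0,
      Measure.map_map measurable_fst (measurable_obs hY _ _)]
    rfl
  have hint' : ∀ θ, Integrable (absLog lam (ge θ)) (G θs ∘ₘ ν θs) := fun θ => by
    rw [← hroot, integrable_map_measure
      (measurable_absLog (hmod θ).isMixing.measurable_g).aestronglyMeasurable (hY _).aemeasurable]
    exact hint θ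
  have hlim : ∀ θ, Tendsto (fun k : ℕ => ((2 : ℝ) ^ k)⁻¹ *
      relEntropy (Q θ) (ge θ) (ν θ) (Q θs) (G θs) (ge θs) (ν θs) (.full k)) atTop
      (𝓝 (contrast lam (q θs) (g θs) Y (P θs) x - contrast lam (q θ) (g θ) Y (P θs) x)) :=
    fun θ => by
      have key : ∀ θ, _ := fun θ => (hL θ).tendsto_expLogLik (hmod θ).isMixing (hmod θ).invariant
        (hmod θs).invariant (hint' θ) hY (hint θ) (hlaw θs)
      refine tendsto_div_two_pow (((key θs).sub (key θ)).congr fun k => ?_)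
      unfold relEntropy
      ring
  have hle : ∀ θ, contrast lam (q θ) (g θ) Y (P θs) x ≤ contrast lam (q θs) (g θs) Y (P θs) x :=
    fun θ => sub_nonneg.1 (ge_of_tendsto (hlim θ) (Eventually.of_forall fun k =>
      mul_nonneg (by positivity)
        (relEntropy_nonneg (hmod θ) (hmod θs) (hint' θ) (hint' θs) _)))
  refine ⟨fun θ => ⟨(hL θ).integrable (hmod θ).isMixing (hmod θ).invariant hY (hint θ),
    fun x' => ⟨ae_of_all _ fun s => ?_, ?_⟩⟩, fun θ => ?_⟩
  · simp_rw [rootIncrement_eq hdom]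
    exact (hL θ).tendsto (hmod θ).isMixing x' s
  · simp_rw [rootIncrement_eq hdom]
    exact (hL θ).tendsto_eLpNorm (hmod θ).isMixing x'
  rw [sameObservedLaw_iff hY]
  have hobs : ∀ θ n, (P θ).map (fun ω => obs (fun u => Y u ω) (.full n) Vertex.root) =
      obsLaw (Q θ) (G θ) (ν θ) (.full n) := fun θ n => hlaw θ 0 _
  simp_rw [hobs]
  constructor
  · intro hmax n
    have h0 := hlim θ
    rw [le_antisymm (hmax θs) (hle θ), sub_self] at h0
    exact obsLaw_eq_of_relEntropy_nonpos (hmod θ) (hmod θs) (hint' θ) (hint' θs) _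
      (relEntropy_nonpos_of_tendsto (hmod θ) (hmod θs) (hint' θ) (hint' θs) h0 n)
  · intro hsame θ'
    have h0 := hlim θ
    simp_rw [relEntropy_eq_zero (hmod θ) (hmod θs) (hsame _), mul_zero] at h0
    have := tendsto_nhds_unique h0 tendsto_const_nhds
    linarith [hle θ']
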